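/- Let $m\ge 2$, $\kappa=m+1$ and $k=\kappa-2=m-1$. Let $\mathcal H_m$ be the Siegel upper half space of symmetric complex $m\times m$ matrices $Z=X+iY$ with $Y>0$. Let $\Gamma\subset \mathrm{Sp}_m(\mathbb Z)$ be a subgroup containing all translations $\begin{pmatrix}1&B\\0&1\end{pmatrix}$ with $B$ integral symmetric. Let $h$ be a holomorphic Siegel cusp form of weight $k$ for $\Gamma$, that is, $h$ is holomorphic on $\mathcal H_m$, $h|_k\gamma=h$ for all $\gamma\in\Gamma$ (where $(h|_k\gamma)(Z)=\det(cZ+d)^{-k}h((aZ+b)(cZ+d)^{-1})$), and for every $\gamma\in\mathrm{Sp}_m(\mathbb Z)$ the function $h|_k\gamma$ has an absolutely convergent Fourier expansion on $\mathcal H_m$ in the terms $\exp(2\pi i\,\mathrm{tr}(TZ)/N)$ with $T>0$ half-integral, for some $N\ge1$. Write $$h(Z)=\sum_{T>0}b(T)\exp(2\pi i\,\mathrm{tr}(TZ)),$$ where here and below $T$ runs over the positive definite half-integral $m\times m$ matrices (symmetric, with diagonal entries in $\mathbb Z$ and other entries in $\tfrac12\mathbb Z$). Let $\partial_Z=\tfrac12(\partial_X-i\partial_Y)$,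 where $(\partial_X)_{\mu\nu}=\tfrac12(1+\delta_{\mu\nu})\frac{\partial}{\partial x_{\mu\nu}}$ and likewise for $\partial_Y$, and let $$\tilde h(Z)=\Delta_+^{[m]}(h)(Z)=(2i)^m\det(Y)^{-(k+\frac{1-m}2)}\det(\partial_Z)\Big(\det(Y)^{k+\frac{1-m}2}h(Z)\Big)$$ be the image of $h$ under the Maass shift operator. Let $dY_{inv}=\det(Y)^{-\frac{m+1}2}\prod_{j\le l}dY_{jl}$ on the cone of positive definite real symmetric matrices, and let $$c(m,\kappa)=(4\pi)^{-m(\kappa-\frac{m+1}2)}\,\Gamma_m\big(\kappa-\tfrac{m+1}2\big),\qquad \Gamma_m(s)=\int_{Y>0}e^{-\mathrm{tr}\,Y}\det(Y)^s\,dY_{inv}.$$ Then $\tilde h$ has a Fourier expansion $\tilde h(Z)=\sum_{T>0}A(T,Y)\exp(2\pi i\,\mathrm{tr}(TX))$, convergent absolutely at every $Z\in\mathcal H_m$, with coefficients $A(T,Y)=\int_{X\bmod 1}\tilde h(X+iY)\exp(-2\pi i\,\mathrm{tr}(TX))\,dX$. For every $T>0$ the integrals $$\int_{Y>0}A(T,Y)\exp(-2\pi\,\mathrm{tr}(TY))\det(TY)^{\kappa-\frac{m+1}2+s}\,dY_{inv}$$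 converge absolutely for complex $s$ with $\mathrm{Re}\,s>0$, and the image of $\tilde h$ under Sturm's operator of weight $\kappa$, defined by the limit $$a(T)=\lim_{\substack{s\to0\\ \mathrm{Re}\,s>0}}c(m,\kappa)^{-1}\int_{Y>0}A(T,Y)\exp(-2\pi\,\mathrm{tr}(TY))\det(TY)^{\kappa-\frac{m+1}2+s}\,dY_{inv},$$ exists and equals $$a(T)=-(4\pi)^m\det(T)\,b(T).$$ Consequently, the formal image $S_{\tilde h}(Z)=\sum_{T>0}a(T)\exp(2\pi i\,\mathrm{tr}(TZ))$ converges absolutely on $\mathcal H_m$ and $$S_{\tilde h}(Z)=(-1)^{m+1}(2i)^m\det(\partial_Z)\,h(Z).$$ -/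

import Mathlib

open scoped Topology
open Matrix MeasureTheory Filter

noncomputable section

namespace SturmScalar

/-- Index set of the entries on and above the diagonal of an `m × m` matrix. -/
abbrev SymIdx (m : ℕ) : Type := {p : Fin m × Fin m // p.1 ≤ p.2}

/-- The symmetric matrix with prescribed entries `x_{jk}`, `j ≤ k`.  This is a linear bijection of
the coordinate space with the space of symmetric matrices. -/
def symMat {R : Type*} {m : ℕ} (x : SymIdx m → R) : Matrix (Fin m) (Fin m) R :=
  Matrix.of fun i j => x ⟨(min i j, max i j), min_le_max⟩

/-- Entrywise imaginary part `Y` of `Z = X + iY`. -/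
def imPart {m : ℕ} (Z : Matrix (Fin m) (Fin m) ℂ) : Matrix (Fin m) (Fin m) ℝ := Z.map Complex.im

/-- Entrywise real part `X` of `Z = X + iY`. -/
def rePart {m : ℕ} (Z : Matrix (Fin m) (Fin m) ℂ) : Matrix (Fin m) (Fin m) ℝ := Z.map Complex.re

/-- A real matrix viewed as a complex one. -/
def toC {m : ℕ} (T : Matrix (Fin m) (Fin m) ℝ) : Matrix (Fin m) (Fin m) ℂ :=
  T.map ((↑) : ℝ → ℂ)

/-- The Siegel upper half space `H_m`. -/
def siegelHalfSpace (m : ℕ) : Set (Matrix (Fin m) (Fin m) ℂ) :=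
  {Z | Z.IsSymm ∧ (imPart Z).PosDef}

/-- Positive definite half-integral matrices: symmetric, with diagonal entries in `ℤ` and
off-diagonal entries in `½ℤ`. -/
def halfIntPos (m : ℕ) : Set (Matrix (Fin m) (Fin m) ℝ) :=
  {T | T.PosDef ∧ (∀ i, ∃ n : ℤ, T i i = n) ∧ ∀ i j, ∃ n : ℤ, 2 * T i j = n}

/-- `exp (2πi trace (T Z))`. -/
def expTr {m : ℕ} (T : Matrix (Fin m) (Fin m) ℝ) (Z : Matrix (Fin m) (Fin m) ℂ) : ℂ :=
  Complex.exp (2 * Real.pi * Complex.I * (toC T * Z).trace)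

/-! ### Siegel cusp forms -/

/-- The block `a`, `b`, `c` or `d` of an integral matrix, viewed as a complex matrix. -/
def intToC {m : ℕ} (A : Matrix (Fin m) (Fin m) ℤ) : Matrix (Fin m) (Fin m) ℂ :=
  A.map ((↑) : ℤ → ℂ)

/-- The automorphy matrix `cZ + d`. -/
def autMat {m : ℕ} (γ : Matrix.symplecticGroup (Fin m) ℤ) (Z : Matrix (Fin m) (Fin m) ℂ) :
    Matrix (Fin m) (Fin m) ℂ :=
  intToC γ.1.toBlocks₂₁ * Z + intToC γ.1.toBlocks₂₂

/-- The action `γZ = (aZ + b)(cZ + d)⁻¹`. -/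
def act {m : ℕ} (γ : Matrix.symplecticGroup (Fin m) ℤ) (Z : Matrix (Fin m) (Fin m) ℂ) :
    Matrix (Fin m) (Fin m) ℂ :=
  (intToC γ.1.toBlocks₁₁ * Z + intToC γ.1.toBlocks₁₂) * (autMat γ Z)⁻¹

/-- The slash operator `(f ∣ₖ γ)(Z) = det(cZ + d)^{-k} f(γZ)`. -/
def slash {m : ℕ} (k : ℤ) (f : Matrix (Fin m) (Fin m) ℂ → ℂ)
    (γ : Matrix.symplecticGroup (Fin m) ℤ) (Z : Matrix (Fin m) (Fin m) ℂ) : ℂ :=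
  (autMat γ Z).det ^ (-k) * f (act γ Z)

/-- Holomorphy on `H_m`, in the independent coordinates `z_{jk}`, `j ≤ k`.  Functions on `H_m` are
represented by functions on all matrices whose values outside `H_m` are irrelevant. -/
def IsHolomorphic {m : ℕ} (f : Matrix (Fin m) (Fin m) ℂ → ℂ) : Prop :=
  DifferentiableOn ℂ (fun z : SymIdx m → ℂ => f (symMat z)) {z | symMat z ∈ siegelHalfSpace m}

/-- Holomorphic Siegel cusp forms of weight `k` for a group `Γ` of integral symplectic matrices:
holomorphic on `H_m`, invariant under `Γ`, and at every cusp (that is, for every `f ∣ₖ γ` with `γ`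
in the full integral symplectic group) the Fourier expansion involves positive definite matrices
`T / N` only, where `T` is half-integral and `N` is a level depending on `γ`. -/
structure IsCuspForm {m : ℕ} (Γ : Subgroup (Matrix.symplecticGroup (Fin m) ℤ)) (k : ℤ)
    (f : Matrix (Fin m) (Fin m) ℂ → ℂ) : Prop where
  holo : IsHolomorphic f
  invariant : ∀ γ ∈ Γ, ∀ Z ∈ siegelHalfSpace m, slash k f γ Z = f Z
  cusp : ∀ γ : Matrix.symplecticGroup (Fin m) ℤ, ∃ N : ℕ, 0 < N ∧
    ∃ c : halfIntPos m → ℂ, ∀ Z ∈ siegelHalfSpace m,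
      HasSum (fun T : halfIntPos m => c T * expTr ((N : ℝ)⁻¹ • T.1) Z) (slash k f γ Z)

/-! ### Maass' differential operator -/

/-- The symmetric direction `½ (E_{μν} + E_{νμ})`; the derivative in this direction is
`½ (1 + δ_{μν}) ∂/∂x_{μν}` on functions of a symmetric matrix. -/
def symDir {m : ℕ} (μ ν : Fin m) : Matrix (Fin m) (Fin m) ℂ :=
  (2 : ℂ)⁻¹ • (Matrix.single μ ν 1 + Matrix.single ν μ 1)

/-- The entry `(∂_Z)_{μν}` of `∂_Z = ½ (∂_X - i ∂_Y)`. -/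
def partialZ {m : ℕ} (μ ν : Fin m) (F : Matrix (Fin m) (Fin m) ℂ → ℂ)
    (Z : Matrix (Fin m) (Fin m) ℂ) : ℂ :=
  (2 : ℂ)⁻¹ * (lineDeriv ℝ F Z (symDir μ ν)
    - Complex.I * lineDeriv ℝ F Z (Complex.I • symDir μ ν))

/-- `det(∂_Z) = ∑_σ sgn(σ) ∂_{0,σ(0)} ∘ ⋯ ∘ ∂_{m-1,σ(m-1)}`. -/
def detPartialZ {m : ℕ} (F : Matrix (Fin m) (Fin m) ℂ → ℂ) (Z : Matrix (Fin m) (Fin m) ℂ) : ℂ :=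
  ∑ σ : Equiv.Perm (Fin m), ((Equiv.Perm.sign σ : ℤ) : ℂ) *
    (List.finRange m).foldr (fun μ G => partialZ μ (σ μ) G) F Z

/-- The Maass shift operator on forms of scalar weight `k`. -/
def maassShift {m : ℕ} (k : ℤ) (h : Matrix (Fin m) (Fin m) ℂ → ℂ)
    (Z : Matrix (Fin m) (Fin m) ℂ) : ℂ :=
  (2 * Complex.I) ^ m * (((imPart Z)⁻¹.det ^ ((k : ℝ) + (1 - m) / 2) : ℝ) : ℂ) *
    detPartialZ (fun W => (((imPart W).det ^ ((k : ℝ) + (1 - m) / 2) : ℝ) : ℂ) * h W) Z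

/-! ### Sturm's operator -/

/-- The cone of positive definite matrices, in the coordinates `y_{jk}`, `j ≤ k`. -/
def posCone (m : ℕ) : Set (SymIdx m → ℝ) := {y | (symMat y).PosDef}

/-- The invariant measure `dY_inv = det(Y)^{-(m+1)/2} ∏_{j ≤ k} dY_{jk}` on the cone `Y > 0`. -/
def invMeasure (m : ℕ) : Measure (SymIdx m → ℝ) :=
  ((volume : Measure (SymIdx m → ℝ)).restrict (posCone m)).withDensity
    fun y => ENNReal.ofReal ((symMat y).det ^ (-((m : ℝ) + 1) / 2))

/-- The gamma function `Γ_m(s) = ∫_{Y>0} exp(-trace Y) det(Y)^s dY_inv`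
(for `Re s > (m-1)/2`). -/
def siegelGamma (m : ℕ) (s : ℂ) : ℂ :=
  ∫ y, Complex.exp (-((symMat y).trace : ℂ)) * ((symMat y).det : ℂ) ^ s ∂(invMeasure m)

/-- `c(m,κ) = (4π)^{-m(κ-(m+1)/2)} Γ_m(κ-(m+1)/2)`. -/
def sturmConst (m : ℕ) (κ : ℤ) : ℂ :=
  ((4 * Real.pi : ℝ) : ℂ) ^ (-(m : ℂ) * ((κ : ℂ) - ((m : ℂ) + 1) / 2)) *
    siegelGamma m ((κ : ℂ) - ((m : ℂ) + 1) / 2)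

/-- The Fourier coefficient
`A(T,Y) = ∫_{X mod 1} F(X + iY) exp(-2πi trace(TX)) dX` of a function `F` on `H_m` which is
periodic in `X` with respect to integral symmetric matrices. -/
def fourierCoeff {m : ℕ} (F : Matrix (Fin m) (Fin m) ℂ → ℂ) (T Y : Matrix (Fin m) (Fin m) ℝ) : ℂ :=
  ∫ x in Set.Icc (0 : SymIdx m → ℝ) 1,
    F (toC (symMat x) + Complex.I • toC Y) * expTr (-T) (toC (symMat x))

/-- The integrand (with respect to `dY_inv`)
`A(T,Y) exp(-2π trace(TY)) det(TY)^{κ-(m+1)/2+s}` of Sturm's operator. -/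
def sturmIntegrand {m : ℕ} (κ : ℤ) (A : Matrix (Fin m) (Fin m) ℝ → Matrix (Fin m) (Fin m) ℝ → ℂ)
    (T : Matrix (Fin m) (Fin m) ℝ) (s : ℂ) (y : SymIdx m → ℝ) : ℂ :=
  A T (symMat y) * Complex.exp (-(2 * Real.pi * (T * symMat y).trace : ℝ)) *
    ((T * symMat y).det : ℂ) ^ ((κ : ℂ) - ((m : ℂ) + 1) / 2 + s)

/-- Sturm's operator of weight `κ` maps the Fourier coefficients `A(T,Y)` to the number `a` at `T`:
the integrals converge absolutely for `Re s > 0`, and, normalized by `c(m,κ)⁻¹`, they tend to `a`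
as `s → 0` in the half plane `Re s > 0`. -/
def HasSturmCoeff {m : ℕ} (κ : ℤ) (A : Matrix (Fin m) (Fin m) ℝ → Matrix (Fin m) (Fin m) ℝ → ℂ)
    (T : Matrix (Fin m) (Fin m) ℝ) (a : ℂ) : Prop :=
  (∀ s : ℂ, 0 < s.re → Integrable (sturmIntegrand κ A T s) (invMeasure m)) ∧
  Tendsto (fun s : ℂ => (sturmConst m κ)⁻¹ * ∫ y, sturmIntegrand κ A T s y ∂(invMeasure m))
    (𝓝[{s : ℂ | 0 < s.re}] 0) (𝓝 a)

end SturmScalar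

end

noncomputable section

namespace SturmScalar

/-! Put `α = k + (1-m)/2`. The Leibniz rule, applied termwise to the Fourier series, gives `A(T,Y) =
b(T) P_α(T,Y) exp(-2π tr(TY))`, where `P_α(T,Y)` is, for fixed `T` and `Y`, a polynomial in `α` of
degree at most `m` (`IsFourier.fourierCoeff_maassShift`, `exists_polynomial_maassPoly`). Everything
reduces to integrating `P_α(T,Y) exp(-4π tr(TY)) det(Y)^(s+(m+1)/2)` over the cone.

For `α < -(m-1)/2` this needs no explicit knowledge of `P_α`. By the gamma integral of the cone
(`integral_gamma`), `det(Y)^α` is a superposition of the exponentials `exp(-tr(PY))` with weight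
`det(P)^(-α)`. On `exp(-tr(PY)) exp(2πi tr(TZ))` the operator `det(∂_Z)` is multiplication by
`det((i/2)(P + R))` with `R = 4πT` (`detPow_mul_maassPoly`). Integrate over `Y` before `P`: the
factor `det(P+R)` offsets a shift by one in the exponent of `det(Y)`, at the price of `∏ (s - α +
j/2)`, a ratio of two values of the gamma function. Exchanging the integrals back leaves the gamma
integral with parameter `R` (`integral_det_mul_lapKernel`).

Both sides of the resulting formula are polynomials in `α` of degree at most `m`, so Lagrange
interpolation at `m+1` very negative nodes extends it to every `α` (`integral_maassPoly`).

At weight `k = m-1` one has `α = (m-1)/2`, and the product becomes `∏ (s - j/2)` over `0 ≤ j < m`.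
Its zero at `s = 0` cancels the pole of the factor `Γ(s)` of the gamma function of the cone. Hence
the limit is finite and nonzero (`tendsto_prod_mul_gammaProd`); its sign `(-1)^(m-1)` meets the
`(-1)^m` from `(2i · i/2)^m` and yields `-1`. Termwise differentiation of the Fourier series of `h`
identifies the result with a multiple of `det(∂_Z) h`.

Differentiation under the sum and under the Laplace integral is one argument (`IsSuper`), used with
counting measure and exponents `a = b = 2π`, and with the invariant measure and `a = 0`, `b = 1`. -/

/-! ### Positive definite matrices and small perturbations -/

lemma posDef_of_pos {m : ℕ} {A : Matrix (Fin m) (Fin m) ℝ} (h : A.IsSymm)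
    (hp : ∀ x : Fin m → ℝ, x ≠ 0 → 0 < x ⬝ᵥ A *ᵥ x) : A.PosDef := by
  refine PosDef.of_dotProduct_mulVec_pos ?_ ?_
  · rw [Matrix.IsHermitian, conjTranspose_eq_transpose_of_trivial]; exact h
  · intro x hx; simpa using hp x hx

lemma _root_.Matrix.PosDef.pos_of_ne {m : ℕ} {A : Matrix (Fin m) (Fin m) ℝ} (h : A.PosDef)
    {x : Fin m → ℝ} (hx : x ≠ 0) : 0 < x ⬝ᵥ A *ᵥ x := by
  simpa using h.dotProduct_mulVec_pos hx

lemma _root_.Matrix.PosDef.isSymm {m : ℕ} {A : Matrix (Fin m) (Fin m) ℝ} (h : A.PosDef) :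
    A.IsSymm := by
  have := h.isHermitian
  rwa [Matrix.IsHermitian, conjTranspose_eq_transpose_of_trivial] at this

lemma abs_dotProduct_mulVec_le {m : ℕ} {S : Matrix (Fin m) (Fin m) ℝ} {c : ℝ}
    (hS : ∀ i j, |S i j| ≤ c) (x : Fin m → ℝ) : |x ⬝ᵥ S *ᵥ x| ≤ m ^ 2 * c * ‖x‖ ^ 2 := by
  simp only [dotProduct, mulVec, Finset.mul_sum]
  calc |∑ i, ∑ j, x i * (S i j * x j)| ≤ ∑ i : Fin m, ∑ j : Fin m, c * ‖x‖ ^ 2 := by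
        refine (Finset.abs_sum_le_sum_abs _ _).trans (Finset.sum_le_sum fun i _ => ?_)
        refine (Finset.abs_sum_le_sum_abs _ _).trans (Finset.sum_le_sum fun j _ => ?_)
        have hi : |x i| ≤ ‖x‖ := norm_le_pi_norm x i
        have hj : |x j| ≤ ‖x‖ := norm_le_pi_norm x j
        have hc := hS i j
        rw [abs_mul, abs_mul]
        calc |x i| * (|S i j| * |x j|) ≤ ‖x‖ * (c * ‖x‖) := by
              have := (abs_nonneg _).trans hc
              gcongr
          _ = c * ‖x‖ ^ 2 := by ring
    _ = m ^ 2 * c * ‖x‖ ^ 2 := by simp; ring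

/-- A positive definite matrix stays positive definite under small symmetric perturbations. -/
lemma _root_.Matrix.PosDef.exists_add {m : ℕ} {Y : Matrix (Fin m) (Fin m) ℝ} (hY : Y.PosDef) :
    ∃ c > 0, ∀ S : Matrix (Fin m) (Fin m) ℝ, S.IsSymm → (∀ i j, |S i j| ≤ c) →
      (Y + S).PosDef := by
  have hcont : Continuous fun x : Fin m → ℝ => x ⬝ᵥ Y *ᵥ x := by
    simp only [dotProduct, mulVec]; fun_prop
  obtain ⟨δ, hδ, hmin⟩ : ∃ δ > 0, ∀ x ∈ Metric.sphere (0 : Fin m → ℝ) 1, δ ≤ x ⬝ᵥ Y *ᵥ x := by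
    -- The unit sphere is empty when `m = 0`; otherwise `δ` is the minimum of the quadratic form on
    -- it.
    rcases (Metric.sphere (0 : Fin m → ℝ) 1).eq_empty_or_nonempty with he | hne
    · exact ⟨1, one_pos, by simp [he]⟩
    · obtain ⟨x, hx, hm⟩ := (isCompact_sphere (0 : Fin m → ℝ) 1).exists_isMinOn hne
        hcont.continuousOn
      refine ⟨_, hY.pos_of_ne (x := x) ?_, fun y hy => hm hy⟩
      rintro rfl
      simp at hx
  -- A perturbation with entries at most `c` changes the form by at most `m² c ‖x‖²`, and this `c`
  -- keeps that below `(δ/2) ‖x‖²`.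
  refine ⟨δ / (2 * (m ^ 2 + 1)), by positivity, fun S hS hb => posDef_of_pos (hY.isSymm.add hS) ?_⟩
  intro x hx
  have hn : 0 < ‖x‖ := norm_pos_iff.2 hx
  have h1 : δ * ‖x‖ ^ 2 ≤ x ⬝ᵥ Y *ᵥ x := by
    have := hmin (‖x‖⁻¹ • x) (by simp [norm_smul, hn.ne'])
    rw [mulVec_smul, smul_dotProduct, dotProduct_smul, smul_eq_mul, smul_eq_mul] at this
    calc δ * ‖x‖ ^ 2 ≤ (‖x‖⁻¹ * (‖x‖⁻¹ * (x ⬝ᵥ Y *ᵥ x))) * ‖x‖ ^ 2 := by gcongr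
      _ = _ := by field_simp
  have h2 := abs_dotProduct_mulVec_le hb x
  have h3 : (m : ℝ) ^ 2 * (δ / (2 * (m ^ 2 + 1))) ≤ δ / 2 := by
    rw [← mul_div_assoc, div_le_div_iff₀ (by positivity) (by positivity)]
    nlinarith [sq_nonneg (m : ℝ)]
  rw [add_mulVec, dotProduct_add]
  have h4 := neg_abs_le (x ⬝ᵥ S *ᵥ x)
  have h5 : (m : ℝ) ^ 2 * (δ / (2 * (m ^ 2 + 1))) * ‖x‖ ^ 2 ≤ δ / 2 * ‖x‖ ^ 2 := by gcongr
  have h6 : 0 < δ * ‖x‖ ^ 2 := by positivity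
  linarith

/-- With `A = Cᴴ C`, cyclicity turns the trace into that of the positive semidefinite matrix `C B
Cᴴ`. -/
lemma trace_mul_nonneg {m : ℕ} {A B : Matrix (Fin m) (Fin m) ℝ} (hA : A.PosSemidef)
    (hB : B.PosSemidef) : 0 ≤ (A * B).trace := by
  obtain ⟨C, rfl⟩ : ∃ C : Matrix (Fin m) (Fin m) ℝ, A = Cᴴ * C := by
    open scoped MatrixOrder in
    exact CStarAlgebra.nonneg_iff_eq_star_mul_self.1 hA.nonneg
  rw [Matrix.mul_assoc, trace_mul_comm]
  exact (hB.mul_mul_conjTranspose_same C).trace_nonneg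

/-! ### Coordinates on symmetric matrices and the open cone -/

lemma symMat_isSymm {R : Type*} {m : ℕ} (x : SymIdx m → R) : (symMat x).IsSymm := by
  ext i j
  simp [symMat, min_comm, max_comm]

/-- The coordinates of a symmetric matrix. -/
def symCoord {R : Type*} {m : ℕ} (A : Matrix (Fin m) (Fin m) R) (p : SymIdx m) : R := A p.1.1 p.1.2

lemma symMat_symCoord {R : Type*} {m : ℕ} {A : Matrix (Fin m) (Fin m) R} (hA : A.IsSymm) :
    symMat (symCoord A) = A := by
  ext i j
  rcases le_total i j with h | h
  · simp [symMat, symCoord, h]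
  · simp [symMat, symCoord, h, hA.apply]

lemma symCoord_symMat {R : Type*} {m : ℕ} (x : SymIdx m → R) : symCoord (symMat x) = x := by
  ext ⟨⟨i, j⟩, h⟩
  have h' : i ≤ j := h
  simp [symMat, symCoord, h']

lemma symMat_add {m : ℕ} (x y : SymIdx m → ℝ) : symMat (x + y) = symMat x + symMat y := rfl

lemma symMat_smul {m : ℕ} (c : ℝ) (x : SymIdx m → ℝ) : symMat (c • x) = c • symMat x := rfl

lemma continuous_symMat {m : ℕ} : Continuous fun x : SymIdx m → ℝ => symMat x := by
  refine continuous_matrix fun i j => ?_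
  simp only [symMat, of_apply]; fun_prop

lemma isOpen_posCone (m : ℕ) : IsOpen (posCone m) := by
  rw [Metric.isOpen_iff]
  intro y hy
  obtain ⟨c, hc, h⟩ := Matrix.PosDef.exists_add hy
  refine ⟨c, hc, fun z hz => ?_⟩
  have := h (symMat (z - y)) (symMat_isSymm _) fun i j => by
    simp only [symMat, of_apply]
    refine (norm_le_pi_norm (z - y) _).trans ?_
    rw [← dist_eq_norm]; exact (Metric.mem_ball.1 hz).le
  rwa [← symMat_add, add_sub_cancel] at this

lemma measurableSet_posCone (m : ℕ) : MeasurableSet (posCone m) := (isOpen_posCone m).measurableSet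

lemma det_pos_of_mem {m : ℕ} {y : SymIdx m → ℝ} (hy : y ∈ posCone m) : 0 < (symMat y).det :=
  Matrix.PosDef.det_pos hy

/-! ### Splitting off the first row by a Schur complement -/

/-- The symmetric matrix with first row `x` and Schur complement `W` of its `(0,0)` entry. -/
def bordered {m : ℕ} (x : Fin (m + 1) → ℝ) (W : Matrix (Fin m) (Fin m) ℝ) :
    Matrix (Fin (m + 1)) (Fin (m + 1)) ℝ :=
  of fun i j => Fin.cases (x j)
    (fun i' => Fin.cases (x i'.succ) (fun j' => W i' j' + x i'.succ * x j'.succ / x 0) j) i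

section bordered
variable {m : ℕ} (x : Fin (m + 1) → ℝ) (W : Matrix (Fin m) (Fin m) ℝ)

@[simp] lemma bordered_zero (j : Fin (m + 1)) : bordered x W 0 j = x j := rfl
@[simp] lemma bordered_succ_zero (i : Fin m) : bordered x W i.succ 0 = x i.succ := rfl
@[simp] lemma bordered_succ_succ (i j : Fin m) :
    bordered x W i.succ j.succ = W i j + x i.succ * x j.succ / x 0 := rfl

/-- Subtracting `x i / x 0` times the first row from row `i` clears the first column below `x 0` and
leaves `W` in the remaining block. -/
lemma det_bordered (hx : x 0 ≠ 0) : (bordered x W).det = x 0 * W.det := by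
  have h := det_eq_of_forall_row_eq_smul_add_const
    (A := bordered x W) (B := of fun i j => Fin.cases (x j)
      (fun i' => Fin.cases 0 (fun j' => W i' j') j) i)
    (Fin.cons 0 fun i => x i.succ / x 0) 0 rfl (by
      intro i j
      refine Fin.cases ?_ (fun i => ?_) i
      · simp
      · refine Fin.cases ?_ (fun j => ?_) j
        · simp [hx]
        · simp; ring)
  rw [h, det_succ_column_zero, Fin.sum_univ_succ]
  simp only [Fin.val_zero, pow_zero, of_apply, Fin.cases_zero, Fin.cases_succ, one_mul, mul_zero,
    zero_mul, Finset.sum_const_zero, add_zero]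
  congr 2

lemma trace_bordered :
    (bordered x W).trace = x 0 + (∑ i : Fin m, x i.succ ^ 2) / x 0 + W.trace := by
  simp only [trace, diag_apply, Fin.sum_univ_succ, bordered_zero, bordered_succ_succ,
    Finset.sum_add_distrib, Finset.sum_div, sq]
  ring

/-- This is completion of the square in the variable `z 0`. -/
lemma bordered_quadratic (hx : x 0 ≠ 0) (z : Fin (m + 1) → ℝ) :
    z ⬝ᵥ bordered x W *ᵥ z = x 0 * (z 0 + (∑ i : Fin m, x i.succ * z i.succ) / x 0) ^ 2
      + (fun i => z (Fin.succ i)) ⬝ᵥ W *ᵥ (fun i => z (Fin.succ i)) := by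
  set q := ∑ i : Fin m, x i.succ * z i.succ with hq
  have h1 : ∀ i : Fin m, (bordered x W *ᵥ z) i.succ
      = x i.succ * z 0 + (W *ᵥ fun i => z (Fin.succ i)) i + x i.succ * q / x 0 := by
    intro i
    simp only [mulVec, dotProduct, Fin.sum_univ_succ, bordered_succ_zero, bordered_succ_succ,
      add_mul, Finset.sum_add_distrib, hq, Finset.mul_sum, Finset.sum_div]
    rw [add_assoc]
    congr 2
    exact Finset.sum_congr rfl fun j _ => by ring
  have h0 : (bordered x W *ᵥ z) 0 = x 0 * z 0 + q := by
    simp [mulVec, dotProduct, Fin.sum_univ_succ, hq]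
  have h2 : ∑ i : Fin m, z i.succ * (x i.succ * z 0 + x i.succ * q / x 0)
      = q * z 0 + q * q / x 0 := by
    rw [hq, Finset.sum_mul, Finset.sum_mul, Finset.sum_div, ← Finset.sum_add_distrib]
    exact Finset.sum_congr rfl fun j _ => by ring
  rw [dotProduct, Fin.sum_univ_succ, h0]
  have h3 : ∑ i : Fin m, z i.succ * (bordered x W *ᵥ z) i.succ
      = (q * z 0 + q * q / x 0) + ∑ i : Fin m, z i.succ * (W *ᵥ fun i => z (Fin.succ i)) i := by
    rw [← h2, ← Finset.sum_add_distrib]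
    exact Finset.sum_congr rfl fun j _ => by rw [h1]; ring
  rw [h3, dotProduct]
  field_simp
  ring

lemma posDef_bordered_iff (hW : W.IsSymm) :
    (bordered x W).PosDef ↔ 0 < x 0 ∧ W.PosDef := by
  constructor
  · intro h
    have h0 : 0 < x 0 := by simpa using h.diag_pos (i := 0)
    refine ⟨h0, posDef_of_pos hW fun z hz => ?_⟩
    -- This value of the zeroth coordinate makes the completed square vanish, so only the form of
    -- `W` remains.
    have := h.pos_of_ne (x := Fin.cons (-(∑ i : Fin m, x i.succ * z i) / x 0) z) (by
      intro h
      apply hz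
      ext i
      simpa using congrFun h i.succ)
    rw [bordered_quadratic x W h0.ne'] at this
    simpa [neg_div] using this
  · rintro ⟨h0, hP⟩
    refine posDef_of_pos ?_ fun z hz => ?_
    · ext i j
      refine Fin.cases ?_ (fun i => ?_) i <;> refine Fin.cases ?_ (fun j => ?_) j <;>
        simp [hW.apply, mul_comm]
    · rw [bordered_quadratic x W h0.ne']
      by_cases hz' : (fun i => z (Fin.succ i)) = 0
      · have hz0 : z 0 ≠ 0 := by
          intro h
          apply hz
          ext i
          exact Fin.cases h (fun i => congrFun hz' i) i
        have hi : ∀ i : Fin m, z i.succ = 0 := fun i => congrFun hz' i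
        simp only [hi]
        simp
        positivity
      · have := hP.pos_of_ne hz'
        have : 0 ≤ x 0 * (z 0 + (∑ i : Fin m, x i.succ * z i.succ) / x 0) ^ 2 := by positivity
        linarith

end bordered

/-- Entries on and above the diagonal of an `(m+1) × (m+1)` matrix: the first row and the rest. -/
def symIdxSucc (m : ℕ) : Fin (m + 1) ⊕ SymIdx m ≃ SymIdx (m + 1) where
  toFun := Sum.elim (fun j => ⟨(0, j), Fin.zero_le j⟩)
    (fun p => ⟨(p.1.1.succ, p.1.2.succ), Fin.succ_le_succ_iff.2 p.2⟩)
  invFun p := if h : p.1.1 = 0 then Sum.inl p.1.2 else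
    have h2 : p.1.2 ≠ 0 := fun h' => h (Fin.le_zero_iff.1 (h' ▸ p.2))
    Sum.inr ⟨(p.1.1.pred h, p.1.2.pred h2),
      (Fin.pred_le_pred_iff (ha := h) (hb := h2)).2 p.2⟩
  left_inv := by rintro (j | p) <;> simp
  right_inv := by
    rintro ⟨⟨i, j⟩, h⟩
    rcases eq_or_ne i 0 with rfl | hi
    · simp
    · simp [hi]

/-- Coordinates of the bordered matrix with first row `x` and Schur complement `w`. -/
def borderedCoord (m : ℕ) (q : (Fin (m + 1) → ℝ) × (SymIdx m → ℝ)) : SymIdx (m + 1) → ℝ :=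
  symCoord (bordered q.1 (symMat q.2))

lemma bordered_isSymm {m : ℕ} (x : Fin (m + 1) → ℝ) {W : Matrix (Fin m) (Fin m) ℝ}
    (hW : W.IsSymm) : (bordered x W).IsSymm := by
  ext i j
  refine Fin.cases ?_ (fun i => ?_) i <;> refine Fin.cases ?_ (fun j => ?_) j <;>
        simp [hW.apply, mul_comm]

lemma symMat_borderedCoord {m : ℕ} (q : (Fin (m + 1) → ℝ) × (SymIdx m → ℝ)) :
    symMat (borderedCoord m q) = bordered q.1 (symMat q.2) :=
  symMat_symCoord (bordered_isSymm _ (symMat_isSymm _))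

/-- For a fixed first row, passing from the Schur complement to the lower block is a translation, so
the whole map is a shear followed by a relabelling of coordinates. There is no Jacobian factor, and
the locus `x 0 = 0` needs no special care because any translation will do there. -/
lemma measurePreserving_borderedCoord (m : ℕ) :
    MeasurePreserving (borderedCoord m) volume volume := by
  have h1 : MeasurePreserving (fun q : (Fin (m + 1) → ℝ) × (SymIdx m → ℝ) =>
      (q.1, q.2 + fun p : SymIdx m => q.1 p.1.1.succ * q.1 p.1.2.succ / q.1 0))
      (volume.prod volume) (volume.prod volume) := by
    refine (MeasurePreserving.id volume).skew_product
      (g := fun (x : Fin (m + 1) → ℝ) w => w + fun p : SymIdx m => x p.1.1.succ * x p.1.2.succ / x 0) ?_ ?_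
    · refine measurable_pi_lambda _ fun p => ?_
      simp only [Function.uncurry, Pi.add_apply]
      fun_prop
    · exact ae_of_all _ fun x => map_add_right_eq_self volume _
  have h2 := volume_measurePreserving_sumPiEquivProdPi_symm
    (fun _ : Fin (m + 1) ⊕ SymIdx m => ℝ)
  have h3 := volume_measurePreserving_piCongrLeft (fun _ : SymIdx (m + 1) => ℝ) (symIdxSucc m)
  have h4 := (h3.comp h2).comp h1
  convert! h4 using 1
  ext ⟨x, w⟩ p
  obtain ⟨p, rfl⟩ := (symIdxSucc m).surjective p
  rcases p with j | p
  · simp only [Function.comp, MeasurableEquiv.piCongrLeft, MeasurableEquiv.coe_mk]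
    rw [Equiv.piCongrLeft_apply_apply]
    rfl
  · simp only [Function.comp, MeasurableEquiv.piCongrLeft, MeasurableEquiv.coe_mk]
    rw [Equiv.piCongrLeft_apply_apply]
    have := congrFun (symCoord_symMat w) p
    simp only [symCoord] at this
    simp [borderedCoord, symIdxSucc, symCoord, this, MeasurableEquiv.sumPiEquivProdPi,
      Equiv.sumPiEquivProdPi]

/-! ### The gamma integral of the cone -/

/-- The integrand `exp(-tr Y) det(Y)^(s-1)` on the cone, extended by zero. -/
def coneFun (m : ℕ) (s : ℂ) : (SymIdx m → ℝ) → ℂ :=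
  (posCone m).indicator fun y =>
    Complex.exp (-((symMat y).trace : ℂ)) * ((symMat y).det : ℂ) ^ (s - 1)

/-- The factor of the integrand `coneFun` which depends on the first row. -/
def rowFun (m : ℕ) (s : ℂ) (y : ℝ) (v : Fin m → ℝ) : ℂ :=
  (Set.Ioi (0 : ℝ)).indicator (fun y => Complex.exp (-y) * (y : ℂ) ^ (s - 1)) y *
    ((∏ i, Real.exp (-y⁻¹ * v i ^ 2) : ℝ) : ℂ)

/-- Determinant, exponential of the trace and the positivity condition all factor in Schur
coordinates, which separates the variables and makes induction on `m` possible. -/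
lemma coneFun_borderedCoord (m : ℕ) (s : ℂ) (q : (Fin (m + 1) → ℝ) × (SymIdx m → ℝ)) :
    coneFun (m + 1) s (borderedCoord m q)
      = rowFun m s (q.1 0) (fun i => q.1 i.succ) * coneFun m s q.2 := by
  obtain ⟨x, w⟩ := q
  have hmem : borderedCoord m (x, w) ∈ posCone (m + 1) ↔ 0 < x 0 ∧ w ∈ posCone m := by
    rw [posCone, Set.mem_ofPred_eq, symMat_borderedCoord, posDef_bordered_iff _ _ (symMat_isSymm _)]
    rfl
  by_cases h : 0 < x 0 ∧ w ∈ posCone m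
  · rw [coneFun, Set.indicator_of_mem (hmem.2 h), rowFun, Set.indicator_of_mem (Set.mem_Ioi.2 h.1),
      coneFun, Set.indicator_of_mem h.2, symMat_borderedCoord, det_bordered _ _ h.1.ne',
      trace_bordered, ← Real.exp_sum]
    simp only
    rw [Complex.ofReal_mul, Complex.mul_cpow_ofReal_nonneg h.1.le (det_pos_of_mem h.2).le]
    have : Complex.exp (-((x 0 + (∑ i : Fin m, x i.succ ^ 2) / x 0 + (symMat w).trace : ℝ) : ℂ))
        = Complex.exp (-(x 0 : ℂ)) *
          ((Real.exp (∑ i : Fin m, -(x 0)⁻¹ * x i.succ ^ 2) : ℝ) : ℂ) *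
          Complex.exp (-((symMat w).trace : ℂ)) := by
      rw [Complex.ofReal_exp, ← Complex.exp_add, ← Complex.exp_add, ← Finset.mul_sum]
      congr 1
      push_cast
      ring
    rw [this]
    ring
  · rw [coneFun, Set.indicator_of_notMem (mt hmem.1 h)]
    rcases not_and_or.1 h with h | h
    · rw [rowFun, Set.indicator_of_notMem (by simpa using h)]
      simp
    · rw [coneFun, Set.indicator_of_notMem h]
      simp

lemma integrable_gaussian_prod (m : ℕ) {y : ℝ} (hy : 0 < y) :
    Integrable fun v : Fin m → ℝ => ∏ i, Real.exp (-y⁻¹ * v i ^ 2) :=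
  Integrable.fintype_prod (f := fun _ v => Real.exp (-y⁻¹ * v ^ 2))
    fun _ => integrable_exp_neg_mul_sq (inv_pos.2 hy)

lemma integral_gaussian_prod (m : ℕ) (y : ℝ) :
    ∫ v : Fin m → ℝ, ∏ i, Real.exp (-y⁻¹ * v i ^ 2) = √(Real.pi * y) ^ m := by
  rw [integral_fintype_prod_volume_eq_pow (fun v : ℝ => Real.exp (-y⁻¹ * v ^ 2)),
    integral_gaussian, div_inv_eq_mul, Fintype.card_fin]

/-- The `m` Gaussian integrals contribute `(π y)^(m/2)`; the power of `y` moves the argument of the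
gamma function from `s` to `s + m/2`. -/
lemma integral_rowFun_right (m : ℕ) (s : ℂ) (y : ℝ) :
    ∫ v, rowFun m s y v = (Real.pi : ℂ) ^ ((m : ℂ) / 2) *
      (Set.Ioi (0 : ℝ)).indicator (fun y => Complex.exp (-y) * (y : ℂ) ^ (s + m / 2 - 1)) y := by
  by_cases hy : y ∈ Set.Ioi (0 : ℝ)
  · have hy' : 0 < y := hy
    simp only [rowFun, Set.indicator_of_mem hy]
    rw [integral_const_mul, integral_complex_ofReal, integral_gaussian_prod,
      Real.sqrt_mul Real.pi_pos.le, mul_pow]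
    have hc : ∀ a : ℝ, 0 < a → ((√a ^ m : ℝ) : ℂ) = (a : ℂ) ^ ((m : ℂ) / 2) := by
      intro a ha
      rw [Real.sqrt_eq_rpow, ← Real.rpow_natCast, ← Real.rpow_mul ha.le, Complex.ofReal_cpow ha.le]
      push_cast
      ring_nf
    rw [Complex.ofReal_mul, hc _ Real.pi_pos, hc _ hy',
      show s + m / 2 - 1 = (s - 1) + m / 2 by ring,
      Complex.cpow_add _ _ (by exact_mod_cast hy'.ne')]
    ring
  · simp [rowFun, Set.indicator_of_notMem hy]

lemma measurable_coneFun (m : ℕ) (s : ℂ) : Measurable (coneFun m s) := by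
  refine Measurable.indicator ?_ (measurableSet_posCone m)
  have h := (continuous_symMat (m := m))
  have h1 : Continuous fun y : SymIdx m → ℝ => (symMat y).trace := h.matrix_trace
  have h2 : Continuous fun y : SymIdx m → ℝ => (symMat y).det := h.matrix_det
  have h1 := h1.measurable
  have h2 := h2.measurable
  fun_prop

lemma measurable_rowFun (m : ℕ) (s : ℂ) : Measurable fun q : ℝ × (Fin m → ℝ) =>
    rowFun m s q.1 q.2 := by
  unfold rowFun
  refine Measurable.mul ?_ (by fun_prop)
  refine Measurable.comp (g := (Set.Ioi (0 : ℝ)).indicator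
    fun y : ℝ => Complex.exp (-y) * (y : ℂ) ^ (s - 1)) ?_ measurable_fst
  exact Measurable.indicator (by fun_prop) measurableSet_Ioi

/-- Taking norms only replaces `s` by its real part, so absolute integrability can be read off from
the formula for real exponents. -/
lemma norm_rowFun (m : ℕ) (s : ℂ) (y : ℝ) (v : Fin m → ℝ) :
    (‖rowFun m s y v‖ : ℂ) = rowFun m s.re y v := by
  have hp : 0 ≤ ∏ i, Real.exp (-y⁻¹ * v i ^ 2) :=
    Finset.prod_nonneg fun _ _ => (Real.exp_pos _).le
  by_cases hy : y ∈ Set.Ioi (0 : ℝ)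
  · have hy' : 0 < y := hy
    simp only [rowFun, Set.indicator_of_mem hy, norm_mul, Complex.norm_real, Real.norm_eq_abs,
      abs_of_nonneg hp, Complex.norm_exp, Complex.norm_cpow_eq_rpow_re_of_pos hy']
    push_cast
    rw [Complex.ofReal_cpow hy'.le]
    simp
  · simp [rowFun, Set.indicator_of_notMem hy]

lemma integrable_rowFun (m : ℕ) {s : ℂ} (hs : 0 < s.re) :
    Integrable fun q : ℝ × (Fin m → ℝ) => rowFun m s q.1 q.2 := by
  rw [Measure.volume_eq_prod, integrable_prod_iff (measurable_rowFun m s).aestronglyMeasurable]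
  constructor
  · refine ae_of_all _ fun y => ?_
    by_cases hy : y ∈ Set.Ioi (0 : ℝ)
    · have h := (integrable_gaussian_prod m hy).ofReal (𝕜 := ℂ)
      simp only [rowFun]
      exact h.const_mul _
    · simp [rowFun, Set.indicator_of_notMem hy]
  · suffices h : Integrable fun y : ℝ => ((∫ v, ‖rowFun m s y v‖ : ℝ) : ℂ) from by
      simpa using h.re
    have : ∀ y : ℝ, ((∫ v, ‖rowFun m s y v‖ : ℝ) : ℂ) = ∫ v, rowFun m s.re y v := by
      intro y
      rw [← integral_complex_ofReal]
      simp only [norm_rowFun]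
    simp only [this, integral_rowFun_right]
    refine Integrable.const_mul ?_ _
    rw [integrable_indicator_iff measurableSet_Ioi]
    convert! Complex.GammaIntegral_convergent (s := s.re + m / 2) (by simp; positivity) using 2
    simp

lemma integral_rowFun (m : ℕ) {s : ℂ} (hs : 0 < s.re) :
    ∫ q : ℝ × (Fin m → ℝ), rowFun m s q.1 q.2
      = (Real.pi : ℂ) ^ ((m : ℂ) / 2) * Complex.Gamma (s + m / 2) := by
  have h := integrable_rowFun m hs
  rw [Measure.volume_eq_prod] at h ⊢
  rw [integral_prod _ h]
  simp only [integral_rowFun_right]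
  rw [integral_const_mul, integral_indicator measurableSet_Ioi,
    Complex.Gamma_eq_integral (by simp; positivity), Complex.GammaIntegral]
  simp

/-- The gamma integral of the cone of positive definite matrices. -/
theorem integral_coneFun (m : ℕ) {s : ℂ} (hs : 0 < s.re) :
    Integrable (coneFun m s) ∧ ∫ y, coneFun m s y
      = ∏ j ∈ Finset.range m, (Real.pi : ℂ) ^ ((j : ℂ) / 2) * Complex.Gamma (s + j / 2) := by
  induction m with
  | zero =>
    have h0 : coneFun 0 s = fun _ => 1 := by
      ext y
      have : y ∈ posCone 0 := posDef_of_pos (symMat_isSymm _) fun x hx =>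
        (hx (Subsingleton.elim _ _)).elim
      simp [coneFun, Set.indicator_of_mem this, trace]
    -- The coordinate space of `0 × 0` matrices is a single point of mass one, matching the empty
    -- product.
    rw [h0, Measure.volume_pi_eq_dirac (x := 0)]
    simp
  | succ m ih =>
    have hmp := measurePreserving_borderedCoord m
    have hm := (measurable_coneFun (m + 1) s)
    have hsplit := volume_preserving_piFinSuccAbove (fun _ : Fin (m + 1) => ℝ) 0
    have hrow : Integrable (fun x : Fin (m + 1) → ℝ => rowFun m s (x 0) fun i => x i.succ) ∧
        ∫ x : Fin (m + 1) → ℝ, rowFun m s (x 0) (fun i => x i.succ)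
          = (Real.pi : ℂ) ^ ((m : ℂ) / 2) * Complex.Gamma (s + m / 2) := by
      have h1 := hsplit.integrable_comp (integrable_rowFun m hs).aestronglyMeasurable
      have h2 := hsplit.integral_comp' (fun q : ℝ × (Fin m → ℝ) => rowFun m s q.1 q.2)
      rw [integral_rowFun m hs] at h2
      exact ⟨h1.2 (integrable_rowFun m hs), h2⟩
    have hI : Integrable (coneFun (m + 1) s ∘ borderedCoord m) := by
      have := hrow.1.mul_prod ih.1
      refine this.congr (ae_of_all _ fun q => ?_)
      exact (coneFun_borderedCoord m s q).symm
    refine ⟨(hmp.integrable_comp hm.aestronglyMeasurable).1 hI, ?_⟩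
    rw [← hmp.map_eq, integral_map hmp.measurable.aemeasurable hm.aestronglyMeasurable]
    simp only [coneFun_borderedCoord]
    rw [Measure.volume_eq_prod,
      integral_prod_mul (fun x : Fin (m + 1) → ℝ => rowFun m s (x 0) fun i => x i.succ)
        (coneFun m s), ih.2, hrow.2, Finset.prod_range_succ, mul_comm]

/-! ### The Jacobian of congruence on symmetric matrices -/

/-- The action `Y ↦ A Y Aᵀ` in coordinates. -/
def conjMap {m : ℕ} (A : Matrix (Fin m) (Fin m) ℝ) : (SymIdx m → ℝ) →ₗ[ℝ] (SymIdx m → ℝ) where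
  toFun y := symCoord (A * symMat y * Aᵀ)
  map_add' x y := by
    rw [symMat_add, Matrix.mul_add, Matrix.add_mul]; rfl
  map_smul' c x := by
    rw [symMat_smul, Matrix.mul_smul, Matrix.smul_mul]; rfl

lemma symMat_conjMap {m : ℕ} (A : Matrix (Fin m) (Fin m) ℝ) (y : SymIdx m → ℝ) :
    symMat (conjMap A y) = A * symMat y * Aᵀ := by
  refine symMat_symCoord (A := A * symMat y * Aᵀ) ?_
  rw [IsSymm, transpose_mul, transpose_mul, transpose_transpose, (symMat_isSymm y).eq,
    Matrix.mul_assoc]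

lemma conjMap_mul {m : ℕ} (A B : Matrix (Fin m) (Fin m) ℝ) :
    conjMap (A * B) = conjMap A ∘ₗ conjMap B := by
  refine LinearMap.ext fun y => ?_
  change symCoord (A * B * symMat y * (A * B)ᵀ) = symCoord (A * symMat (conjMap B y) * Aᵀ)
  rw [symMat_conjMap, transpose_mul]
  simp only [Matrix.mul_assoc]

lemma conjMap_one {m : ℕ} : conjMap (1 : Matrix (Fin m) (Fin m) ℝ) = LinearMap.id := by
  refine LinearMap.ext fun y => ?_
  change symCoord (1 * symMat y * 1ᵀ) = y
  rw [transpose_one, Matrix.mul_one, Matrix.one_mul, symCoord_symMat]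

lemma det_conjMap_mul {m : ℕ} (A B : Matrix (Fin m) (Fin m) ℝ) :
    LinearMap.det (conjMap (A * B)) = LinearMap.det (conjMap A) * LinearMap.det (conjMap B) := by
  rw [conjMap_mul, LinearMap.det_comp]

/-- The index `i` occurs `m - i` times as first and `i + 1` times as second entry of a pair, hence
`m + 1` times in all. -/
lemma prod_symIdx {m : ℕ} (d : Fin m → ℝ) :
    ∏ p : SymIdx m, d p.1.1 * d p.1.2 = (∏ i, d i) ^ (m + 1) := by
  have h1 : ∏ p : SymIdx m, d p.1.1 * d p.1.2
      = ∏ p ∈ Finset.univ.filter (fun p : Fin m × Fin m => p.1 ≤ p.2), d p.1 * d p.2 :=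
    (Finset.prod_subtype _ (by simp) fun p : Fin m × Fin m => d p.1 * d p.2).symm
  rw [h1, Finset.prod_filter, Fintype.prod_prod_type]
  have h2 : ∀ i j : Fin m, (if i ≤ j then d i * d j else 1)
      = (if i ≤ j then d i else 1) * (if i ≤ j then d j else 1) := by
    intro i j; split_ifs <;> simp
  simp only [h2, Finset.prod_mul_distrib]
  rw [Finset.prod_comm (f := fun i j => if i ≤ j then d j else 1), ← Finset.prod_mul_distrib,
    ← Finset.prod_pow]
  refine Finset.prod_congr rfl fun i _ => ?_
  rw [← Finset.prod_filter, ← Finset.prod_filter, Finset.prod_const, Finset.prod_const, ← pow_add]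
  congr 1
  have e1 : (Finset.univ.filter fun j : Fin m => i ≤ j) = Finset.Ici i := by ext; simp
  have e2 : (Finset.univ.filter fun j : Fin m => j ≤ i) = Finset.Iic i := by ext; simp
  rw [e1, e2, Fin.card_Ici, Fin.card_Iic]
  have := i.2
  lia

lemma det_conjMap_diagonal {m : ℕ} (d : Fin m → ℝ) :
    LinearMap.det (conjMap (diagonal d)) = (diagonal d).det ^ (m + 1) := by
  have : conjMap (diagonal d)
      = Matrix.toLin' (diagonal fun p : SymIdx m => d p.1.1 * d p.1.2) := by
    refine LinearMap.ext fun y => ?_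
    ext p
    have hp := congrFun (symCoord_symMat y) p
    simp only [symCoord] at hp
    change (diagonal d * symMat y * (diagonal d)ᵀ) p.1.1 p.1.2 = _
    rw [diagonal_transpose, mul_diagonal, diagonal_mul, hp, Matrix.toLin'_apply, mulVec_diagonal]
    ring
  rw [this, LinearMap.det_toLin', det_diagonal, det_diagonal, prod_symIdx]

/-- Conjugation by the diagonal matrix `D` with entry `2` at `i` turns the parameter `c` into `2c`.
As determinants are multiplicative and blind to conjugation, the value `δ` at `c` satisfies `δ =
δ²`; it is nonzero because transvections are invertible. -/
lemma det_conjMap_transvection {m : ℕ} {i j : Fin m} (hij : i ≠ j) (c : ℝ) :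
    LinearMap.det (conjMap (transvection i j c)) = 1 := by
  set D : Matrix (Fin m) (Fin m) ℝ := diagonal fun k => if k = i then 2 else 1 with hD
  have hcomm : D * transvection i j c = transvection i j (c + c) * D := by
    rw [transvection, transvection, Matrix.mul_add, Matrix.add_mul, Matrix.mul_one, Matrix.one_mul]
    congr 1
    ext a b
    rw [hD, diagonal_mul, mul_diagonal]
    by_cases ha : i = a
    · by_cases hb : j = b
      · subst ha hb
        simp [hij.symm]
        ring
      · simp [hb, ha, single_apply_of_ne]
    · simp [ha, single_apply_of_ne]
  have hne : ∀ c : ℝ, LinearMap.det (conjMap (transvection i j c)) ≠ 0 := by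
    intro c h0
    have h1 := det_conjMap_mul (transvection i j c) (transvection i j (-c))
    rw [transvection_mul_transvection_same _ _ hij, add_neg_cancel, transvection_zero, conjMap_one,
      LinearMap.det_id, h0, zero_mul] at h1
    exact one_ne_zero h1
  have hDne : LinearMap.det (conjMap D) ≠ 0 := by
    rw [hD, det_conjMap_diagonal, det_diagonal]
    refine pow_ne_zero _ (Finset.prod_ne_zero_iff.2 fun k _ => ?_)
    split_ifs <;> norm_num
  have h2 := det_conjMap_mul D (transvection i j c)
  rw [hcomm, det_conjMap_mul, ← transvection_mul_transvection_same _ _ hij, det_conjMap_mul,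
    mul_comm] at h2
  have h3 := mul_left_cancel₀ hDne h2
  exact mul_left_cancel₀ (hne c) (by rw [h3, mul_one])

/-- The Jacobian determinant of `Y ↦ A Y Aᵀ` on symmetric matrices. -/
lemma det_conjMap {m : ℕ} (A : Matrix (Fin m) (Fin m) ℝ) (hA : A.det ≠ 0) :
    LinearMap.det (conjMap A) = A.det ^ (m + 1) := by
  refine diagonal_transvection_induction_of_det_ne_zero
    (fun A => LinearMap.det (conjMap A) = A.det ^ (m + 1)) A hA
    (fun d _ => det_conjMap_diagonal d) (fun t => ?_) (fun A B _ _ h1 h2 => ?_)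
  · rw [TransvectionStruct.toMatrix, det_conjMap_transvection t.hij, det_transvection_of_ne _ _ t.hij,
      one_pow]
  · rw [det_conjMap_mul, h1, h2, det_mul, mul_pow]

/-! ### The invariant measure and the gamma integral with a parameter -/

lemma measurable_det {m : ℕ} : Measurable fun y : SymIdx m → ℝ => (symMat y).det :=
  (continuous_symMat.matrix_det).measurable

lemma ae_invMeasure_mem (m : ℕ) : ∀ᵐ y ∂(invMeasure m), y ∈ posCone m :=
  (withDensity_absolutelyContinuous _ _).ae_le (ae_restrict_mem (measurableSet_posCone m))

instance (m : ℕ) : SFinite (invMeasure m) := by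
  unfold invMeasure; infer_instance

lemma measurable_invDensity (m : ℕ) : Measurable fun y : SymIdx m → ℝ =>
    ENNReal.ofReal ((symMat y).det ^ (-((m : ℝ) + 1) / 2)) := by
  have := measurable_det (m := m)
  fun_prop

lemma integrable_invMeasure_iff {m : ℕ} (f : (SymIdx m → ℝ) → ℂ) :
    Integrable f (invMeasure m) ↔ Integrable ((posCone m).indicator fun y =>
      ((symMat y).det : ℂ) ^ (-((m : ℂ) + 1) / 2) * f y) := by
  rw [invMeasure, integrable_withDensity_iff_integrable_smul' (measurable_invDensity m)
    (ae_of_all _ fun _ => ENNReal.ofReal_lt_top), integrable_indicator_iff (measurableSet_posCone m)]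
  refine integrable_congr ?_
  filter_upwards [ae_restrict_mem (measurableSet_posCone m)] with y hy
  have := det_pos_of_mem hy
  rw [ENNReal.toReal_ofReal (by positivity), Complex.real_smul, Complex.ofReal_cpow this.le]
  push_cast
  rfl

lemma integral_invMeasure {m : ℕ} (f : (SymIdx m → ℝ) → ℂ) :
    ∫ y, f y ∂(invMeasure m) = ∫ y, (posCone m).indicator (fun y =>
      ((symMat y).det : ℂ) ^ (-((m : ℂ) + 1) / 2) * f y) y := by
  rw [invMeasure, integral_withDensity_eq_integral_toReal_smul (measurable_invDensity m)
    (ae_of_all _ fun _ => ENNReal.ofReal_lt_top), integral_indicator (measurableSet_posCone m)]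
  refine integral_congr_ae ?_
  filter_upwards [ae_restrict_mem (measurableSet_posCone m)] with y hy
  have := det_pos_of_mem hy
  rw [ENNReal.toReal_ofReal (by positivity), Complex.real_smul, Complex.ofReal_cpow this.le]
  push_cast
  rfl

/-- The product `∏_{j < m} π^{j/2} Γ(s + j/2)`, the value of `Γ_m` at `s + (m-1)/2`. -/
def gammaProd (m : ℕ) (s : ℂ) : ℂ :=
  ∏ j ∈ Finset.range m, (Real.pi : ℂ) ^ ((j : ℂ) / 2) * Complex.Gamma (s + j / 2)

lemma _root_.Matrix.PosDef.exists_eq_transpose_mul {m : ℕ} {R : Matrix (Fin m) (Fin m) ℝ}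
    (hR : R.PosDef) : ∃ A : Matrix (Fin m) (Fin m) ℝ, R = Aᵀ * A ∧ A.det ≠ 0 := by
  obtain ⟨A, hA⟩ : ∃ A : Matrix (Fin m) (Fin m) ℝ, R = Aᴴ * A := by
    open scoped MatrixOrder in
    exact CStarAlgebra.nonneg_iff_eq_star_mul_self.1 hR.posSemidef.nonneg
  rw [conjTranspose_eq_transpose_of_trivial] at hA
  refine ⟨A, hA, fun h => hR.det_pos.ne' ?_⟩
  rw [hA, det_mul, h, mul_zero]

/-- The gamma integral with a positive definite parameter `R`. -/
theorem integral_gamma {m : ℕ} {R : Matrix (Fin m) (Fin m) ℝ} (hR : R.PosDef) {s : ℂ}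
    (hs : 0 < s.re) :
    Integrable (fun y : SymIdx m → ℝ => Complex.exp (-(((R * symMat y).trace : ℝ) : ℂ)) *
        ((symMat y).det : ℂ) ^ (s + (m - 1) / 2)) (invMeasure m) ∧
      ∫ y : SymIdx m → ℝ, Complex.exp (-(((R * symMat y).trace : ℝ) : ℂ)) *
        ((symMat y).det : ℂ) ^ (s + (m - 1) / 2) ∂(invMeasure m)
      = (R.det : ℂ) ^ (-(s + (m - 1) / 2)) * gammaProd m s := by
  -- With `R = Aᵀ A`, the substitution `Y ↦ A Y Aᵀ` turns `tr(RY)` into the trace of the new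
  -- variable, which reduces to the case `R = 1`.
  obtain ⟨A, rfl, hA⟩ := hR.exists_eq_transpose_mul
  have hRdet := hR.det_pos
  set d := (Aᵀ * A).det with hd
  have hd2 : d = A.det ^ 2 := by rw [hd, det_mul, det_transpose, sq]
  have hdne : (d : ℂ) ≠ 0 := by exact_mod_cast hRdet.ne'
  have hmem : ∀ y, conjMap A y ∈ posCone m ↔ y ∈ posCone m := by
    intro y
    have hu : IsUnit A := (isUnit_iff_isUnit_det A).2 (isUnit_iff_ne_zero.2 hA)
    have := Matrix.IsUnit.posDef_star_right_conjugate_iff (x := symMat y) hu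
    rw [star_eq_conjTranspose, conjTranspose_eq_transpose_of_trivial, ← symMat_conjMap] at this
    exact this
  have hcomp : ∀ y, coneFun m s (conjMap A y) = (d : ℂ) ^ (s - 1) *
      (posCone m).indicator (fun y => ((symMat y).det : ℂ) ^ (-((m : ℂ) + 1) / 2) *
        (Complex.exp (-(((Aᵀ * A * symMat y).trace : ℝ) : ℂ)) *
        ((symMat y).det : ℂ) ^ (s + (m - 1) / 2))) y := by
    intro y
    by_cases hy : y ∈ posCone m
    · have hy0 := det_pos_of_mem hy
      rw [coneFun, Set.indicator_of_mem ((hmem y).2 hy), Set.indicator_of_mem hy, symMat_conjMap]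
      have e1 : (A * symMat y * Aᵀ).trace = (Aᵀ * A * symMat y).trace := by
        rw [trace_mul_comm, ← Matrix.mul_assoc]
      have e2 : (A * symMat y * Aᵀ).det = d * (symMat y).det := by
        rw [hd, det_mul, det_mul, det_mul]; ring
      rw [e1, e2, Complex.ofReal_mul, Complex.mul_cpow_ofReal_nonneg hRdet.le hy0.le,
        show s - 1 = -((m : ℂ) + 1) / 2 + (s + (m - 1) / 2) by ring,
        Complex.cpow_add _ _ (by exact_mod_cast hy0.ne' : ((symMat y).det : ℂ) ≠ 0)]
      ring
    · rw [coneFun, Set.indicator_of_notMem (mt (hmem y).1 hy), Set.indicator_of_notMem hy, mul_zero]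
  have hdet : LinearMap.det (conjMap A) ≠ 0 := by
    rw [det_conjMap A hA]; exact pow_ne_zero _ hA
  have hmap := Measure.map_linearMap_addHaar_eq_smul_addHaar
    (volume : Measure (SymIdx m → ℝ)) hdet
  have hmeas : Measurable (conjMap A) := (conjMap A).continuous_of_finiteDimensional.measurable
  have hIcone := (integral_coneFun m hs)
  have hpow : (d : ℂ) ^ (s - 1) ≠ 0 := by simp [Complex.cpow_eq_zero_iff, hdne]
  -- The Jacobian is `det(A)^(m+1)` and `d = det(A)²`, which accounts for the exponent `(m+1)/2`.
  have hfactor : |(LinearMap.det (conjMap A))⁻¹| = d ^ (-((m : ℝ) + 1) / 2) := by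
    rw [det_conjMap A hA, abs_inv, abs_pow, hd2, ← sq_abs, ← Real.rpow_natCast,
      ← Real.rpow_natCast, ← Real.rpow_mul (abs_nonneg _), ← Real.rpow_neg (abs_nonneg _)]
    congr 1
    push_cast
    ring
  have hI : Integrable (fun y => coneFun m s (conjMap A y)) := by
    refine (integrable_map_measure (measurable_coneFun m s).aestronglyMeasurable
      hmeas.aemeasurable).1 ?_
    rw [hmap]
    exact hIcone.1.smul_measure ENNReal.ofReal_ne_top
  have hE : ∫ y, coneFun m s (conjMap A y) = (d : ℂ) ^ (-((m : ℂ) + 1) / 2) * gammaProd m s := by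
    rw [← integral_map hmeas.aemeasurable (measurable_coneFun m s).aestronglyMeasurable, hmap,
      integral_smul_measure, hIcone.2, hfactor,
      ENNReal.toReal_ofReal (by positivity), Complex.real_smul, Complex.ofReal_cpow hRdet.le]
    push_cast
    rfl
  simp only [hcomp] at hI hE
  refine ⟨(integrable_invMeasure_iff _).2 ?_, ?_⟩
  · exact (integrable_const_mul_iff (isUnit_iff_ne_zero.2 hpow) _).1 hI
  · rw [integral_invMeasure]
    rw [integral_const_mul] at hE
    refine mul_left_cancel₀ hpow (hE.trans ?_)
    rw [← mul_assoc, ← Complex.cpow_add _ _ hdne]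
    congr 2
    ring

lemma siegelGamma_eq {m : ℕ} {s : ℂ} (hs : 0 < s.re) :
    siegelGamma m (s + (m - 1) / 2) = gammaProd m s := by
  have := (integral_gamma (Matrix.PosDef.one : (1 : Matrix (Fin m) (Fin m) ℝ).PosDef) hs).2
  simpa [siegelGamma] using this

/-! ### Lines in the half space and iterated derivatives -/

lemma imPart_add_smul {m : ℕ} (Z v : Matrix (Fin m) (Fin m) ℂ) (t : ℝ) :
    imPart (Z + t • v) = imPart Z + t • imPart v := by
  ext i j; simp [imPart]

lemma rePart_add_smul {m : ℕ} (Z v : Matrix (Fin m) (Fin m) ℂ) (t : ℝ) :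
    rePart (Z + t • v) = rePart Z + t • rePart v := by
  ext i j; simp [rePart]

lemma isSymm_imPart {m : ℕ} {v : Matrix (Fin m) (Fin m) ℂ} (hv : v.IsSymm) : (imPart v).IsSymm := by
  ext i j; simp [imPart, hv.apply]

lemma isSymm_rePart {m : ℕ} {v : Matrix (Fin m) (Fin m) ℂ} (hv : v.IsSymm) : (rePart v).IsSymm := by
  ext i j; simp [rePart, hv.apply]

lemma exists_abs_entry_le {m : ℕ} (S : Matrix (Fin m) (Fin m) ℝ) : ∃ K > 0, ∀ i j, |S i j| ≤ K := by
  refine ⟨1 + ∑ i, ∑ j, |S i j|, by positivity, fun i j => ?_⟩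
  have h1 : |S i j| ≤ ∑ j, |S i j| :=
    Finset.single_le_sum (f := fun j => |S i j|) (fun _ _ => abs_nonneg _) (Finset.mem_univ j)
  have h2 : ∑ j, |S i j| ≤ ∑ i, ∑ j, |S i j| :=
    Finset.single_le_sum (f := fun i => ∑ j, |S i j|)
      (fun _ _ => Finset.sum_nonneg fun _ _ => abs_nonneg _) (Finset.mem_univ i)
  linarith

lemma _root_.Matrix.PosDef.exists_add_smul {m : ℕ} {Y S : Matrix (Fin m) (Fin m) ℝ}
    (hY : Y.PosDef) (hS : S.IsSymm) : ∃ ε > 0, ∀ t : ℝ, |t| ≤ ε → (Y + t • S).PosDef := by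
  obtain ⟨c, hc, h⟩ := hY.exists_add
  obtain ⟨K, hK, hb⟩ := exists_abs_entry_le S
  refine ⟨c / K, by positivity, fun t ht => h _ (hS.smul t) fun i j => ?_⟩
  rw [Matrix.smul_apply, smul_eq_mul, abs_mul]
  calc |t| * |S i j| ≤ c / K * K := by gcongr; exact hb i j
    _ = c := by field_simp

lemma exists_line_mem {m : ℕ} {Z v : Matrix (Fin m) (Fin m) ℂ} (hZ : Z ∈ siegelHalfSpace m)
    (hv : v.IsSymm) : ∃ ε > 0, ∀ t : ℝ, |t| ≤ ε → Z + t • v ∈ siegelHalfSpace m := by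
  obtain ⟨ε, hε, h⟩ := hZ.2.exists_add_smul (isSymm_imPart hv)
  refine ⟨ε, hε, fun t ht => ⟨hZ.1.add (hv.smul t), ?_⟩⟩
  rw [imPart_add_smul]
  exact h t ht

lemma eventually_line_mem {m : ℕ} {Z v : Matrix (Fin m) (Fin m) ℂ} (hZ : Z ∈ siegelHalfSpace m)
    (hv : v.IsSymm) : ∀ᶠ t : ℝ in 𝓝 0, Z + t • v ∈ siegelHalfSpace m := by
  obtain ⟨ε, hε, h⟩ := exists_line_mem hZ hv
  filter_upwards [Metric.ball_mem_nhds (0 : ℝ) hε] with t ht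
  exact h t (by simpa using (Metric.mem_ball.1 ht).le)

lemma symDir_isSymm {m : ℕ} (μ ν : Fin m) : (symDir μ ν).IsSymm := by
  rw [IsSymm, symDir, transpose_smul, transpose_add, transpose_single, transpose_single, add_comm]

lemma I_smul_symDir_isSymm {m : ℕ} (μ ν : Fin m) : (Complex.I • symDir μ ν).IsSymm :=
  (symDir_isSymm μ ν).smul _

/-- The derivatives are taken along symmetric directions only, and such lines stay in the half space
for small parameters; values elsewhere never matter. -/
lemma partialZ_congr {m : ℕ} {F G : Matrix (Fin m) (Fin m) ℂ → ℂ}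
    (h : ∀ Z ∈ siegelHalfSpace m, F Z = G Z) (μ ν : Fin m) {Z : Matrix (Fin m) (Fin m) ℂ}
    (hZ : Z ∈ siegelHalfSpace m) : partialZ μ ν F Z = partialZ μ ν G Z := by
  have key : ∀ v : Matrix (Fin m) (Fin m) ℂ, v.IsSymm → lineDeriv ℝ F Z v = lineDeriv ℝ G Z v := by
    intro v hv
    refine Filter.EventuallyEq.deriv_eq ?_
    filter_upwards [eventually_line_mem hZ hv] with t ht using h _ ht
  rw [partialZ, partialZ, key _ (symDir_isSymm μ ν), key _ (I_smul_symDir_isSymm μ ν)]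

/-- The iterated derivative `∂_{l₀} ∂_{l₁} ⋯` along a list of index pairs. -/
def iterZ {m : ℕ} (l : List (Fin m × Fin m)) (F : Matrix (Fin m) (Fin m) ℂ → ℂ) :
    Matrix (Fin m) (Fin m) ℂ → ℂ :=
  l.foldr (fun p G => partialZ p.1 p.2 G) F

@[simp] lemma iterZ_nil {m : ℕ} (F : Matrix (Fin m) (Fin m) ℂ → ℂ) : iterZ [] F = F := rfl
@[simp] lemma iterZ_cons {m : ℕ} (p : Fin m × Fin m) (l : List (Fin m × Fin m))
    (F : Matrix (Fin m) (Fin m) ℂ → ℂ) : iterZ (p :: l) F = partialZ p.1 p.2 (iterZ l F) := rfl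

lemma iterZ_congr {m : ℕ} {F G : Matrix (Fin m) (Fin m) ℂ → ℂ}
    (h : ∀ Z ∈ siegelHalfSpace m, F Z = G Z) (l : List (Fin m × Fin m)) :
    ∀ Z ∈ siegelHalfSpace m, iterZ l F Z = iterZ l G Z := by
  induction l with
  | nil => exact h
  | cons p l ih => exact fun Z hZ => partialZ_congr ih _ _ hZ

/-- The list `(0, σ 0), …, (m-1, σ (m-1))`. -/
def permList {m : ℕ} (σ : Equiv.Perm (Fin m)) : List (Fin m × Fin m) :=
  (List.finRange m).map fun μ => (μ, σ μ)

lemma length_permList {m : ℕ} (σ : Equiv.Perm (Fin m)) : (permList σ).length = m := by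
  simp [permList]

lemma detPartialZ_eq {m : ℕ} (F : Matrix (Fin m) (Fin m) ℂ → ℂ) (Z : Matrix (Fin m) (Fin m) ℂ) :
    detPartialZ F Z = ∑ σ : Equiv.Perm (Fin m), ((Equiv.Perm.sign σ : ℤ) : ℂ) *
      iterZ (permList σ) F Z := by
  simp [detPartialZ, iterZ, permList, List.foldr_map]

/-- This is the Leibniz formula in the row order used for `det(∂_Z)`, so that the operator's action
on an exponential can be recognised as a determinant. -/
lemma det_eq_sum_permList {m : ℕ} {R : Type*} [CommRing R] (A : Matrix (Fin m) (Fin m) R) :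
    A.det = ∑ σ : Equiv.Perm (Fin m), ((Equiv.Perm.sign σ : ℤ) : R) *
      ((permList σ).map fun p => A p.1 p.2).prod := by
  rw [← det_transpose, det_apply']
  refine Finset.sum_congr rfl fun σ _ => ?_
  rw [permList, List.map_map, ← List.ofFn_eq_map, List.prod_ofFn]
  rfl

/-! ### Differentiating superpositions of exponentials -/

/-- The exponential `exp(i a tr(TX) - b tr(TY))`. -/
def expRI {m : ℕ} (a b : ℝ) (T : Matrix (Fin m) (Fin m) ℝ) (Z : Matrix (Fin m) (Fin m) ℂ) : ℂ :=
  Complex.exp (Complex.I * a * ((T * rePart Z).trace : ℝ) - b * ((T * imPart Z).trace : ℝ))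

lemma norm_expRI {m : ℕ} (a b : ℝ) (T : Matrix (Fin m) (Fin m) ℝ) (Z : Matrix (Fin m) (Fin m) ℂ) :
    ‖expRI a b T Z‖ = Real.exp (-b * (T * imPart Z).trace) := by
  rw [expRI, Complex.norm_exp]
  simp

/-- Data of a superposition `∫ c(ω) exp(i a tr(T_ω X) - b tr(T_ω Y)) dν(ω)` which converges
absolutely for all `Y > 0`. -/
structure IsSuper {Ω : Type*} [MeasurableSpace Ω] {m : ℕ} (ρ : Measure Ω) (b : ℝ)
    (T : Ω → Matrix (Fin m) (Fin m) ℝ) (c : Ω → ℂ) : Prop where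
  meas_coeff : AEStronglyMeasurable c ρ
  meas_mat : ∀ i j, Measurable fun ω => T ω i j
  psd : ∀ᵐ ω ∂ρ, (T ω).PosSemidef
  integrable : ∀ Y : Matrix (Fin m) (Fin m) ℝ, Y.PosDef →
    Integrable (fun ω => ‖c ω‖ * Real.exp (-b * (T ω * Y).trace)) ρ

/-- Pairing the positive semidefinite `T` with both `Y + εS` and `Y - εS` gives nonnegative traces,
which bounds `tr(TS)` from both sides. -/
lemma abs_trace_mul_le {m : ℕ} {T Y S : Matrix (Fin m) (Fin m) ℝ} (hT : T.PosSemidef) {ε : ℝ}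
    (hε : 0 < ε) (hp : (Y + ε • S).PosDef) (hn : (Y + (-ε) • S).PosDef) :
    |(T * S).trace| ≤ ε⁻¹ * (T * Y).trace := by
  have h1 := trace_mul_nonneg hT hp.posSemidef
  have h2 := trace_mul_nonneg hT hn.posSemidef
  rw [Matrix.mul_add, trace_add, Matrix.mul_smul, trace_smul, smul_eq_mul] at h1 h2
  rw [inv_mul_eq_div, le_div_iff₀ hε]
  rcases abs_cases (T * S).trace with ⟨h, _⟩ | ⟨h, _⟩ <;> rw [h] <;> linarith

lemma mul_exp_neg_le {x : ℝ} (b : ℝ) (hb : 0 < b) :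
    x * Real.exp (-b * x) ≤ 2 / b * Real.exp (-b * (x / 2)) := by
  have h := Real.add_one_le_exp (b * x / 2)
  have h2 : x ≤ 2 / b * Real.exp (b * x / 2) := by
    rw [div_mul_eq_mul_div, le_div_iff₀ hb]; nlinarith
  calc x * Real.exp (-b * x) ≤ 2 / b * Real.exp (b * x / 2) * Real.exp (-b * x) := by gcongr
    _ = _ := by rw [mul_assoc, ← Real.exp_add]; ring_nf

lemma measurable_trace_mul {Ω : Type*} [MeasurableSpace Ω] {m : ℕ}
    {T : Ω → Matrix (Fin m) (Fin m) ℝ} (h : ∀ i j, Measurable fun ω => T ω i j)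
    (S : Matrix (Fin m) (Fin m) ℝ) : Measurable fun ω => (T ω * S).trace := by
  simp only [trace, diag_apply, mul_apply]
  fun_prop

lemma trace_mul_smul_half {m : ℕ} (T Y : Matrix (Fin m) (Fin m) ℝ) :
    (T * ((2 : ℝ)⁻¹ • Y)).trace = (T * Y).trace / 2 := by
  rw [Matrix.mul_smul, trace_smul, smul_eq_mul]; ring

section Super
variable {Ω : Type*} [MeasurableSpace Ω] {m : ℕ} {ρ : Measure Ω} {a b : ℝ}
  {T : Ω → Matrix (Fin m) (Fin m) ℝ} {c : Ω → ℂ}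

/-- A factor linear in `T` is at most a multiple of `tr(TY)`, and half of the exponential decay
absorbs it. Replacing `Y` by `Y/2` is harmless because integrability holds for every `Y > 0`; the
class is therefore stable under differentiation. -/
lemma IsSuper.mul_coeff (h : IsSuper ρ b T c) (hb : 0 < b) {S : Matrix (Fin m) (Fin m) ℝ}
    (hS : S.IsSymm) (κ : ℂ) : IsSuper ρ b T fun ω => κ * ((T ω * S).trace : ℝ) * c ω where
  meas_coeff := by
    have h1 := measurable_trace_mul h.meas_mat S
    have h2 : Measurable fun ω => κ * (((T ω * S).trace : ℝ) : ℂ) := by fun_prop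
    exact h2.aestronglyMeasurable.mul h.meas_coeff
  meas_mat := h.meas_mat
  psd := h.psd
  integrable Y hY := by
    obtain ⟨ε, hε, hpd⟩ := hY.exists_add_smul hS
    have h0 := (h.integrable ((2 : ℝ)⁻¹ • Y) (hY.smul (by norm_num))).const_mul
      (‖κ‖ * (ε⁻¹ * (2 / b)))
    refine h0.mono' ?_ ?_
    · have h1 := measurable_trace_mul h.meas_mat S
      have h2 := measurable_trace_mul h.meas_mat Y
      have h3 : Measurable fun ω => κ * (((T ω * S).trace : ℝ) : ℂ) := by fun_prop
      have h4 : Measurable fun ω => Real.exp (-b * (T ω * Y).trace) := by fun_prop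
      exact (h3.aestronglyMeasurable.mul h.meas_coeff).norm.mul h4.aestronglyMeasurable
    · filter_upwards [h.psd] with ω hω
      have h1 := abs_trace_mul_le hω hε (hpd ε (abs_of_pos hε).le)
        (hpd (-ε) (by rw [abs_neg, abs_of_pos hε]))
      rw [norm_mul, norm_norm, norm_mul, norm_mul, Complex.norm_real, Real.norm_eq_abs,
        Real.norm_eq_abs, Real.abs_exp, trace_mul_smul_half]
      calc ‖κ‖ * |(T ω * S).trace| * ‖c ω‖ * Real.exp (-b * (T ω * Y).trace)
          ≤ ‖κ‖ * (ε⁻¹ * (T ω * Y).trace) * ‖c ω‖ * Real.exp (-b * (T ω * Y).trace) := by gcongr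
        _ = ‖κ‖ * ε⁻¹ * ‖c ω‖ * ((T ω * Y).trace * Real.exp (-b * (T ω * Y).trace)) := by ring
        _ ≤ ‖κ‖ * ε⁻¹ * ‖c ω‖ * (2 / b * Real.exp (-b * ((T ω * Y).trace / 2))) := by
            exact mul_le_mul_of_nonneg_left (mul_exp_neg_le b hb) (by positivity)
        _ = _ := by ring

lemma IsSuper.aestronglyMeasurable (h : IsSuper ρ b T c) (a : ℝ) (Z : Matrix (Fin m) (Fin m) ℂ) :
    AEStronglyMeasurable (fun ω => c ω * expRI a b (T ω) Z) ρ := by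
  have h1 := measurable_trace_mul h.meas_mat (rePart Z)
  have h2 := measurable_trace_mul h.meas_mat (imPart Z)
  have h3 : Measurable fun ω => expRI a b (T ω) Z := by
    unfold expRI; fun_prop
  exact h.meas_coeff.mul h3.aestronglyMeasurable

lemma IsSuper.integrable_exp (h : IsSuper ρ b T c) (a : ℝ) {Z : Matrix (Fin m) (Fin m) ℂ}
    (hZ : Z ∈ siegelHalfSpace m) : Integrable (fun ω => c ω * expRI a b (T ω) Z) ρ := by
  refine (h.integrable _ hZ.2).mono' (h.aestronglyMeasurable a Z) (ae_of_all _ fun ω => ?_)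
  rw [norm_mul, norm_expRI]

/-- Differentiation of a superposition of exponentials under the integral sign. -/
lemma IsSuper.hasLineDerivAt (h : IsSuper ρ b T c) (hb : 0 < b) (a : ℝ)
    {Z v : Matrix (Fin m) (Fin m) ℂ} (hZ : Z ∈ siegelHalfSpace m) (hv : v.IsSymm) :
    HasLineDerivAt ℝ (fun Z => ∫ ω, c ω * expRI a b (T ω) Z ∂ρ)
      (∫ ω, (Complex.I * a * ((T ω * rePart v).trace : ℝ) - b * ((T ω * imPart v).trace : ℝ))
        * c ω * expRI a b (T ω) Z ∂ρ) Z v := by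
  obtain ⟨ε, hε, hpd⟩ := hZ.2.exists_add_smul (isSymm_imPart hv)
  have hr := h.mul_coeff hb (isSymm_rePart hv) (Complex.I * a)
  have hi := h.mul_coeff hb (isSymm_imPart hv) b
  have hexp : ∀ (ω : Ω) (t : ℝ), expRI a b (T ω) (Z + t • v) = Complex.exp
      ((Complex.I * a * ((T ω * rePart Z).trace : ℝ) - b * ((T ω * imPart Z).trace : ℝ)) + t *
      (Complex.I * a * ((T ω * rePart v).trace : ℝ) - b * ((T ω * imPart v).trace : ℝ))) := by
    intro ω t
    rw [expRI, rePart_add_smul, imPart_add_smul]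
    congr 1
    simp only [Matrix.mul_add, Matrix.mul_smul, trace_add, trace_smul, smul_eq_mul]
    push_cast
    ring
  set D : ℝ → Ω → ℂ := fun t ω =>
    (Complex.I * a * ((T ω * rePart v).trace : ℝ) - b * ((T ω * imPart v).trace : ℝ))
        * c ω * expRI a b (T ω) (Z + t • v) with hD
  have hbound : Integrable (fun ω => ‖Complex.I * a * ((T ω * rePart v).trace : ℝ) * c ω‖ *
      Real.exp (-b * (T ω * ((2 : ℝ)⁻¹ • imPart Z)).trace) +
      ‖b * ((T ω * imPart v).trace : ℝ) * c ω‖ *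
      Real.exp (-b * (T ω * ((2 : ℝ)⁻¹ • imPart Z)).trace)) ρ :=
    (hr.integrable _ (hZ.2.smul (by norm_num))).add (hi.integrable _ (hZ.2.smul (by norm_num)))
  have hZ0 : Z + (0 : ℝ) • v = Z := by simp
  have key := hasDerivAt_integral_of_dominated_loc_of_deriv_le (𝕜 := ℝ) (μ := ρ)
    (F := fun t ω => c ω * expRI a b (T ω) (Z + t • v)) (F' := D) (x₀ := 0)
    (s := Metric.ball 0 (ε / 2)) (Metric.ball_mem_nhds _ (by positivity))
    (Eventually.of_forall fun t => h.aestronglyMeasurable a _)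
    (by rw [hZ0]; exact h.integrable_exp a hZ)
    (by
      have h1 := (hr.aestronglyMeasurable a Z).sub (hi.aestronglyMeasurable a Z)
      refine h1.congr (ae_of_all _ fun ω => ?_)
      simp only [hD, hZ0, Pi.sub_apply]
      ring)
    (by
      filter_upwards [h.psd] with ω hω t ht
      have htb : |t| < ε / 2 := by simpa using ht
      have h1 := abs_trace_mul_le hω hε (hpd ε (abs_of_pos hε).le)
        (hpd (-ε) (by rw [abs_neg, abs_of_pos hε]))
      -- On the ball of radius `ε/2` the exponent keeps at least half its value at the centre, which
      -- gives a dominating function independent of `t`.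
      have h2 : (T ω * imPart Z).trace / 2 ≤ (T ω * imPart (Z + t • v)).trace := by
        rw [imPart_add_smul, Matrix.mul_add, trace_add, Matrix.mul_smul, trace_smul, smul_eq_mul]
        have h3 : |t * (T ω * imPart v).trace| ≤ ε / 2 * (ε⁻¹ * (T ω * imPart Z).trace) := by
          rw [abs_mul]; gcongr
        have h4 : ε / 2 * (ε⁻¹ * (T ω * imPart Z).trace) = (T ω * imPart Z).trace / 2 := by
          field_simp
        rw [h4] at h3
        have := (abs_le.1 h3).1
        linarith
      have h5 : Real.exp (-b * (T ω * imPart (Z + t • v)).trace) ≤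
          Real.exp (-b * (T ω * ((2 : ℝ)⁻¹ • imPart Z)).trace) := by
        rw [trace_mul_smul_half]
        exact Real.exp_le_exp.2 (by nlinarith)
      rw [hD]
      simp only
      rw [norm_mul, norm_expRI, sub_mul, ← add_mul]
      gcongr
      exact norm_sub_le _ _)
    hbound
    (by
      refine ae_of_all _ fun ω t _ => ?_
      simp only [hD, hexp]
      have h1 : HasDerivAt (fun t : ℝ => (Complex.I * a * ((T ω * rePart Z).trace : ℝ) -
          b * ((T ω * imPart Z).trace : ℝ)) + (t : ℂ) *
          (Complex.I * a * ((T ω * rePart v).trace : ℝ) - b * ((T ω * imPart v).trace : ℝ)))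
          (1 * (Complex.I * a * ((T ω * rePart v).trace : ℝ) - b * ((T ω * imPart v).trace : ℝ)))
          t := (((hasDerivAt_id t).ofReal_comp).mul_const _).const_add _
      refine (h1.cexp.const_mul (c ω)).congr_deriv ?_
      ring)
  have := key.2
  simp only [hD, hZ0] at this
  exact this

lemma trace_mul_symDir {T : Matrix (Fin m) (Fin m) ℝ} (hT : T.IsSymm) (μ ν : Fin m) :
    (T * rePart (symDir μ ν)).trace = T μ ν := by
  have : rePart (symDir μ ν) = (2 : ℝ)⁻¹ • (Matrix.single μ ν 1 + Matrix.single ν μ 1) := by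
    ext i j
    simp [rePart, symDir, Matrix.single_apply]
    split_ifs <;> norm_num
  rw [this, Matrix.mul_smul, trace_smul, Matrix.mul_add, trace_add, trace_mul_single,
    trace_mul_single, hT.apply]
  simp
  ring

lemma imPart_symDir (μ ν : Fin m) : imPart (symDir μ ν) = 0 := by
  ext i j
  simp [imPart, symDir, Matrix.single_apply]
  split_ifs <;> simp

lemma imPart_I_smul (v : Matrix (Fin m) (Fin m) ℂ) : imPart (Complex.I • v) = rePart v := by
  ext i j; simp [imPart, rePart]

lemma rePart_I_smul (v : Matrix (Fin m) (Fin m) ℂ) : rePart (Complex.I • v) = -imPart v := by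
  ext i j; simp [imPart, rePart]

lemma IsSuper.entry_coeff (h : IsSuper ρ b T c) (hb : 0 < b) (κ : ℂ) (μ ν : Fin m) :
    IsSuper ρ b T fun ω => κ * (T ω μ ν : ℝ) * c ω := by
  have h1 := h.mul_coeff hb (isSymm_rePart (symDir_isSymm μ ν)) κ
  have hae : (fun ω => κ * ((T ω * rePart (symDir μ ν)).trace : ℝ) * c ω) =ᵐ[ρ]
      fun ω => κ * (T ω μ ν : ℝ) * c ω := by
    filter_upwards [h.psd] with ω hω
    have hs : (T ω).IsSymm := by
      have := hω.isHermitian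
      rwa [Matrix.IsHermitian, conjTranspose_eq_transpose_of_trivial] at this
    rw [trace_mul_symDir hs]
  refine ⟨h1.meas_coeff.congr hae, h.meas_mat, h.psd, fun Y hY => (h1.integrable Y hY).congr ?_⟩
  filter_upwards [hae] with ω hω
  rw [hω]

/-- The `X`-derivative of the exponential brings down `i a T μ ν` and the `Y`-derivative `-b T μ ν`;
the combination `½ (∂_X - i ∂_Y)` has the symbol `i (a + b)/2 · T μ ν`. -/
lemma IsSuper.partialZ (h : IsSuper ρ b T c) (hb : 0 < b) (a : ℝ)
    {Z : Matrix (Fin m) (Fin m) ℂ} (hZ : Z ∈ siegelHalfSpace m) (μ ν : Fin m) :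
    partialZ μ ν (fun Z => ∫ ω, c ω * expRI a b (T ω) Z ∂ρ) Z =
      ∫ ω, Complex.I * ((a + b) / 2) * (T ω μ ν : ℝ) * c ω * expRI a b (T ω) Z ∂ρ := by
  have h1 := (h.hasLineDerivAt hb a hZ (symDir_isSymm μ ν)).lineDeriv
  have h2 := (h.hasLineDerivAt hb a hZ (I_smul_symDir_isSymm μ ν)).lineDeriv
  have hs : ∀ᵐ ω ∂ρ, (T ω).IsSymm := by
    filter_upwards [h.psd] with ω hω
    have := hω.isHermitian
    rwa [Matrix.IsHermitian, conjTranspose_eq_transpose_of_trivial] at this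
  have e1 : ∫ ω, (Complex.I * a * ((T ω * rePart (symDir μ ν)).trace : ℝ) -
      b * ((T ω * imPart (symDir μ ν)).trace : ℝ)) * c ω * expRI a b (T ω) Z ∂ρ
      = Complex.I * a * ∫ ω, 1 * (T ω μ ν : ℝ) * c ω * expRI a b (T ω) Z ∂ρ := by
    rw [← integral_const_mul]
    refine integral_congr_ae ?_
    filter_upwards [hs] with ω hω
    rw [imPart_symDir, trace_mul_symDir hω]
    simp
    ring
  have e2 : ∫ ω, (Complex.I * a * ((T ω * rePart (Complex.I • symDir μ ν)).trace : ℝ) -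
      b * ((T ω * imPart (Complex.I • symDir μ ν)).trace : ℝ)) * c ω * expRI a b (T ω) Z ∂ρ
      = -b * ∫ ω, 1 * (T ω μ ν : ℝ) * c ω * expRI a b (T ω) Z ∂ρ := by
    rw [← integral_const_mul]
    refine integral_congr_ae ?_
    filter_upwards [hs] with ω hω
    rw [imPart_I_smul, rePart_I_smul, imPart_symDir, trace_mul_symDir hω]
    simp
    ring
  have e3 : ∫ ω, Complex.I * ((a + b) / 2) * (T ω μ ν : ℝ) * c ω * expRI a b (T ω) Z ∂ρ
      = Complex.I * ((a + b) / 2) * ∫ ω, 1 * (T ω μ ν : ℝ) * c ω * expRI a b (T ω) Z ∂ρ := by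
    rw [← integral_const_mul]
    exact integral_congr_ae (ae_of_all _ fun ω => by ring)
  rw [SturmScalar.partialZ, h1, h2, e1, e2, e3]
  ring

lemma IsSuper.list_coeff (h : IsSuper ρ b T c) (hb : 0 < b) (κ : ℂ) (l : List (Fin m × Fin m)) :
    IsSuper ρ b T fun ω => (l.map fun p => κ * (T ω p.1 p.2 : ℝ)).prod * c ω := by
  induction l with
  | nil => simpa using h
  | cons p l ih =>
    have := ih.entry_coeff hb κ p.1 p.2
    simpa [mul_assoc] using this

lemma IsSuper.iterZ (h : IsSuper ρ b T c) (hb : 0 < b) (a : ℝ) (l : List (Fin m × Fin m)) :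
    ∀ Z ∈ siegelHalfSpace m, iterZ l (fun Z => ∫ ω, c ω * expRI a b (T ω) Z ∂ρ) Z =
      ∫ ω, (l.map fun p => Complex.I * ((a + b) / 2) * (T ω p.1 p.2 : ℝ)).prod * c ω *
        expRI a b (T ω) Z ∂ρ := by
  induction l with
  | nil => intro Z hZ; simp
  | cons p l ih =>
    intro Z hZ
    rw [iterZ_cons, partialZ_congr ih _ _ hZ,
      (h.list_coeff hb (Complex.I * ((a + b) / 2)) l).partialZ hb a hZ]
    simp [mul_assoc]

end Super

/-! ### Line differentiability on the half space and the Leibniz rule -/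

/-- Differentiability along all symmetric directions at all points of `H_m`. -/
def LineDiff {m : ℕ} (F : Matrix (Fin m) (Fin m) ℂ → ℂ) : Prop :=
  ∀ Z ∈ siegelHalfSpace m, ∀ v : Matrix (Fin m) (Fin m) ℂ, v.IsSymm → LineDifferentiableAt ℝ F Z v

section LineDiff
variable {m : ℕ} {F G : Matrix (Fin m) (Fin m) ℂ → ℂ}

lemma LineDiff.congr (hF : LineDiff F) (h : ∀ Z ∈ siegelHalfSpace m, G Z = F Z) : LineDiff G := by
  intro Z hZ v hv
  refine (show DifferentiableAt ℝ _ _ from hF Z hZ v hv).congr_of_eventuallyEq ?_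
  filter_upwards [eventually_line_mem hZ hv] with t ht using h _ ht

lemma LineDiff.add (hF : LineDiff F) (hG : LineDiff G) : LineDiff fun Z => F Z + G Z :=
  fun Z hZ v hv => DifferentiableAt.add (hF Z hZ v hv) (hG Z hZ v hv)

lemma LineDiff.mul (hF : LineDiff F) (hG : LineDiff G) : LineDiff fun Z => F Z * G Z :=
  fun Z hZ v hv => DifferentiableAt.mul (hF Z hZ v hv) (hG Z hZ v hv)

lemma LineDiff.const (c : ℂ) : LineDiff fun _ : Matrix (Fin m) (Fin m) ℂ => c :=
  fun _ _ _ _ => differentiableAt_const _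

lemma LineDiff.partialZ_add (hF : LineDiff F) (hG : LineDiff G) (μ ν : Fin m)
    {Z : Matrix (Fin m) (Fin m) ℂ} (hZ : Z ∈ siegelHalfSpace m) :
    partialZ μ ν (fun Z => F Z + G Z) Z = partialZ μ ν F Z + partialZ μ ν G Z := by
  have key : ∀ v : Matrix (Fin m) (Fin m) ℂ, v.IsSymm →
      lineDeriv ℝ (fun Z => F Z + G Z) Z v = lineDeriv ℝ F Z v + lineDeriv ℝ G Z v :=
    fun v hv => deriv_add (hF Z hZ v hv) (hG Z hZ v hv)
  rw [partialZ, key _ (symDir_isSymm μ ν), key _ (I_smul_symDir_isSymm μ ν), partialZ, partialZ]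
  ring

lemma LineDiff.partialZ_mul (hF : LineDiff F) (hG : LineDiff G) (μ ν : Fin m)
    {Z : Matrix (Fin m) (Fin m) ℂ} (hZ : Z ∈ siegelHalfSpace m) :
    partialZ μ ν (fun Z => F Z * G Z) Z = partialZ μ ν F Z * G Z + F Z * partialZ μ ν G Z := by
  have key : ∀ v : Matrix (Fin m) (Fin m) ℂ, v.IsSymm → lineDeriv ℝ (fun Z => F Z * G Z) Z v
      = lineDeriv ℝ F Z v * G Z + F Z * lineDeriv ℝ G Z v := by
    intro v hv
    have := deriv_mul (𝕜 := ℝ) (hF Z hZ v hv) (hG Z hZ v hv)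
    simp only [zero_smul, add_zero] at this
    exact this
  rw [partialZ, key _ (symDir_isSymm μ ν), key _ (I_smul_symDir_isSymm μ ν), partialZ, partialZ]
  ring

lemma partialZ_const (c : ℂ) (μ ν : Fin m) (Z : Matrix (Fin m) (Fin m) ℂ) :
    partialZ μ ν (fun _ => c) Z = 0 := by
  simp [partialZ, lineDeriv]

lemma LineDiff.list_sum {ι : Type*} {φ : ι → Matrix (Fin m) (Fin m) ℂ → ℂ}
    (h : ∀ i, LineDiff (φ i)) (L : List ι) : LineDiff fun Z => (L.map fun i => φ i Z).sum := by
  induction L with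
  | nil => simpa using LineDiff.const 0
  | cons i L ih => simpa using (h i).add ih

lemma partialZ_list_sum {ι : Type*} {φ : ι → Matrix (Fin m) (Fin m) ℂ → ℂ}
    (h : ∀ i, LineDiff (φ i)) (L : List ι) (μ ν : Fin m)
    {Z : Matrix (Fin m) (Fin m) ℂ} (hZ : Z ∈ siegelHalfSpace m) :
    partialZ μ ν (fun Z => (L.map fun i => φ i Z).sum) Z
      = (L.map fun i => partialZ μ ν (φ i) Z).sum := by
  induction L with
  | nil => simpa using partialZ_const 0 μ ν Z
  | cons i L ih =>
    have := (h i).partialZ_add (LineDiff.list_sum h L) μ ν hZ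
    simp only [List.map_cons, List.sum_cons]
    rw [this, ih]

/-- All ways to split a list into a sublist and its complement. -/
def splits {ι : Type*} : List ι → List (List ι × List ι)
  | [] => [([], [])]
  | a :: l => (splits l).map (fun q => (a :: q.1, q.2)) ++ (splits l).map (fun q => (q.1, a :: q.2))

lemma length_le_of_mem_splits {ι : Type*} {l : List ι} {q : List ι × List ι} (hq : q ∈ splits l) :
    q.1.length ≤ l.length := by
  induction l generalizing q with
  | nil =>
    rw [splits, List.mem_singleton] at hq
    simp [hq]
  | cons a l ih =>
    rw [splits, List.mem_append, List.mem_map, List.mem_map] at hq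
    rcases hq with ⟨q', h', rfl⟩ | ⟨q', h', rfl⟩
    · simpa using ih h'
    · exact (ih h').trans (by simp)

/-- The same index set governs the Leibniz rule below. The sums that rule produces can thus be
folded back into products of sums, and then into a determinant. -/
lemma prod_map_add {ι R : Type*} [CommRing R] (f g : ι → R) (l : List ι) :
    (l.map fun i => f i + g i).prod
      = ((splits l).map fun q => (q.1.map f).prod * (q.2.map g).prod).sum := by
  induction l with
  | nil => simp [splits]
  | cons a l ih =>
    simp only [List.map_cons, List.prod_cons, ih, splits, List.map_append, List.map_map,
      List.sum_append, add_mul]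
    rw [← List.sum_map_mul_left, ← List.sum_map_mul_left]
    congr 2
    · refine List.map_congr_left fun q _ => ?_
      simp [mul_assoc]
    · refine List.map_congr_left fun q _ => ?_
      simp [mul_left_comm]

/-- The Leibniz rule for iterated derivatives. -/
lemma iterZ_mul (hF : ∀ l, LineDiff (iterZ l F)) (hG : ∀ l, LineDiff (iterZ l G))
    (l : List (Fin m × Fin m)) : ∀ Z ∈ siegelHalfSpace m, iterZ l (fun Z => F Z * G Z) Z
      = ((splits l).map fun q => iterZ q.1 F Z * iterZ q.2 G Z).sum := by
  induction l with
  | nil => intro Z _; simp [splits]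
  | cons p l ih =>
    intro Z hZ
    rw [iterZ_cons, partialZ_congr ih _ _ hZ,
      partialZ_list_sum (φ := fun (q : List (Fin m × Fin m) × List (Fin m × Fin m)) Z => iterZ q.1 F Z * iterZ q.2 G Z)
        (fun q => (hF q.1).mul (hG q.2)) _ _ _ hZ]
    simp only [(hF _).partialZ_mul (hG _) _ _ hZ, List.sum_map_add, splits, List.map_append,
      List.map_map, List.sum_append]
    rfl

end LineDiff

lemma IsSuper.lineDiff {Ω : Type*} [MeasurableSpace Ω] {m : ℕ} {ρ : Measure Ω} {b : ℝ}
    {T : Ω → Matrix (Fin m) (Fin m) ℝ} {c : Ω → ℂ} (h : IsSuper ρ b T c) (hb : 0 < b) (a : ℝ)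
    (l : List (Fin m × Fin m)) :
    LineDiff (SturmScalar.iterZ l fun Z => ∫ ω, c ω * expRI a b (T ω) Z ∂ρ) := by
  refine LineDiff.congr (F := fun Z => ∫ ω, (l.map fun p => Complex.I * ((a + b) / 2) *
      (T ω p.1 p.2 : ℝ)).prod * c ω * expRI a b (T ω) Z ∂ρ) ?_ (h.iterZ hb a l)
  intro Z hZ v hv
  exact ((h.list_coeff hb _ l).hasLineDerivAt hb a hZ hv).lineDifferentiableAt

/-! ### Derivatives of powers of the determinant -/

/-- The function `det(Y)^α` of `Z = X + iY`. -/
def detPow {m : ℕ} (α : ℝ) (Z : Matrix (Fin m) (Fin m) ℂ) : ℂ := (((imPart Z).det ^ α : ℝ) : ℂ)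

/-- The set `det(Y) > 0`. -/
def detPosSet (m : ℕ) : Set (Matrix (Fin m) (Fin m) ℂ) := {Z | 0 < (imPart Z).det}

/-- The condition `det(Y) > 0` is open among all complex matrices, whereas the half space in general
is not. Fréchet derivatives of powers of `det(Y)` are therefore handled on the larger set and
restricted afterwards. -/
lemma siegelHalfSpace_subset (m : ℕ) : siegelHalfSpace m ⊆ detPosSet m := fun _ hZ => hZ.2.det_pos

lemma contDiff_det_imPart (m : ℕ) : ContDiff ℝ (⊤ : ℕ∞)
    fun z : Fin m → Fin m → ℂ => (imPart (of z)).det := by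
  have h : ∀ i j : Fin m, ContDiff ℝ (⊤ : ℕ∞) fun z : Fin m → Fin m → ℂ => (z i j).im := by
    intro i j
    have h1 : ContDiff ℝ (⊤ : ℕ∞) fun z : Fin m → Fin m → ℂ => z i j :=
      (contDiff_apply_apply ℝ ℂ i j)
    exact Complex.imCLM.contDiff.comp h1
  simp only [det_apply', imPart, map_apply, of_apply]
  exact ContDiff.sum fun σ _ => contDiff_const.mul (contDiff_prod fun i _ => h _ _)

/-- The set `det(Y) > 0` in the space of arrays. -/
def detPosArr (m : ℕ) : Set (Fin m → Fin m → ℂ) := {z | of z ∈ detPosSet m}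

lemma isOpen_detPosArr (m : ℕ) : IsOpen (detPosArr m) :=
  isOpen_lt continuous_const (contDiff_det_imPart m).continuous

/-- Smooth complex functions on the set `det(Y) > 0`. -/
def SmoothDet {m : ℕ} (A : Matrix (Fin m) (Fin m) ℂ → ℂ) : Prop :=
  ContDiffOn ℝ (⊤ : ℕ∞) (fun z => A (of z)) (detPosArr m)

section SmoothDet
variable {m : ℕ} {A B : Matrix (Fin m) (Fin m) ℂ → ℂ}

lemma SmoothDet.differentiableAt (h : SmoothDet A) {Z : Matrix (Fin m) (Fin m) ℂ}
    (hZ : Z ∈ detPosSet m) : DifferentiableAt ℝ (fun z => A (of z)) (of.symm Z) :=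
  (h.differentiableOn (by simp)).differentiableAt ((isOpen_detPosArr m).mem_nhds hZ)

lemma SmoothDet.lineDiff (h : SmoothDet A) : LineDiff A := fun _ hZ v _ =>
  (h.differentiableAt (siegelHalfSpace_subset m hZ)).lineDifferentiableAt (v := of.symm v)

lemma SmoothDet.partialZ_eq (h : SmoothDet A) {Z : Matrix (Fin m) (Fin m) ℂ}
    (hZ : Z ∈ detPosSet m) (μ ν : Fin m) : partialZ μ ν A Z =
      (2 : ℂ)⁻¹ * (fderiv ℝ (fun z => A (of z)) (of.symm Z) (of.symm (symDir μ ν)) -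
        Complex.I * fderiv ℝ (fun z => A (of z)) (of.symm Z)
          (of.symm (Complex.I • symDir μ ν))) := by
  have key : ∀ v : Matrix (Fin m) (Fin m) ℂ, lineDeriv ℝ A Z v
      = fderiv ℝ (fun z => A (of z)) (of.symm Z) (of.symm v) :=
    fun v => (h.differentiableAt hZ).lineDeriv_eq_fderiv (v := of.symm v)
  rw [partialZ, key, key]

lemma SmoothDet.partialZ (h : SmoothDet A) (μ ν : Fin m) : SmoothDet (partialZ μ ν A) := by
  have h1 : ContDiffOn ℝ (⊤ : ℕ∞) (fderiv ℝ (fun z => A (of z))) (detPosArr m) :=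
    h.fderiv_of_isOpen (isOpen_detPosArr m) (by simp)
  have h2 : ∀ v : Fin m → Fin m → ℂ, ContDiffOn ℝ (⊤ : ℕ∞)
      (fun z => fderiv ℝ (fun z => A (of z)) z v) (detPosArr m) :=
    fun v => h1.clm_apply contDiffOn_const
  refine ContDiffOn.congr ?_ fun z hz => h.partialZ_eq (Z := of z) hz μ ν
  exact contDiffOn_const.mul ((h2 _).sub (contDiffOn_const.mul (h2 _)))

lemma partialZ_congr_detPosSet (h : ∀ Z ∈ detPosSet m, A Z = B Z) (μ ν : Fin m)
    {Z : Matrix (Fin m) (Fin m) ℂ} (hZ : Z ∈ detPosSet m) :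
    SturmScalar.partialZ μ ν A Z = SturmScalar.partialZ μ ν B Z := by
  have h1 : (fun z => A (of z)) =ᶠ[𝓝 (of.symm Z)] fun z => B (of z) := by
    filter_upwards [(isOpen_detPosArr m).mem_nhds hZ] with W hW using h _ hW
  have key : ∀ v : Matrix (Fin m) (Fin m) ℂ, lineDeriv ℝ A Z v = lineDeriv ℝ B Z v :=
    fun v => h1.lineDeriv_eq (v := of.symm v)
  rw [SturmScalar.partialZ, SturmScalar.partialZ, key, key]

lemma SmoothDet.mul (hA : SmoothDet A) (hB : SmoothDet B) : SmoothDet fun Z => A Z * B Z :=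
  ContDiffOn.mul hA hB

lemma SmoothDet.add (hA : SmoothDet A) (hB : SmoothDet B) : SmoothDet fun Z => A Z + B Z :=
  ContDiffOn.add hA hB

lemma smoothDet_const (c : ℂ) : SmoothDet fun _ : Matrix (Fin m) (Fin m) ℂ => c := contDiffOn_const

lemma SmoothDet.partialZ_mul (hA : SmoothDet A) (hB : SmoothDet B)
    {Z : Matrix (Fin m) (Fin m) ℂ} (hZ : Z ∈ detPosSet m) (μ ν : Fin m) :
    SturmScalar.partialZ μ ν (fun Z => A Z * B Z) Z =
      SturmScalar.partialZ μ ν A Z * B Z + A Z * SturmScalar.partialZ μ ν B Z := by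
  rw [(hA.mul hB).partialZ_eq hZ, hA.partialZ_eq hZ, hB.partialZ_eq hZ,
    fderiv_fun_mul (hA.differentiableAt hZ) (hB.differentiableAt hZ)]
  simp
  ring

lemma smoothDet_sum {s : Finset ℕ} {A : ℕ → Matrix (Fin m) (Fin m) ℂ → ℂ}
    (hA : ∀ j, SmoothDet (A j)) (x : ℕ → ℂ) : SmoothDet fun Z => ∑ j ∈ s, x j * A j Z :=
  ContDiffOn.sum fun j _ => contDiffOn_const.mul (hA j)

lemma partialZ_sum {s : Finset ℕ} {A : ℕ → Matrix (Fin m) (Fin m) ℂ → ℂ}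
    (hA : ∀ j, SmoothDet (A j)) (x : ℕ → ℂ) {Z : Matrix (Fin m) (Fin m) ℂ} (hZ : Z ∈ detPosSet m)
    (μ ν : Fin m) : SturmScalar.partialZ μ ν (fun Z => ∑ j ∈ s, x j * A j Z) Z
      = ∑ j ∈ s, x j * SturmScalar.partialZ μ ν (A j) Z := by
  rw [(smoothDet_sum hA x).partialZ_eq hZ,
    fderiv_fun_sum fun j _ => ((hA j).differentiableAt hZ).const_mul (x j)]
  simp only [(hA _).partialZ_eq hZ, fderiv_const_mul ((hA _).differentiableAt hZ),
    _root_.sum_apply, _root_.smul_apply, smul_eq_mul]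
  rw [Finset.mul_sum, ← Finset.sum_sub_distrib, Finset.mul_sum]
  exact Finset.sum_congr rfl fun j _ => by ring

end SmoothDet

/-- The function `log det(Y)`. -/
def logDet {m : ℕ} (Z : Matrix (Fin m) (Fin m) ℂ) : ℂ := (Real.log (imPart Z).det : ℂ)

lemma smoothDet_logDet (m : ℕ) : SmoothDet (logDet (m := m)) := by
  have : ContDiffOn ℝ (⊤ : ℕ∞) (fun z : Fin m → Fin m → ℂ => Real.log (imPart (of z)).det)
      (detPosArr m) := (contDiff_det_imPart m).contDiffOn.log fun _ hZ => (ne_of_gt hZ)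
  exact Complex.ofRealCLM.contDiff.comp_contDiffOn this

lemma detPow_eq_exp {m : ℕ} (α : ℝ) {Z : Matrix (Fin m) (Fin m) ℂ} (hZ : Z ∈ detPosSet m) :
    detPow α Z = Complex.exp (α * logDet Z) := by
  have : 0 < (imPart Z).det := hZ
  rw [detPow, logDet, Real.rpow_def_of_pos this]
  push_cast
  ring_nf

lemma smoothDet_detPow {m : ℕ} (α : ℝ) : SmoothDet (detPow (m := m) α) := by
  have h : ContDiffOn ℝ (⊤ : ℕ∞) (fun z : Fin m → Fin m → ℂ => Complex.exp (α * logDet (of z)))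
      (detPosArr m) := (contDiffOn_const.mul (smoothDet_logDet m)).cexp
  exact h.congr fun Z hZ => detPow_eq_exp α hZ

/-- Writing the power as `exp(α log det Y)` shows that each differentiation produces exactly one
factor `α`, the source of the degree bound in `α`. -/
lemma partialZ_detPow {m : ℕ} (α : ℝ) {Z : Matrix (Fin m) (Fin m) ℂ} (hZ : Z ∈ detPosSet m)
    (μ ν : Fin m) : partialZ μ ν (detPow α) Z = detPow α Z * (α * partialZ μ ν logDet Z) := by
  have h0 := ((smoothDet_logDet m).differentiableAt hZ)
  have h1 : HasFDerivAt (fun z : Fin m → Fin m → ℂ => Complex.exp (α * logDet (of z)))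
      (Complex.exp (α * logDet Z) • ((α : ℂ) • fderiv ℝ (fun z => logDet (of z)) (of.symm Z)))
      (of.symm Z) :=
    (h0.hasFDerivAt.const_mul (α : ℂ)).cexp
  have h2 : fderiv ℝ (fun z => detPow α (of z)) (of.symm Z) =
      Complex.exp (α * logDet Z) • ((α : ℂ) • fderiv ℝ (fun z => logDet (of z)) (of.symm Z)) := by
    refine HasFDerivAt.fderiv (h1.congr_of_eventuallyEq ?_)
    filter_upwards [(isOpen_detPosArr m).mem_nhds hZ] with W hW using detPow_eq_exp α hW
  rw [(smoothDet_detPow α).partialZ_eq hZ, (smoothDet_logDet m).partialZ_eq hZ, h2,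
    detPow_eq_exp α hZ]
  simp
  ring

/-- Iterated derivatives of `det(Y)^α` are `det(Y)^α` times a polynomial in `α`. -/
lemma iterZ_detPow {m : ℕ} (l : List (Fin m × Fin m)) :
    ∃ A : ℕ → Matrix (Fin m) (Fin m) ℂ → ℂ, (∀ j, SmoothDet (A j)) ∧
      (∀ j, l.length < j → A j = fun _ => 0) ∧ ∀ α : ℝ, ∀ Z ∈ detPosSet m,
        iterZ l (detPow α) Z
          = detPow α Z * ∑ j ∈ Finset.range (l.length + 1), (α : ℂ) ^ j * A j Z := by
  induction l with
  | nil =>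
    refine ⟨fun j => if j = 0 then fun _ => 1 else fun _ => 0, fun j => ?_, fun j hj => ?_, ?_⟩
    · dsimp only
      split_ifs <;> exact smoothDet_const _
    · simp only [List.length_nil] at hj
      simp [hj.ne']
    · intro α Z _
      simp
  | cons p l ih =>
    obtain ⟨A, hA, hA0, h⟩ := ih
    have hL := (smoothDet_logDet m).partialZ p.1 p.2
    -- The new coefficient of `α^(i+1)` is `(∂ log det) A_i + ∂ A_(i+1)`: one term from
    -- differentiating the power, one from the old coefficients.
    refine ⟨fun j => Nat.casesOn j (partialZ p.1 p.2 (A 0))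
      (fun i => fun Z => partialZ p.1 p.2 logDet Z * A i Z + partialZ p.1 p.2 (A (i + 1)) Z),
      fun j => ?_, fun j hj => ?_, fun α Z hZ => ?_⟩
    · cases j with
      | zero => exact (hA 0).partialZ _ _
      | succ i => exact (hL.mul (hA i)).add ((hA _).partialZ _ _)
    · cases j with
      | zero => simp at hj
      | succ i =>
        simp only [List.length_cons, Nat.add_lt_add_iff_right] at hj
        ext Z
        simp only [hA0 i hj, hA0 (i + 1) (by lia), partialZ_const]
        simp
    · rw [iterZ_cons, partialZ_congr_detPosSet (h α) _ _ hZ,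
        (smoothDet_detPow α).partialZ_mul (smoothDet_sum hA _) hZ, partialZ_sum hA _ hZ,
        partialZ_detPow α hZ, List.length_cons, mul_assoc, ← mul_add]
      congr 1
      have hlast : partialZ p.1 p.2 (A (l.length + 1)) Z = 0 := by
        rw [hA0 _ (by lia), partialZ_const]
      rw [Finset.sum_range_succ' _ (l.length + 1)]
      have e1 : ∑ j ∈ Finset.range (l.length + 1), (α : ℂ) ^ j * partialZ p.1 p.2 (A j) Z
          = ∑ j ∈ Finset.range (l.length + 1), (α : ℂ) ^ (j + 1) * partialZ p.1 p.2 (A (j + 1)) Z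
            + (α : ℂ) ^ 0 * partialZ p.1 p.2 (A 0) Z := by
        rw [← Finset.sum_range_succ' (fun j => (α : ℂ) ^ j * partialZ p.1 p.2 (A j) Z),
          Finset.sum_range_succ _ (l.length + 1), hlast, mul_zero, add_zero]
      rw [e1, ← add_assoc, Finset.mul_sum, ← Finset.sum_add_distrib]
      congr 1
      exact Finset.sum_congr rfl fun j _ => by ring

lemma lineDiff_iterZ_detPow {m : ℕ} (α : ℝ) (l : List (Fin m × Fin m)) :
    LineDiff (iterZ l (detPow α)) := by
  obtain ⟨A, hA, -, h⟩ := iterZ_detPow l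
  exact ((smoothDet_detPow α).mul (smoothDet_sum hA _)).lineDiff.congr
    fun Z hZ => h α Z (siegelHalfSpace_subset m hZ)

/-- Operators with constant coefficients commute with translations. Applied to real translations,
this shows that the derivatives of `det(Y)^α` depend on `Y` alone. -/
lemma iterZ_translate {m : ℕ} (F : Matrix (Fin m) (Fin m) ℂ → ℂ) (B : Matrix (Fin m) (Fin m) ℂ)
    (l : List (Fin m × Fin m)) : ∀ Z, iterZ l F (Z + B) = iterZ l (fun W => F (W + B)) Z := by
  induction l with
  | nil => intro Z; rfl
  | cons p l ih =>
    intro Z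
    simp only [iterZ_cons, partialZ, lineDeriv]
    simp only [← ih, add_right_comm]

/-- The point `iY`. -/
def iMat {m : ℕ} (Y : Matrix (Fin m) (Fin m) ℝ) : Matrix (Fin m) (Fin m) ℂ := Complex.I • toC Y

lemma imPart_iMat {m : ℕ} (Y : Matrix (Fin m) (Fin m) ℝ) : imPart (iMat Y) = Y := by
  ext i j; simp [imPart, iMat, toC]

lemma iMat_mem {m : ℕ} {Y : Matrix (Fin m) (Fin m) ℝ} (hY : Y.PosDef) :
    iMat Y ∈ siegelHalfSpace m := by
  refine ⟨?_, by rwa [imPart_iMat]⟩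
  ext i j
  simp [iMat, toC, hY.isSymm.apply]

lemma eq_iMat_add {m : ℕ} (Z : Matrix (Fin m) (Fin m) ℂ) : Z = iMat (imPart Z) + toC (rePart Z) := by
  ext i j
  simp only [iMat, toC, imPart, rePart, Matrix.add_apply, Matrix.smul_apply, map_apply, smul_eq_mul]
  rw [mul_comm, add_comm, Complex.re_add_im]

lemma imPart_add_toC {m : ℕ} (Z : Matrix (Fin m) (Fin m) ℂ) (X : Matrix (Fin m) (Fin m) ℝ) :
    imPart (Z + toC X) = imPart Z := by
  ext i j; simp [imPart, toC]

/-- The factor `det(Y)^{-α} ∂_l det(Y)^α`. -/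
def detDeriv {m : ℕ} (l : List (Fin m × Fin m)) (α : ℝ) (Y : Matrix (Fin m) (Fin m) ℝ) : ℂ :=
  (detPow α (iMat Y))⁻¹ * iterZ l (detPow α) (iMat Y)

lemma detPow_ne_zero {m : ℕ} (α : ℝ) {Z : Matrix (Fin m) (Fin m) ℂ} (hZ : Z ∈ detPosSet m) :
    detPow α Z ≠ 0 := by
  rw [detPow_eq_exp α hZ]; exact Complex.exp_ne_zero _

lemma iterZ_detPow_eq {m : ℕ} (l : List (Fin m × Fin m)) (α : ℝ) {Z : Matrix (Fin m) (Fin m) ℂ}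
    (hZ : Z ∈ siegelHalfSpace m) :
    iterZ l (detPow α) Z = detPow α Z * detDeriv l α (imPart Z) := by
  have h1 : iterZ l (detPow α) Z = iterZ l (detPow α) (iMat (imPart Z)) := by
    conv_lhs => rw [eq_iMat_add Z]
    rw [iterZ_translate]
    congr 1
    ext W
    rw [detPow, detPow, imPart_add_toC]
  have h2 : detPow α Z = detPow α (iMat (imPart Z)) := by
    rw [detPow, detPow, imPart_iMat]
  rw [detDeriv, h1, h2, mul_inv_cancel_left₀]
  exact detPow_ne_zero α (siegelHalfSpace_subset m (iMat_mem hZ.2))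

/-- Polynomiality in `α`, with a degree bound independent of `Y`, is what later permits
interpolation from very negative `α`. -/
lemma exists_polynomial_detDeriv {m : ℕ} (l : List (Fin m × Fin m))
    {Y : Matrix (Fin m) (Fin m) ℝ} (hY : Y.PosDef) :
    ∃ p : Polynomial ℂ, p.natDegree ≤ l.length ∧ ∀ α : ℝ, detDeriv l α Y = p.eval (α : ℂ) := by
  obtain ⟨A, -, -, h⟩ := iterZ_detPow l
  have hZ := siegelHalfSpace_subset m (iMat_mem hY)
  refine ⟨∑ j ∈ Finset.range (l.length + 1), Polynomial.C (A j (iMat Y)) * Polynomial.X ^ j, ?_, ?_⟩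
  · refine Polynomial.natDegree_sum_le_of_forall_le _ _ fun j hj => ?_
    refine (Polynomial.natDegree_C_mul_X_pow_le _ _).trans ?_
    have := Finset.mem_range.1 hj
    lia
  · intro α
    rw [detDeriv, h α _ hZ, inv_mul_cancel_left₀ (detPow_ne_zero α hZ), Polynomial.eval_finsetSum]
    refine Finset.sum_congr rfl fun j _ => ?_
    rw [Polynomial.eval_mul, Polynomial.eval_C, Polynomial.eval_pow, Polynomial.eval_X, mul_comm]

/-! ### Fourier series over half-integral matrices -/

instance (m : ℕ) : MeasurableSpace (halfIntPos m) := ⊤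
instance (m : ℕ) : DiscreteMeasurableSpace (halfIntPos m) := ⟨fun _ => trivial⟩

lemma exists_int_coords {m : ℕ} (T : halfIntPos m) :
    ∃ n : Fin m → Fin m → ℤ, ∀ i j, 2 * T.1 i j = n i j := by
  choose n hn using T.2.2.2
  exact ⟨n, hn⟩

instance (m : ℕ) : Countable (halfIntPos m) := by
  refine Function.Injective.countable (β := Fin m → Fin m → ℤ)
    (f := fun T => (exists_int_coords T).choose) ?_
  intro T T' h
  apply Subtype.ext
  ext i j
  have h1 := (exists_int_coords T).choose_spec i j
  have h2 := (exists_int_coords T').choose_spec i j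
  have h3 := congrFun (congrFun h i) j
  simp only at h3
  rw [h3, ← h2] at h1
  linarith

lemma expTr_eq {m : ℕ} (T : Matrix (Fin m) (Fin m) ℝ) (Z : Matrix (Fin m) (Fin m) ℂ) :
    expTr T Z = expRI (2 * Real.pi) (2 * Real.pi) T Z := by
  have : (toC T * Z).trace = ((T * rePart Z).trace : ℝ) + Complex.I * ((T * imPart Z).trace : ℝ) := by
    simp only [trace, diag_apply, mul_apply, toC, rePart, imPart, map_apply]
    push_cast
    rw [Finset.mul_sum, ← Finset.sum_add_distrib]
    refine Finset.sum_congr rfl fun i _ => ?_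
    rw [Finset.mul_sum, ← Finset.sum_add_distrib]
    refine Finset.sum_congr rfl fun j _ => ?_
    conv_lhs => rw [← Complex.re_add_im (Z j i)]
    ring
  rw [expTr, expRI, this]
  congr 1
  push_cast
  linear_combination (2 * Real.pi * ((T * imPart Z).trace : ℝ) : ℂ) * Complex.I_sq

lemma hasSum_of_integrable_count {Ω : Type*} [MeasurableSpace Ω] [DiscreteMeasurableSpace Ω]
    [Countable Ω] {f : Ω → ℂ} (hf : Integrable f Measure.count) : HasSum f (∫ ω, f ω ∂Measure.count) := by
  have h1 : Summable f := (integrable_count_iff.1 hf).of_norm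
  have h2 := integral_countable hf
  simp only [Measure.real, Measure.count_singleton, ENNReal.toReal_one, one_smul] at h2
  rw [h2]
  exact h1.hasSum

/-- Convergence of a Fourier series on the whole half space. -/
def IsFourier {m : ℕ} (b : halfIntPos m → ℂ) (h : Matrix (Fin m) (Fin m) ℂ → ℂ) : Prop :=
  ∀ Z ∈ siegelHalfSpace m, HasSum (fun T : halfIntPos m => b T * expTr T.1 Z) (h Z)

section Fourier
variable {m : ℕ} {b : halfIntPos m → ℂ} {h : Matrix (Fin m) (Fin m) ℂ → ℂ}

/-- A Fourier series is an integral against counting measure, and its summability at the points `iY`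
is the required absolute convergence. -/
lemma IsFourier.isSuper (hb : IsFourier b h) :
    IsSuper (Measure.count : Measure (halfIntPos m)) (2 * Real.pi) (fun T => T.1) b where
  meas_coeff := (Measurable.of_discrete).aestronglyMeasurable
  meas_mat _ _ := Measurable.of_discrete
  psd := ae_of_all _ fun T => T.2.1.posSemidef
  integrable Y hY := by
    rw [integrable_count_iff]
    have := (hb _ (iMat_mem hY)).summable.norm
    refine this.congr fun T => ?_
    rw [expTr_eq, norm_mul, norm_expRI, norm_mul, norm_norm, imPart_iMat, Real.norm_eq_abs,
      Real.abs_exp]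

lemma IsFourier.eq_integral (hb : IsFourier b h) : ∀ Z ∈ siegelHalfSpace m,
    h Z = ∫ T, b T * expRI (2 * Real.pi) (2 * Real.pi) T.1 Z ∂Measure.count := by
  intro Z hZ
  have h1 := hasSum_of_integrable_count (hb.isSuper.integrable_exp (2 * Real.pi) hZ)
  have h2 := hb Z hZ
  simp only [expTr_eq] at h2
  exact h2.unique h1

/-- Termwise differentiation of a Fourier series. -/
lemma IsFourier.iterZ (hb : IsFourier b h) (l : List (Fin m × Fin m)) :
    IsFourier (fun T => (l.map fun p => 2 * Real.pi * Complex.I * (T.1 p.1 p.2 : ℝ)).prod * b T)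
      (iterZ l h) := by
  intro Z hZ
  have h2pi : (0 : ℝ) < 2 * Real.pi := by positivity
  rw [iterZ_congr hb.eq_integral l Z hZ, hb.isSuper.iterZ h2pi _ l Z hZ]
  have h1 := (hb.isSuper.list_coeff h2pi (Complex.I * (((2 * Real.pi : ℝ) + (2 * Real.pi : ℝ)) / 2))
    l).integrable_exp (2 * Real.pi) hZ
  have h2 := hasSum_of_integrable_count h1
  have e : Complex.I * (((2 * Real.pi : ℝ) + (2 * Real.pi : ℝ)) / 2) = 2 * Real.pi * Complex.I := by
    push_cast; ring
  simp only [expTr_eq]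
  rw [e] at h2 ⊢
  exact h2

lemma IsFourier.lineDiff (hb : IsFourier b h) (l : List (Fin m × Fin m)) :
    LineDiff (SturmScalar.iterZ l h) :=
  (hb.isSuper.lineDiff (by positivity) (2 * Real.pi) l).congr (iterZ_congr hb.eq_integral l)

/-- The Fourier series of `det(∂_Z) h`. -/
lemma IsFourier.detPartialZ (hb : IsFourier b h) :
    IsFourier (fun T => (2 * Real.pi * Complex.I) ^ m * (T.1.det : ℂ) * b T) (detPartialZ h) := by
  intro Z hZ
  rw [detPartialZ_eq]
  have h1 := hasSum_sum (s := Finset.univ) fun (σ : Equiv.Perm (Fin m)) _ =>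
    (hb.iterZ (permList σ) Z hZ).mul_left ((Equiv.Perm.sign σ : ℤ) : ℂ)
  refine h1.congr_fun ?_
  intro T
  dsimp only
  have h2 : ((toC T.1).det : ℂ) = (T.1.det : ℂ) := by
    rw [toC, ← Complex.ofRealHom_eq_coe, RingHom.map_det]; rfl
  have h3 : (2 * Real.pi * Complex.I) ^ m * (T.1.det : ℂ)
      = ((2 * Real.pi * Complex.I) • toC T.1).det := by
    rw [det_smul, Fintype.card_fin, h2]
  rw [h3, det_eq_sum_permList, Finset.sum_mul, Finset.sum_mul]
  refine Finset.sum_congr rfl fun σ _ => ?_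
  simp only [Matrix.smul_apply, smul_eq_mul, toC, map_apply]
  ring

/-! ### The Maass polynomial and the Fourier series of the shifted form -/

/-- The polynomial factor `P(T, Y)` in `det(Y)^{-α} det(∂_Z)(det(Y)^α e(TZ)) = P(T, Y) e(TZ)`
(up to `(2i)^m`). -/
def maassPoly {m : ℕ} (α : ℝ) (T Y : Matrix (Fin m) (Fin m) ℝ) : ℂ :=
  (2 * Complex.I) ^ m * ∑ σ : Equiv.Perm (Fin m), ((Equiv.Perm.sign σ : ℤ) : ℂ) *
    ((splits (permList σ)).map fun q => detDeriv q.1 α Y *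
      (q.2.map fun p => 2 * Real.pi * Complex.I * (T p.1 p.2 : ℝ)).prod).sum

lemma hasSum_list_sum {ι β : Type*} {f : ι → β → ℂ} {s : ι → ℂ} (hf : ∀ i, HasSum (f i) (s i))
    (L : List ι) : HasSum (fun x => (L.map fun i => f i x).sum) (L.map s).sum := by
  induction L with
  | nil => simp
  | cons i L ih => simpa using (hf i).add ih

lemma IsFourier.maassShift (hb : IsFourier b h) (k : ℤ) {Z : Matrix (Fin m) (Fin m) ℂ}
    (hZ : Z ∈ siegelHalfSpace m) :
    HasSum (fun T : halfIntPos m => b T * maassPoly ((k : ℝ) + (1 - m) / 2) T.1 (imPart Z) *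
      expTr T.1 Z) (maassShift k h Z) := by
  set α : ℝ := (k : ℝ) + (1 - m) / 2 with hα
  have h0 : SturmScalar.maassShift k h Z = (2 * Complex.I) ^ m *
      (((imPart Z)⁻¹.det ^ α : ℝ) : ℂ) *
      SturmScalar.detPartialZ (fun W => detPow α W * h W) Z := rfl
  have hinv : (((imPart Z)⁻¹.det ^ α : ℝ) : ℂ) * detPow α Z = 1 := by
    have hp := hZ.2.det_pos
    rw [detPow, ← Complex.ofReal_mul, det_nonsing_inv, Ring.inverse_eq_inv', Real.inv_rpow hp.le,
      inv_mul_cancel₀ (Real.rpow_pos_of_pos hp α).ne', Complex.ofReal_one]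
  have h1 : SturmScalar.maassShift k h Z = (2 * Complex.I) ^ m *
      ∑ σ : Equiv.Perm (Fin m), ((Equiv.Perm.sign σ : ℤ) : ℂ) *
        ((splits (permList σ)).map fun q => detDeriv q.1 α (imPart Z) *
          SturmScalar.iterZ q.2 h Z).sum := by
    rw [h0, detPartialZ_eq, mul_assoc, Finset.mul_sum]
    congr 1
    refine Finset.sum_congr rfl fun σ _ => ?_
    rw [iterZ_mul (lineDiff_iterZ_detPow α) hb.lineDiff _ Z hZ, mul_left_comm,
      ← List.sum_map_mul_left]
    congr 3
    ext q
    rw [iterZ_detPow_eq _ _ hZ]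
    linear_combination detDeriv q.1 α (imPart Z) * SturmScalar.iterZ q.2 h Z * hinv
  rw [h1]
  have h2 := (hasSum_sum (s := Finset.univ) fun (σ : Equiv.Perm (Fin m)) _ =>
    (hasSum_list_sum (fun q : List (Fin m × Fin m) × List (Fin m × Fin m) =>
      (hb.iterZ q.2 Z hZ).mul_left (detDeriv q.1 α (imPart Z))) (splits (permList σ))).mul_left
        ((Equiv.Perm.sign σ : ℤ) : ℂ)).mul_left ((2 * Complex.I) ^ m)
  refine h2.congr_fun ?_
  intro T
  rw [maassPoly, mul_right_comm, mul_comm (b T * _), mul_assoc, Finset.sum_mul]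
  congr 1
  refine Finset.sum_congr rfl fun σ _ => ?_
  rw [mul_assoc, ← List.sum_map_mul_right]
  congr 3
  ext q
  ring

end Fourier

/-! ### Orthogonality of characters -/

lemma integral_Icc_exp_int (n : ℤ) :
    ∫ x in Set.Icc (0 : ℝ) 1, Complex.exp (2 * Real.pi * Complex.I * n * x)
      = if n = 0 then 1 else 0 := by
  rw [integral_Icc_eq_integral_Ioc, ← intervalIntegral.integral_of_le zero_le_one]
  split_ifs with hn
  · simp [hn]
  · have hne : 2 * Real.pi * Complex.I * (n : ℂ) ≠ 0 := by
      simp [Real.pi_ne_zero, hn]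
    rw [integral_exp_mul_complex hne]
    have : Complex.exp (2 * Real.pi * Complex.I * n * (1 : ℝ)) = 1 := by
      rw [Complex.exp_eq_one_iff]
      exact ⟨n, by push_cast; ring⟩
    rw [this]
    simp

lemma integral_cube_exp_int {ι : Type*} [Fintype ι] (n : ι → ℤ) :
    ∫ x in Set.Icc (0 : ι → ℝ) 1, Complex.exp (2 * Real.pi * Complex.I * ∑ p, (n p : ℂ) * x p)
      = if n = 0 then 1 else 0 := by
  rw [← Set.pi_univ_Icc, volume_pi, Measure.restrict_pi_pi]
  have h1 : ∀ x : ι → ℝ, Complex.exp (2 * Real.pi * Complex.I * ∑ p, (n p : ℂ) * x p)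
      = ∏ p, Complex.exp (2 * Real.pi * Complex.I * n p * x p) := by
    intro x
    rw [← Complex.exp_sum, Finset.mul_sum]
    simp only [mul_assoc]
  simp only [h1]
  rw [integral_fintype_prod_eq_prod (fun p (x : ℝ) =>
    Complex.exp (2 * Real.pi * Complex.I * n p * x))]
  simp only [Pi.zero_apply, Pi.one_apply, integral_Icc_exp_int]
  split_ifs with hn
  · simp [hn]
  · obtain ⟨p, hp⟩ := Function.ne_iff.1 hn
    exact Finset.prod_eq_zero (Finset.mem_univ p) (by simpa using hp)

/-- Each off-diagonal coordinate appears twice in the trace; this doubling turns half-integral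
entries into integer frequencies. -/
lemma trace_mul_symMat {m : ℕ} {D : Matrix (Fin m) (Fin m) ℝ} (hD : D.IsSymm) (x : SymIdx m → ℝ) :
    (D * symMat x).trace
      = ∑ p : SymIdx m, (if p.1.1 = p.1.2 then D p.1.1 p.1.2 else 2 * D p.1.1 p.1.2) * x p := by
  have h1 : (D * symMat x).trace = ∑ q : Fin m × Fin m, D q.1 q.2 * symMat x q.1 q.2 := by
    rw [Fintype.sum_prod_type]
    simp only [trace, diag_apply, mul_apply]
    refine Finset.sum_congr rfl fun i _ => Finset.sum_congr rfl fun j _ => ?_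
    rw [(symMat_isSymm x).apply]
  have h2 : ∑ q ∈ Finset.univ.filter (fun q : Fin m × Fin m => ¬ q.1 ≤ q.2),
      D q.1 q.2 * symMat x q.1 q.2 = ∑ q ∈ Finset.univ.filter (fun q : Fin m × Fin m => q.1 ≤ q.2),
      (if q.1 = q.2 then 0 else D q.1 q.2) * symMat x q.1 q.2 := by
    rw [Finset.sum_filter, Finset.sum_filter, ← (Equiv.prodComm (Fin m) (Fin m)).sum_comp]
    refine Finset.sum_congr rfl fun q _ => ?_
    simp only [Equiv.prodComm_apply, Prod.fst_swap, Prod.snd_swap, hD.apply,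
      (symMat_isSymm x).apply]
    rcases lt_trichotomy q.1 q.2 with h | h | h
    · simp [h.ne, h.le, h]
    · simp [h]
    · simp [h.le, h]
  have h3 : ∀ f : Fin m × Fin m → ℝ,
      ∑ q ∈ Finset.univ.filter (fun q : Fin m × Fin m => q.1 ≤ q.2), f q = ∑ p : SymIdx m, f p.1 :=
    fun f => Finset.sum_subtype _ (by simp) f
  rw [h1, ← Finset.sum_filter_add_sum_filter_not _ (fun q : Fin m × Fin m => q.1 ≤ q.2), h2,
    ← Finset.sum_add_distrib, h3]
  refine Finset.sum_congr rfl fun p _ => ?_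
  have hp := congrFun (symCoord_symMat x) p
  simp only [symCoord] at hp
  rw [hp]
  split_ifs <;> ring

/-- Orthogonality of the characters `exp(2πi tr(TX))` over `X mod 1`. -/
lemma integral_expTr {m : ℕ} (T T' : halfIntPos m) :
    ∫ x in Set.Icc (0 : SymIdx m → ℝ) 1, expTr T'.1 (toC (symMat x)) * expTr (-T.1) (toC (symMat x))
      = if T' = T then 1 else 0 := by
  have hsymm : (T'.1 - T.1).IsSymm := T'.2.1.isSymm.sub T.2.1.isSymm
  have hex : ∀ p : SymIdx m, ∃ n : ℤ, (if p.1.1 = p.1.2 then (T'.1 - T.1) p.1.1 p.1.2 else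
      2 * (T'.1 - T.1) p.1.1 p.1.2) = n := by
    intro p
    split_ifs with hp
    · obtain ⟨n, hn⟩ := T.2.2.1 p.1.1
      obtain ⟨n', hn'⟩ := T'.2.2.1 p.1.1
      exact ⟨n' - n, by rw [← hp, Matrix.sub_apply, hn, hn']; push_cast; ring⟩
    · obtain ⟨n, hn⟩ := T.2.2.2 p.1.1 p.1.2
      obtain ⟨n', hn'⟩ := T'.2.2.2 p.1.1 p.1.2
      exact ⟨n' - n, by rw [Matrix.sub_apply, mul_sub, hn, hn']; push_cast; ring⟩
  choose n hn using hex
  have h1 : ∀ x : SymIdx m → ℝ, expTr T'.1 (toC (symMat x)) * expTr (-T.1) (toC (symMat x))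
      = Complex.exp (2 * Real.pi * Complex.I * ∑ p, (n p : ℂ) * x p) := by
    intro x
    have h2 : (∑ p, (n p : ℂ) * x p) = (((T'.1 - T.1) * symMat x).trace : ℝ) := by
      rw [trace_mul_symMat hsymm]
      push_cast
      refine Finset.sum_congr rfl fun p _ => ?_
      have := hn p
      rw [← Complex.ofReal_intCast, ← this]
    have h3 : ∀ S : Matrix (Fin m) (Fin m) ℝ, (toC S * toC (symMat x)).trace
        = ((S * symMat x).trace : ℝ) := by
      intro S
      simp [trace, mul_apply, toC]
    rw [expTr, expTr, ← Complex.exp_add, h2, h3, h3, Matrix.sub_mul, Matrix.neg_mul, trace_sub,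
      trace_neg]
    push_cast
    ring_nf
  simp only [h1, integral_cube_exp_int]
  refine if_congr ⟨fun h => ?_, fun h => ?_⟩ rfl rfl
  · apply Subtype.ext
    have hz : ∀ i j : Fin m, i ≤ j → T'.1 i j = T.1 i j := by
      intro i j hij
      have := hn ⟨(i, j), hij⟩
      rw [h] at this
      simp only [Matrix.sub_apply, Pi.zero_apply, Int.cast_zero] at this
      split_ifs at this <;> linarith
    ext i j
    rcases le_total i j with hij | hij
    · exact hz i j hij
    · rw [← T'.2.1.isSymm.apply, ← T.2.1.isSymm.apply]; exact hz j i hij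
  · subst h
    ext p
    have := hn p
    simp only [sub_self, Matrix.zero_apply, mul_zero, ite_self] at this
    exact_mod_cast this.symm

/-- The Fourier coefficients of the image of a Fourier series under the Maass shift operator. -/
lemma IsFourier.fourierCoeff_maassShift {m : ℕ} {b : halfIntPos m → ℂ}
    {h : Matrix (Fin m) (Fin m) ℂ → ℂ} (hb : IsFourier b h) (k : ℤ) (T : halfIntPos m)
    {Y : Matrix (Fin m) (Fin m) ℝ} (hY : Y.PosDef) :
    fourierCoeff (SturmScalar.maassShift k h) T.1 Y = b T * maassPoly ((k : ℝ) + (1 - m) / 2) T.1 Y *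
      (Real.exp (-(2 * Real.pi) * (T.1 * Y).trace) : ℝ) := by
  set α : ℝ := (k : ℝ) + (1 - m) / 2 with hα
  have him : ∀ X : Matrix (Fin m) (Fin m) ℝ, imPart (toC X + Complex.I • toC Y) = Y := by
    intro X; ext i j; simp [imPart, toC]
  have hre : ∀ X : Matrix (Fin m) (Fin m) ℝ, rePart (toC X + Complex.I • toC Y) = X := by
    intro X; ext i j; simp [rePart, toC]
  have hmem : ∀ x : SymIdx m → ℝ, toC (symMat x) + Complex.I • toC Y ∈ siegelHalfSpace m := by
    intro x
    refine ⟨?_, by rwa [him]⟩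
    ext i j
    simp [toC, (symMat_isSymm x).apply, hY.isSymm.apply]
  have him0 : ∀ X : Matrix (Fin m) (Fin m) ℝ, imPart (toC X) = 0 := by
    intro X; ext i j; simp [imPart, toC]
  have hre0 : ∀ X : Matrix (Fin m) (Fin m) ℝ, rePart (toC X) = X := by
    intro X; ext i j; simp [rePart, toC]
  have hexp : ∀ (S X : Matrix (Fin m) (Fin m) ℝ), expTr S (toC X + Complex.I • toC Y)
      = (Real.exp (-(2 * Real.pi) * (S * Y).trace) : ℝ) * expTr S (toC X) := by
    intro S X
    rw [expTr_eq, expTr_eq, expRI, expRI, him, hre, him0, hre0, Complex.ofReal_exp,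
      ← Complex.exp_add]
    congr 1
    simp
    ring
  have hnorm : ∀ (S X : Matrix (Fin m) (Fin m) ℝ), ‖expTr S (toC X)‖ = 1 := by
    intro S X
    rw [expTr_eq, norm_expRI, him0]
    simp
  set A : halfIntPos m → ℂ := fun T' => b T' * maassPoly α T'.1 Y *
    (Real.exp (-(2 * Real.pi) * (T'.1 * Y).trace) : ℝ) with hA
  have hsum : ∀ x : SymIdx m → ℝ, HasSum (fun T' : halfIntPos m =>
      A T' * (expTr T'.1 (toC (symMat x)) * expTr (-T.1) (toC (symMat x))))
      (SturmScalar.maassShift k h (toC (symMat x) + Complex.I • toC Y) * expTr (-T.1) (toC (symMat x))) := by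
    intro x
    have := (hb.maassShift k (hmem x)).mul_right (expTr (-T.1) (toC (symMat x)))
    refine this.congr_fun ?_
    intro T'
    rw [him, hexp, hA]
    ring
  have hcont : ∀ S : Matrix (Fin m) (Fin m) ℝ,
      Continuous fun x : SymIdx m → ℝ => expTr S (toC (symMat x)) := by
    intro S
    have h1 : Continuous fun x : SymIdx m → ℝ => (S * symMat x).trace :=
      (continuous_const.matrix_mul continuous_symMat).matrix_trace
    simp only [expTr_eq, expRI, him0, hre0]
    fun_prop
  -- The characters in `X` have modulus one, so absolute convergence at `X = 0` dominates the series
  -- for all `X` and allows integration term by term.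
  have hAsum : Summable fun T' => ‖A T'‖ := by
    have := (hsum 0).summable.norm
    refine this.congr fun T' => ?_
    simp only [norm_mul (A T'), norm_mul (expTr _ _), hnorm, mul_one]
  have hvol : volume (Set.Icc (0 : SymIdx m → ℝ) 1) = 1 := by
    rw [Real.volume_Icc_pi]; simp
  have hint := hasSum_integral_of_summable_integral_norm
    (μ := volume.restrict (Set.Icc (0 : SymIdx m → ℝ) 1))
    (F := fun (T' : halfIntPos m) x =>
      A T' * (expTr T'.1 (toC (symMat x)) * expTr (-T.1) (toC (symMat x))))
    (fun T' => (continuous_const.mul ((hcont _).mul (hcont _))).continuousOn.integrableOn_compact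
      isCompact_Icc)
    (by
      refine hAsum.congr fun T' => ?_
      simp only [norm_mul, hnorm, mul_one]
      simp [Measure.real, hvol])
  have hA' : ∀ T' : halfIntPos m, ∫ x in Set.Icc (0 : SymIdx m → ℝ) 1,
      A T' * (expTr T'.1 (toC (symMat x)) * expTr (-T.1) (toC (symMat x)))
      = if T' = T then A T else 0 := by
    intro T'
    rw [integral_const_mul, integral_expTr]
    split_ifs with hT
    · rw [hT, mul_one]
    · rw [mul_zero]
  simp only [hA', (hsum _).tsum_eq] at hint
  exact hint.unique (hasSum_ite_eq T (A T))

/-! ### The Laplace transform of powers of the determinant -/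

lemma gammaProd_ne_zero {m : ℕ} {s : ℂ} (hs : 0 < s.re) : gammaProd m s ≠ 0 := by
  refine Finset.prod_ne_zero_iff.2 fun j _ => mul_ne_zero ?_ ?_
  · simp [Complex.cpow_eq_zero_iff, Real.pi_ne_zero]
  · exact Complex.Gamma_ne_zero_of_re_pos (by simp; positivity)

lemma norm_det_cpow {m : ℕ} {y : SymIdx m → ℝ} (hy : y ∈ posCone m) (e : ℂ) :
    ‖((symMat y).det : ℂ) ^ e‖ = (symMat y).det ^ e.re :=
  Complex.norm_cpow_eq_rpow_re_of_pos (det_pos_of_mem hy) e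

lemma isSuper_laplace {m : ℕ} {s : ℂ} (hs : 0 < s.re) (κ : ℂ) :
    IsSuper (invMeasure m) 1 symMat
      (fun p => κ * ((symMat p).det : ℂ) ^ (s + (m - 1) / 2)) where
  meas_coeff := by
    have := measurable_det (m := m)
    exact Measurable.aestronglyMeasurable (by fun_prop)
  meas_mat i j := by
    simp only [symMat, of_apply]
    fun_prop
  psd := by
    filter_upwards [ae_invMeasure_mem m] with p hp using Matrix.PosDef.posSemidef hp
  integrable Y hY := by
    have h := ((integral_gamma hY hs).1.const_mul κ).norm
    refine h.congr (ae_of_all _ fun p => ?_)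
    simp only [norm_mul, Complex.norm_exp]
    rw [trace_mul_comm]
    simp
    ring

lemma integral_list_sum {X ι : Type*} [MeasurableSpace X] {μ : Measure X} {f : ι → X → ℂ}
    (hf : ∀ i, Integrable (f i) μ) (L : List ι) :
    Integrable (fun x => (L.map fun i => f i x).sum) μ ∧
      ∫ x, (L.map fun i => f i x).sum ∂μ = (L.map fun i => ∫ x, f i x ∂μ).sum := by
  induction L with
  | nil => simp
  | cons i L ih =>
    simp only [List.map_cons, List.sum_cons]
    exact ⟨(hf i).add ih.1, by rw [integral_add (hf i) ih.1, ih.2]⟩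

/-- This is the gamma integral with parameter `Y` at `s = -α - (m-1)/2`; the hypothesis on `α` is
its condition of convergence. -/
lemma detPow_eq_integral {m : ℕ} {α : ℝ} (hα : 0 < -α - (m - 1) / 2)
    {Z : Matrix (Fin m) (Fin m) ℂ} (hZ : Z ∈ siegelHalfSpace m) :
    detPow α Z = ∫ p, (gammaProd m (-α - (m - 1) / 2 : ℂ))⁻¹ *
      ((symMat p).det : ℂ) ^ ((-α - (m - 1) / 2 : ℂ) + (m - 1) / 2) * expRI 0 1 (symMat p) Z
        ∂(invMeasure m) := by
  have hs : 0 < (-α - (m - 1) / 2 : ℂ).re := by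
    have : (-α - (m - 1) / 2 : ℂ) = ((-α - (m - 1) / 2 : ℝ) : ℂ) := by push_cast; ring
    rw [this, Complex.ofReal_re]; exact hα
  have h := (integral_gamma hZ.2 hs).2
  have e1 : ∀ p : SymIdx m → ℝ, (gammaProd m (-α - (m - 1) / 2 : ℂ))⁻¹ *
      ((symMat p).det : ℂ) ^ ((-α - (m - 1) / 2 : ℂ) + (m - 1) / 2) * expRI 0 1 (symMat p) Z =
      (gammaProd m (-α - (m - 1) / 2 : ℂ))⁻¹ *
      (Complex.exp (-(((imPart Z * symMat p).trace : ℝ) : ℂ)) *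
        ((symMat p).det : ℂ) ^ ((-α - (m - 1) / 2 : ℂ) + (m - 1) / 2)) := by
    intro p
    rw [expRI, trace_mul_comm (symMat p) (imPart Z)]
    simp
    ring
  simp only [e1]
  rw [integral_const_mul, h, mul_left_comm, inv_mul_cancel₀ (gammaProd_ne_zero hs), mul_one, detPow,
    Complex.ofReal_cpow hZ.2.det_pos.le]
  congr 1
  ring

/-- The Maass polynomial for sufficiently negative `α` as a Laplace transform. -/
lemma detPow_mul_maassPoly {m : ℕ} {α : ℝ} (hα : 0 < -α - (m - 1) / 2)
    (T : Matrix (Fin m) (Fin m) ℝ) {Y : Matrix (Fin m) (Fin m) ℝ} (hY : Y.PosDef) :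
    detPow α (iMat Y) * maassPoly α T Y = (-1) ^ m * (gammaProd m (-α - (m - 1) / 2 : ℂ))⁻¹ *
      ∫ p, ((symMat p + (4 * Real.pi) • T).det : ℂ) * ((symMat p).det : ℂ) ^ (-α : ℂ) *
        Complex.exp (-(((symMat p * Y).trace : ℝ) : ℂ)) ∂(invMeasure m) := by
  have hs : 0 < (-α - (m - 1) / 2 : ℂ).re := by
    have : (-α - (m - 1) / 2 : ℂ) = ((-α - (m - 1) / 2 : ℝ) : ℂ) := by push_cast; ring
    rw [this, Complex.ofReal_re]; exact hα
  have hZ := iMat_mem hY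
  set G := gammaProd m (-α - (m - 1) / 2 : ℂ) with hG
  have hsup := isSuper_laplace (m := m) hs G⁻¹
  have hl : ∀ l : List (Fin m × Fin m), detPow α (iMat Y) * detDeriv l α Y =
      ∫ p, (l.map fun q => Complex.I * (((0 : ℝ) + (1 : ℝ)) / 2) * (symMat p q.1 q.2 : ℝ)).prod *
        (G⁻¹ * ((symMat p).det : ℂ) ^ ((-α - (m - 1) / 2 : ℂ) + (m - 1) / 2)) *
        expRI 0 1 (symMat p) (iMat Y) ∂(invMeasure m) := by
    intro l
    have h1 := iterZ_detPow_eq l α hZ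
    rw [imPart_iMat] at h1
    rw [← h1, iterZ_congr (fun Z hZ => detPow_eq_integral hα hZ) l _ hZ]
    exact hsup.iterZ one_pos 0 l _ hZ
  have hli : ∀ l : List (Fin m × Fin m), Integrable (fun p =>
      (l.map fun q => Complex.I * (((0 : ℝ) + (1 : ℝ)) / 2) * (symMat p q.1 q.2 : ℝ)).prod *
        (G⁻¹ * ((symMat p).det : ℂ) ^ ((-α - (m - 1) / 2 : ℂ) + (m - 1) / 2)) *
        expRI 0 1 (symMat p) (iMat Y)) (invMeasure m) :=
    fun l => (hsup.list_coeff one_pos _ l).integrable_exp 0 hZ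
  have e1 : detPow α (iMat Y) * maassPoly α T Y = (2 * Complex.I) ^ m *
      ∑ σ : Equiv.Perm (Fin m), ((Equiv.Perm.sign σ : ℤ) : ℂ) *
      ((splits (permList σ)).map fun q => (detPow α (iMat Y) * detDeriv q.1 α Y) *
      (q.2.map fun p => 2 * Real.pi * Complex.I * (T p.1 p.2 : ℝ)).prod).sum := by
    rw [maassPoly, mul_left_comm, Finset.mul_sum]
    congr 1
    refine Finset.sum_congr rfl fun σ _ => ?_
    rw [mul_left_comm, ← List.sum_map_mul_left]
    simp only [mul_assoc]
  have hint : ∀ q : List (Fin m × Fin m) × List (Fin m × Fin m), Integrable (fun p =>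
      (q.1.map fun q => Complex.I * (((0 : ℝ) + (1 : ℝ)) / 2) * (symMat p q.1 q.2 : ℝ)).prod *
        (G⁻¹ * ((symMat p).det : ℂ) ^ ((-α - (m - 1) / 2 : ℂ) + (m - 1) / 2)) *
        expRI 0 1 (symMat p) (iMat Y) *
        (q.2.map fun p => 2 * Real.pi * Complex.I * (T p.1 p.2 : ℝ)).prod) (invMeasure m) :=
    fun q => (hli q.1).mul_const _
  rw [e1]
  simp only [hl, ← integral_mul_const]
  simp only [← (integral_list_sum hint _).2]
  simp only [← integral_const_mul]
  rw [← integral_finsetSum _ fun σ _ => ((integral_list_sum hint _).1).const_mul _]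
  simp only [← integral_const_mul]
  refine integral_congr_ae (ae_of_all _ fun p => ?_)
  dsimp only
  have e2 : ∀ σ : Equiv.Perm (Fin m), ((splits (permList σ)).map fun q =>
      (q.1.map fun q => Complex.I * (((0 : ℝ) + (1 : ℝ)) / 2) * (symMat p q.1 q.2 : ℝ)).prod *
        (G⁻¹ * ((symMat p).det : ℂ) ^ ((-α - (m - 1) / 2 : ℂ) + (m - 1) / 2)) *
        expRI 0 1 (symMat p) (iMat Y) *
        (q.2.map fun p => 2 * Real.pi * Complex.I * (T p.1 p.2 : ℝ)).prod).sum =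
      ((permList σ).map fun q => (Complex.I / 2 * ((symMat p + (4 * Real.pi) • T) q.1 q.2 : ℝ) : ℂ)).prod
        * (G⁻¹ * ((symMat p).det : ℂ) ^ (-α : ℂ) *
          Complex.exp (-(((symMat p * Y).trace : ℝ) : ℂ))) := by
    intro σ
    have e3 : (fun q : Fin m × Fin m =>
        (Complex.I / 2 * ((symMat p + (4 * Real.pi) • T) q.1 q.2 : ℝ) : ℂ)) = fun q =>
        Complex.I * (((0 : ℝ) + (1 : ℝ)) / 2) * (symMat p q.1 q.2 : ℝ) +
          2 * Real.pi * Complex.I * (T q.1 q.2 : ℝ) := by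
      ext q
      simp only [Matrix.add_apply, Matrix.smul_apply, smul_eq_mul]
      push_cast
      ring
    -- The Leibniz sum refolds: the symbols `(i/2) P` and `2πi T` add up to `(i/2)(P + 4πT)` entry
    -- by entry.
    rw [e3, prod_map_add, ← List.sum_map_mul_right]
    congr 2
    ext q
    have e4 : expRI 0 1 (symMat p) (iMat Y) = Complex.exp (-(((symMat p * Y).trace : ℝ) : ℂ)) := by
      rw [expRI, imPart_iMat]; simp
    rw [e4, show (-α - (m - 1) / 2 : ℂ) + (m - 1) / 2 = -α by ring]
    ring
  simp only [e2]
  -- The normalising `2i` meets the `i/2` of the symbol, and each of the `m` rows contributes `-1`.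
  have e5 : (2 * Complex.I) ^ m * ∑ σ : Equiv.Perm (Fin m), ((Equiv.Perm.sign σ : ℤ) : ℂ) *
      ((permList σ).map fun q =>
        (Complex.I / 2 * ((symMat p + (4 * Real.pi) • T) q.1 q.2 : ℝ) : ℂ)).prod
      = (-1) ^ m * ((symMat p + (4 * Real.pi) • T).det : ℝ) := by
    have h1 := det_eq_sum_permList ((Complex.I / 2 : ℂ) • toC (symMat p + (4 * Real.pi) • T))
    simp only [Matrix.smul_apply, smul_eq_mul, toC, map_apply] at h1
    rw [← h1, det_smul, Fintype.card_fin, ← mul_assoc, ← mul_pow]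
    congr 1
    · congr 1
      linear_combination Complex.I_sq
    · rw [← Complex.ofRealHom_eq_coe, RingHom.map_det]; rfl
  simp only [← mul_assoc] at e5 ⊢
  rw [← Finset.sum_mul, ← Finset.sum_mul, ← Finset.sum_mul]
  simp only [← mul_assoc]
  rw [e5]
  ring

/-! ### The integral of the Maass polynomial -/

/-- The kernel `exp(-tr((P+R)Y)) det(Y)^e det(P)^β`. -/
def lapKernel {m : ℕ} (R : Matrix (Fin m) (Fin m) ℝ) (e : ℂ) (β : ℂ) (y p : SymIdx m → ℝ) : ℂ :=
  Complex.exp (-((((symMat p + R) * symMat y).trace : ℝ) : ℂ)) * ((symMat y).det : ℂ) ^ e *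
    ((symMat p).det : ℂ) ^ β

section lapKernel
variable {m : ℕ} {R : Matrix (Fin m) (Fin m) ℝ}

lemma measurable_lapKernel (R : Matrix (Fin m) (Fin m) ℝ) (e β : ℂ) :
    Measurable fun q : (SymIdx m → ℝ) × (SymIdx m → ℝ) => lapKernel R e β q.1 q.2 := by
  have h1 : Measurable fun q : (SymIdx m → ℝ) × (SymIdx m → ℝ) =>
      ((symMat q.2 + R) * symMat q.1).trace := by
    refine Continuous.measurable ?_
    exact (((continuous_symMat.comp continuous_snd).add continuous_const).matrix_mul
      (continuous_symMat.comp continuous_fst)).matrix_trace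
  have h2 : Measurable fun q : (SymIdx m → ℝ) × (SymIdx m → ℝ) => (symMat q.1).det :=
    measurable_det.comp measurable_fst
  have h3 : Measurable fun q : (SymIdx m → ℝ) × (SymIdx m → ℝ) => (symMat q.2).det :=
    measurable_det.comp measurable_snd
  unfold lapKernel
  fun_prop

/-- The norm is again a kernel of the same kind with real exponents, so integrability on the product
follows from the explicit inner integrals. -/
lemma norm_lapKernel (R : Matrix (Fin m) (Fin m) ℝ) (e : ℂ) (β : ℝ) {y p : SymIdx m → ℝ}
    (hy : y ∈ posCone m) (hp : p ∈ posCone m) :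
    (‖lapKernel R e β y p‖ : ℂ) = lapKernel R e.re β y p := by
  rw [lapKernel, norm_mul, norm_mul, norm_det_cpow hy, norm_det_cpow hp, Complex.norm_exp,
    lapKernel]
  push_cast
  rw [Complex.ofReal_cpow (det_pos_of_mem hy).le, Complex.ofReal_cpow (det_pos_of_mem hp).le]
  simp

lemma integral_lapKernel_left (hR : R.PosDef) {s : ℂ} (hs : 0 < s.re) (β : ℂ) {p : SymIdx m → ℝ}
    (hp : p ∈ posCone m) :
    Integrable (fun y => lapKernel R (s + (m - 1) / 2) β y p) (invMeasure m) ∧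
      ∫ y, lapKernel R (s + (m - 1) / 2) β y p ∂(invMeasure m) =
        ((symMat p + R).det : ℂ) ^ (-(s + (m - 1) / 2)) * gammaProd m s *
          ((symMat p).det : ℂ) ^ β := by
  have hpR : (symMat p + R).PosDef := Matrix.PosDef.add hp hR
  have h := integral_gamma hpR hs
  unfold lapKernel
  exact ⟨h.1.mul_const _, by rw [integral_mul_const, h.2]⟩

lemma integral_lapKernel_right (R : Matrix (Fin m) (Fin m) ℝ) {s : ℂ} (hs : 0 < s.re) (e : ℂ)
    {y : SymIdx m → ℝ} (hy : y ∈ posCone m) :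
    Integrable (fun p => lapKernel R e (s + (m - 1) / 2) y p) (invMeasure m) ∧
      ∫ p, lapKernel R e (s + (m - 1) / 2) y p ∂(invMeasure m) =
        Complex.exp (-(((R * symMat y).trace : ℝ) : ℂ)) *
          ((symMat y).det : ℂ) ^ (e - (s + (m - 1) / 2)) * gammaProd m s := by
  have h := integral_gamma (show (symMat y).PosDef from hy) hs
  have e1 : ∀ p : SymIdx m → ℝ, lapKernel R e (s + (m - 1) / 2) y p =
      (Complex.exp (-(((R * symMat y).trace : ℝ) : ℂ)) * ((symMat y).det : ℂ) ^ e) *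
      (Complex.exp (-(((symMat y * symMat p).trace : ℝ) : ℂ)) *
        ((symMat p).det : ℂ) ^ (s + (m - 1) / 2)) := by
    intro p
    rw [lapKernel, Matrix.add_mul, trace_add, trace_mul_comm (symMat p), Complex.ofReal_add,
      neg_add, Complex.exp_add]
    ring
  simp only [e1]
  refine ⟨h.1.const_mul _, ?_⟩
  have hne : ((symMat y).det : ℂ) ≠ 0 := by exact_mod_cast (det_pos_of_mem hy).ne'
  rw [integral_const_mul, h.2,
    show e - (s + ((m : ℂ) - 1) / 2) = e + -(s + (m - 1) / 2) by ring, Complex.cpow_add _ _ hne]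
  ring

lemma ofReal_integral_norm_lapKernel_left (e : ℂ) (β : ℝ) {p : SymIdx m → ℝ} (hp : p ∈ posCone m) :
    ((∫ y, ‖lapKernel R e β y p‖ ∂(invMeasure m) : ℝ) : ℂ)
      = ∫ y, lapKernel R e.re β y p ∂(invMeasure m) := by
  rw [← integral_complex_ofReal]
  refine integral_congr_ae ?_
  filter_upwards [ae_invMeasure_mem m] with y hy using norm_lapKernel R e β hy hp

lemma ofReal_integral_norm_lapKernel_right (e : ℂ) (β : ℝ) {y : SymIdx m → ℝ}
    (hy : y ∈ posCone m) : ((∫ p, ‖lapKernel R e β y p‖ ∂(invMeasure m) : ℝ) : ℂ)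
      = ∫ p, lapKernel R e.re β y p ∂(invMeasure m) := by
  rw [← integral_complex_ofReal]
  refine integral_congr_ae ?_
  filter_upwards [ae_invMeasure_mem m] with p hp using norm_lapKernel R e β hy hp

lemma integrable_lapKernel (hR : R.PosDef) {s : ℂ} (hs : 0 < s.re) {r : ℝ} (hr : 0 < r) :
    Integrable (fun q : (SymIdx m → ℝ) × (SymIdx m → ℝ) =>
      lapKernel R (s + r + (m - 1) / 2 + (m - 1) / 2) ((r + (m - 1) / 2 : ℝ) : ℂ) q.1 q.2)
      ((invMeasure m).prod (invMeasure m)) := by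
  have hβ : ((r + (m - 1) / 2 : ℝ) : ℂ) = (r : ℂ) + (m - 1) / 2 := by push_cast; ring
  have hr' : 0 < (r : ℂ).re := by simpa using hr
  rw [integrable_prod_iff (measurable_lapKernel _ _ _).aestronglyMeasurable]
  constructor
  · filter_upwards [ae_invMeasure_mem m] with y hy
    rw [hβ]
    exact (integral_lapKernel_right R hr' _ hy).1
  · have hmain := (integral_gamma hR (s := (s.re : ℂ)) (by simpa using hs)).1.mul_const
      (gammaProd m r)
    refine hmain.re.congr ?_
    filter_upwards [ae_invMeasure_mem m] with y hy
    have h1 := ofReal_integral_norm_lapKernel_right (R := R)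
      (s + r + (m - 1) / 2 + (m - 1) / 2) (r + (m - 1) / 2) hy
    rw [hβ, (integral_lapKernel_right R hr' _ hy).2] at h1
    have h2 := congrArg Complex.re h1
    rw [Complex.ofReal_re] at h2
    rw [hβ, h2]
    simp only [RCLike.re_to_complex]
    congr 4
    have : (((s + r + (m - 1) / 2 + (m - 1) / 2 : ℂ).re : ℝ) : ℂ)
        = s.re + r + (m - 1) / 2 + (m - 1) / 2 := by
      have : (s + r + (m - 1) / 2 + (m - 1) / 2 : ℂ)
        = s + ((r + (m - 1) / 2 + (m - 1) / 2 : ℝ) : ℂ) := by push_cast; ring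
      rw [this, Complex.add_re, Complex.ofReal_re]
      push_cast
      ring
    rw [this]
    ring

lemma gammaProd_add_one {s : ℂ} (hs : 0 < s.re) :
    gammaProd m (s + 1) = (∏ j ∈ Finset.range m, (s + j / 2)) * gammaProd m s := by
  rw [gammaProd, gammaProd, ← Finset.prod_mul_distrib]
  refine Finset.prod_congr rfl fun j _ => ?_
  have hne : s + (j : ℂ) / 2 ≠ 0 := by
    intro h
    have := congrArg Complex.re h
    simp at this
    have : (0 : ℝ) ≤ (j : ℝ) / 2 := by positivity
    linarith
  rw [add_right_comm, Complex.Gamma_add_one _ hne]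
  ring

/-- Exchange of the order of integration for the kernel multiplied by `det(P + R)`. -/
lemma integral_det_mul_lapKernel (hm0 : 0 < m) (hR : R.PosDef) {s : ℂ} (hs : 0 < s.re) {r : ℝ} (hr : 0 < r) :
    Integrable (fun y => ∫ p, ((symMat p + R).det : ℂ) *
      lapKernel R (s + r + (m - 1) / 2 + 1 + (m - 1) / 2) ((r + (m - 1) / 2 : ℝ) : ℂ) y p
        ∂(invMeasure m)) (invMeasure m) ∧
    ∫ y, ∫ p, ((symMat p + R).det : ℂ) *
      lapKernel R (s + r + (m - 1) / 2 + 1 + (m - 1) / 2) ((r + (m - 1) / 2 : ℝ) : ℂ) y p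
        ∂(invMeasure m) ∂(invMeasure m)
      = (∏ j ∈ Finset.range m, (s + r + (m - 1) / 2 + j / 2)) * ((R.det : ℂ) ^ (-(s + (m - 1) / 2)) *
        gammaProd m s * gammaProd m r) := by
  set β : ℂ := ((r + (m - 1) / 2 : ℝ) : ℂ) with hβdef
  have hβ : β = (r : ℂ) + (m - 1) / 2 := by rw [hβdef]; push_cast; ring
  have hr' : 0 < (r : ℂ).re := by simpa using hr
  set u : ℂ := s + r + (m - 1) / 2 with hu
  have hure : u.re = s.re + (r + (m - 1) / 2) := by
    have : u = s + ((r + (m - 1) / 2 : ℝ) : ℂ) := by rw [hu]; push_cast; ring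
    rw [this, Complex.add_re, Complex.ofReal_re]
  have hm1 : (1 : ℝ) ≤ m := by exact_mod_cast hm0
  have hupos : 0 < u.re := by
    rw [hure]
    have : (0 : ℝ) ≤ ((m : ℝ) - 1) / 2 := by linarith
    linarith
  have hu1pos : 0 < (u + 1).re := by simp; linarith
  have hF2 := integrable_lapKernel hR hs hr
  rw [← hβdef, ← hu] at hF2
  -- Raising the exponent of `det(Y)` by one produces an extra `det(P+R)⁻¹`, cancelled by the factor
  -- in front; what survives is the ratio of gamma products at `v + 1` and `v`.
  have hratio : ∀ (v : ℂ), 0 < v.re → ∀ p ∈ posCone m,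
      ∫ y, ((symMat p + R).det : ℂ) * lapKernel R (v + 1 + (m - 1) / 2) β y p ∂(invMeasure m) =
      (∏ j ∈ Finset.range m, (v + j / 2)) *
        ∫ y, lapKernel R (v + (m - 1) / 2) β y p ∂(invMeasure m) := by
    intro v hv p hp
    have hv1 : 0 < (v + 1).re := by simp; linarith
    have hpR : (0 : ℝ) < (symMat p + R).det := (Matrix.PosDef.add hp hR).det_pos
    have hne : ((symMat p + R).det : ℂ) ≠ 0 := by exact_mod_cast hpR.ne'
    rw [integral_const_mul, (integral_lapKernel_left hR hv1 β hp).2,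
      (integral_lapKernel_left hR hv β hp).2, gammaProd_add_one hv,
      show -(v + 1 + ((m : ℂ) - 1) / 2) = -(v + (m - 1) / 2) - 1 by ring, Complex.cpow_sub _ _ hne,
      Complex.cpow_one]
    field_simp
  have hmeasF1 : Measurable fun q : (SymIdx m → ℝ) × (SymIdx m → ℝ) =>
      ((symMat q.2 + R).det : ℂ) * lapKernel R (u + 1 + (m - 1) / 2) β q.1 q.2 := by
    have h1 : Continuous fun q : (SymIdx m → ℝ) × (SymIdx m → ℝ) => (symMat q.2 + R).det :=
      ((continuous_symMat.comp continuous_snd).add continuous_const).matrix_det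
    have h1 := h1.measurable
    have h2 := measurable_lapKernel R (u + 1 + (m - 1) / 2) β
    fun_prop
  have hF1 : Integrable (fun q : (SymIdx m → ℝ) × (SymIdx m → ℝ) =>
      ((symMat q.2 + R).det : ℂ) * lapKernel R (u + 1 + (m - 1) / 2) β q.1 q.2)
      ((invMeasure m).prod (invMeasure m)) := by
    rw [integrable_prod_iff' hmeasF1.aestronglyMeasurable]
    constructor
    · filter_upwards [ae_invMeasure_mem m] with p hp
      exact (integral_lapKernel_left hR hu1pos β hp).1.const_mul _
    -- The inner norm integrals are a constant multiple of those of the kernel without `det(P+R)`,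
    -- whose integrability is known.
    · have h2 := ((integrable_prod_iff' (measurable_lapKernel _ _ _).aestronglyMeasurable).1 hF2).2
      have h3 := (h2.ofReal (𝕜 := ℂ)).const_mul (∏ j ∈ Finset.range m, ((u.re : ℂ) + j / 2))
      refine h3.re.congr ?_
      filter_upwards [ae_invMeasure_mem m] with p hp
      have hre : ∀ v : ℂ, (((v + (m - 1) / 2 : ℂ).re : ℝ) : ℂ) = (v.re : ℂ) + (m - 1) / 2 := by
        intro v
        have : (v + (m - 1) / 2 : ℂ) = v + (((m - 1) / 2 : ℝ) : ℂ) := by push_cast; ring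
        rw [this, Complex.add_re, Complex.ofReal_re]
        push_cast
        ring
      have hpR : (0 : ℝ) < (symMat p + R).det := (Matrix.PosDef.add hp hR).det_pos
      have e1 := ofReal_integral_norm_lapKernel_left (R := R) (u + (m - 1) / 2)
        (r + (m - 1) / 2) hp
      have e2 := ofReal_integral_norm_lapKernel_left (R := R) (u + 1 + (m - 1) / 2)
        (r + (m - 1) / 2) hp
      rw [← hβdef, hre] at e1 e2
      have e3 : ((∫ y, ‖((symMat p + R).det : ℂ) * lapKernel R (u + 1 + (m - 1) / 2) β y p‖
          ∂(invMeasure m) : ℝ) : ℂ) = (∏ j ∈ Finset.range m, ((u.re : ℂ) + j / 2)) *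
          ((∫ y, ‖lapKernel R (u + (m - 1) / 2) β y p‖ ∂(invMeasure m) : ℝ) : ℂ) := by
        simp only [norm_mul, Complex.norm_real, Real.norm_eq_abs, abs_of_pos hpR]
        rw [integral_const_mul, Complex.ofReal_mul, e2, e1,
          ← hratio (u.re : ℂ) (by simpa using hupos) p hp, integral_const_mul]
        simp
      have e4 := congrArg Complex.re e3
      rw [Complex.ofReal_re] at e4
      exact e4.symm
  refine ⟨hF1.integral_prod_left, ?_⟩
  rw [integral_integral_swap hF1]
  have h1 : ∫ p, ∫ y, ((symMat p + R).det : ℂ) * lapKernel R (u + 1 + (m - 1) / 2) β y p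
      ∂(invMeasure m) ∂(invMeasure m) = (∏ j ∈ Finset.range m, (u + j / 2)) *
      ∫ p, ∫ y, lapKernel R (u + (m - 1) / 2) β y p ∂(invMeasure m) ∂(invMeasure m) := by
    rw [← integral_const_mul]
    refine integral_congr_ae ?_
    filter_upwards [ae_invMeasure_mem m] with p hp using hratio u hupos p hp
  have h2 : ∫ y, ∫ p, lapKernel R (u + (m - 1) / 2) β y p ∂(invMeasure m) ∂(invMeasure m) =
      (R.det : ℂ) ^ (-(s + (m - 1) / 2)) * gammaProd m s * gammaProd m r := by
    rw [← (integral_gamma hR hs).2, ← integral_mul_const]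
    refine integral_congr_ae ?_
    filter_upwards [ae_invMeasure_mem m] with y hy
    rw [hβ, (integral_lapKernel_right R hr' _ hy).2, hu]
    congr 3
    ring
  rw [h1, ← integral_integral_swap hF2, h2]

end lapKernel

section
variable {m : ℕ}

/-- The Laplace representation carries `det(Y)^α` on its left side; dividing by it raises the
exponent of `det(Y)` to `s + (m+1)/2 - α`, exactly the exponent in the exchange of integrals. The
factor `gammaProd m r` produced there cancels the normalisation of the Laplace transform. -/
lemma integral_maassPoly_of_neg (hm : 0 < m) {T : Matrix (Fin m) (Fin m) ℝ} (hT : T.PosDef)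
    {s : ℂ} (hs : 0 < s.re) {α : ℝ} (hα : 0 < -α - (m - 1) / 2) :
    Integrable (fun y : SymIdx m → ℝ => maassPoly α T (symMat y) *
      Complex.exp (-(((((4 * Real.pi) • T) * symMat y).trace : ℝ) : ℂ)) *
        ((symMat y).det : ℂ) ^ (s + (m + 1) / 2)) (invMeasure m) ∧
    ∫ y : SymIdx m → ℝ, maassPoly α T (symMat y) *
      Complex.exp (-(((((4 * Real.pi) • T) * symMat y).trace : ℝ) : ℂ)) *
        ((symMat y).det : ℂ) ^ (s + (m + 1) / 2) ∂(invMeasure m) =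
      (-1) ^ m * (∏ j ∈ Finset.range m, (s - α + j / 2)) *
        ((((4 * Real.pi) • T).det : ℂ) ^ (-(s + (m - 1) / 2)) * gammaProd m s) := by
  set R := (4 * Real.pi) • T with hRdef
  have hR : R.PosDef := hT.smul (by positivity)
  set r : ℝ := -α - (m - 1) / 2 with hr
  have hrc : (r : ℂ) = -α - (m - 1) / 2 := by rw [hr]; push_cast; ring
  have hG : gammaProd m r ≠ 0 := gammaProd_ne_zero (by simpa using hα)
  have h := integral_det_mul_lapKernel hm hR hs hα
  have key : ∀ y ∈ posCone m, (-1) ^ m * (gammaProd m r)⁻¹ * ∫ p, ((symMat p + R).det : ℂ) *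
      lapKernel R (s + r + (m - 1) / 2 + 1 + (m - 1) / 2) ((r + (m - 1) / 2 : ℝ) : ℂ) y p
        ∂(invMeasure m) = maassPoly α T (symMat y) *
      Complex.exp (-(((R * symMat y).trace : ℝ) : ℂ)) *
        ((symMat y).det : ℂ) ^ (s + (m + 1) / 2) := by
    intro y hy
    have hd := det_pos_of_mem hy
    have hne : ((symMat y).det : ℂ) ≠ 0 := by exact_mod_cast hd.ne'
    have h1 := detPow_mul_maassPoly hα T (show (symMat y).PosDef from hy)
    rw [← hrc, detPow, imPart_iMat, Complex.ofReal_cpow hd.le, ← hRdef] at h1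
    have h2 : ∀ p, ((symMat p + R).det : ℂ) *
        lapKernel R (s + r + (m - 1) / 2 + 1 + (m - 1) / 2) ((r + (m - 1) / 2 : ℝ) : ℂ) y p =
        (Complex.exp (-(((R * symMat y).trace : ℝ) : ℂ)) *
          ((symMat y).det : ℂ) ^ (s + (m + 1) / 2 - α)) *
        (((symMat p + R).det : ℂ) * ((symMat p).det : ℂ) ^ (-α : ℂ) *
          Complex.exp (-(((symMat p * symMat y).trace : ℝ) : ℂ))) := by
      intro p
      rw [lapKernel, Matrix.add_mul, trace_add, Complex.ofReal_add, neg_add, Complex.exp_add,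
        show ((r + (m - 1) / 2 : ℝ) : ℂ) = -α by push_cast; rw [hrc]; ring,
        show s + r + ((m : ℂ) - 1) / 2 + 1 + (m - 1) / 2 = s + (m + 1) / 2 - α by rw [hrc]; ring]
      ring
    simp only [h2]
    rw [integral_const_mul, mul_left_comm, ← h1, Complex.cpow_sub _ _ hne]
    have : ((symMat y).det : ℂ) ^ (α : ℂ) ≠ 0 := by simp [Complex.cpow_eq_zero_iff, hne]
    field_simp
  have hae : (fun y => (-1) ^ m * (gammaProd m r)⁻¹ * ∫ p, ((symMat p + R).det : ℂ) *
      lapKernel R (s + r + (m - 1) / 2 + 1 + (m - 1) / 2) ((r + (m - 1) / 2 : ℝ) : ℂ) y p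
        ∂(invMeasure m)) =ᵐ[invMeasure m] fun y => maassPoly α T (symMat y) *
      Complex.exp (-(((R * symMat y).trace : ℝ) : ℂ)) *
        ((symMat y).det : ℂ) ^ (s + (m + 1) / 2) := by
    filter_upwards [ae_invMeasure_mem m] with y hy using key y hy
  refine ⟨(h.1.const_mul _).congr hae, ?_⟩
  rw [← integral_congr_ae hae, integral_const_mul, h.2]
  have e : ∏ j ∈ Finset.range m, (s + r + ((m : ℂ) - 1) / 2 + j / 2)
      = ∏ j ∈ Finset.range m, (s - α + (j : ℂ) / 2) :=
    Finset.prod_congr rfl fun j _ => by rw [hrc]; ring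
  rw [e]
  field_simp

/-! ### Extension to all `α` by interpolation -/

lemma exists_polynomial_maassPoly (T : Matrix (Fin m) (Fin m) ℝ) {Y : Matrix (Fin m) (Fin m) ℝ}
    (hY : Y.PosDef) : ∃ p : Polynomial ℂ, p.natDegree ≤ m ∧
      ∀ α : ℝ, maassPoly α T Y = p.eval (α : ℂ) := by
  choose P hPdeg hP using fun l => exists_polynomial_detDeriv (m := m) l hY
  have hlist : ∀ L : List (List (Fin m × Fin m) × List (Fin m × Fin m)),
      (∀ q ∈ L, q.1.length ≤ m) → ∃ p : Polynomial ℂ, p.natDegree ≤ m ∧ ∀ α : ℝ,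
      (L.map fun q => detDeriv q.1 α Y *
      (q.2.map fun p => 2 * Real.pi * Complex.I * (T p.1 p.2 : ℝ)).prod).sum = p.eval (α : ℂ) := by
    intro L
    induction L with
    | nil => exact fun _ => ⟨0, by simp, by simp⟩
    | cons q L ih =>
      intro hL
      obtain ⟨p, hp, hpe⟩ := ih fun q' hq' => hL q' (List.mem_cons_of_mem _ hq')
      refine ⟨P q.1 * Polynomial.C ((q.2.map fun p => 2 * Real.pi * Complex.I *
        (T p.1 p.2 : ℝ)).prod : ℂ) + p, ?_, fun α => ?_⟩
      · refine Polynomial.natDegree_add_le_of_degree_le ?_ hp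
        refine (Polynomial.natDegree_mul_C_le _ _).trans ((hPdeg _).trans ?_)
        exact hL q List.mem_cons_self
      · rw [List.map_cons, List.sum_cons, hpe, hP]
        simp
  have hσ : ∀ σ : Equiv.Perm (Fin m), ∀ q ∈ splits (permList σ), q.1.length ≤ m :=
    fun σ q hq => (length_le_of_mem_splits hq).trans (length_permList σ).le
  choose Q hQdeg hQ using fun σ : Equiv.Perm (Fin m) => hlist _ (hσ σ)
  refine ⟨∑ σ : Equiv.Perm (Fin m),
    Polynomial.C ((2 * Complex.I) ^ m * ((Equiv.Perm.sign σ : ℤ) : ℂ)) * Q σ, ?_, fun α => ?_⟩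
  · exact Polynomial.natDegree_sum_le_of_forall_le _ _ fun σ _ =>
      (Polynomial.natDegree_C_mul_le _ _).trans (hQdeg σ)
  · rw [maassPoly, Polynomial.eval_finsetSum, Finset.mul_sum]
    refine Finset.sum_congr rfl fun σ _ => ?_
    rw [hQ, Polynomial.eval_mul, Polynomial.eval_C, mul_assoc]

/-- Lagrange interpolation at the nodes `-m, -(m+1), …, -2m`. -/
lemma exists_interpolation (m : ℕ) (x : ℂ) : ∃ L : ℕ → ℂ, ∀ p : Polynomial ℂ, p.natDegree ≤ m →
    p.eval x = ∑ j ∈ Finset.range (m + 1), L j * p.eval ((-((m : ℝ) + j) : ℝ) : ℂ) := by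
  set v : ℕ → ℂ := fun j => ((-((m : ℝ) + j) : ℝ) : ℂ) with hv
  have hinj : Set.InjOn v (Finset.range (m + 1)) := by
    intro i _ j _ hij
    simp only [hv, Complex.ofReal_inj] at hij
    have : (i : ℝ) = j := by linarith
    exact_mod_cast this
  refine ⟨fun j => (Lagrange.basis (Finset.range (m + 1)) v j).eval x, fun p hp => ?_⟩
  have hdeg : p.degree < (Finset.range (m + 1)).card := by
    rw [Finset.card_range]
    refine (Polynomial.degree_le_of_natDegree_le hp).trans_lt ?_
    exact_mod_cast Nat.lt_succ_self m
  conv_lhs => rw [Lagrange.eq_interpolate hinj hdeg]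
  rw [Lagrange.interpolate_apply, Polynomial.eval_finsetSum]
  refine Finset.sum_congr rfl fun j _ => ?_
  rw [Polynomial.eval_mul, Polynomial.eval_C, mul_comm]

/-- The integral of the Maass polynomial against the Wishart density, for all `α`. -/
theorem integral_maassPoly (hm : 0 < m) {T : Matrix (Fin m) (Fin m) ℝ} (hT : T.PosDef)
    {s : ℂ} (hs : 0 < s.re) (α : ℝ) :
    Integrable (fun y : SymIdx m → ℝ => maassPoly α T (symMat y) *
      Complex.exp (-(((((4 * Real.pi) • T) * symMat y).trace : ℝ) : ℂ)) *
        ((symMat y).det : ℂ) ^ (s + (m + 1) / 2)) (invMeasure m) ∧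
    ∫ y : SymIdx m → ℝ, maassPoly α T (symMat y) *
      Complex.exp (-(((((4 * Real.pi) • T) * symMat y).trace : ℝ) : ℂ)) *
        ((symMat y).det : ℂ) ^ (s + (m + 1) / 2) ∂(invMeasure m) =
      (-1) ^ m * (∏ j ∈ Finset.range m, (s - α + j / 2)) *
        ((((4 * Real.pi) • T).det : ℂ) ^ (-(s + (m - 1) / 2)) * gammaProd m s) := by
  -- The weights do not depend on `Y`, so the integrand for `α` is a fixed finite combination of
  -- integrands at nodes where the formula is known.
  obtain ⟨L, hL⟩ := exists_interpolation m (α : ℂ)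
  have hnode : ∀ j : ℕ, 0 < -(-((m : ℝ) + j)) - ((m : ℝ) - 1) / 2 := by
    intro j
    have h1 : (0 : ℝ) ≤ j := Nat.cast_nonneg j
    have h2 : (0 : ℝ) < m := by exact_mod_cast hm
    linarith
  have h := fun j : ℕ => integral_maassPoly_of_neg hm hT hs (hnode j)
  have hae : (fun y : SymIdx m → ℝ => ∑ j ∈ Finset.range (m + 1), L j *
      (maassPoly (-((m : ℝ) + j)) T (symMat y) *
      Complex.exp (-(((((4 * Real.pi) • T) * symMat y).trace : ℝ) : ℂ)) *
        ((symMat y).det : ℂ) ^ (s + (m + 1) / 2))) =ᵐ[invMeasure m]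
      fun y : SymIdx m → ℝ => maassPoly α T (symMat y) *
      Complex.exp (-(((((4 * Real.pi) • T) * symMat y).trace : ℝ) : ℂ)) *
        ((symMat y).det : ℂ) ^ (s + (m + 1) / 2) := by
    filter_upwards [ae_invMeasure_mem m] with y hy
    obtain ⟨p, hp, hpe⟩ := exists_polynomial_maassPoly T (show (symMat y).PosDef from hy)
    rw [hpe α, hL p hp, Finset.sum_mul, Finset.sum_mul]
    exact Finset.sum_congr rfl fun j _ => by rw [← hpe]; ring
  have hI := fun (j : ℕ) (_ : j ∈ Finset.range (m + 1)) => (h j).1.const_mul (L j)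
  refine ⟨(integrable_finsetSum _ hI).congr hae, ?_⟩
  rw [← integral_congr_ae hae, integral_finsetSum _ hI]
  simp only [integral_const_mul, (h _).2]
  -- The right side has degree at most `m` in `α` as well, so the same weights reproduce it from its
  -- values at the nodes.
  set P : Polynomial ℂ := ∏ j ∈ Finset.range m,
    (Polynomial.C (s + (j : ℂ) / 2) - Polynomial.X) with hP
  have hPdeg : P.natDegree ≤ m := by
    refine (Polynomial.natDegree_prod_le _ _).trans ?_
    refine (Finset.sum_le_card_nsmul _ _ 1 fun j _ => ?_).trans (by simp)
    exact (Polynomial.natDegree_sub_le _ _).trans (by simp)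
  have hPe : ∀ x : ℂ, P.eval x = ∏ j ∈ Finset.range m, (s - x + (j : ℂ) / 2) := by
    intro x
    rw [hP, Polynomial.eval_prod]
    refine Finset.prod_congr rfl fun j _ => ?_
    simp only [Polynomial.eval_sub, Polynomial.eval_C, Polynomial.eval_X]
    ring
  rw [← hPe α, hL P hPdeg, Finset.mul_sum, Finset.sum_mul]
  refine Finset.sum_congr rfl fun j _ => ?_
  rw [hPe]
  ring

/-! ### The limit `s → 0` -/

/-- The factor with `j = 0` is `s Γ(s) = Γ(s+1)`, which removes the pole. For `j ≥ 1` the value at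
`s = 0` is `-(j/2) Γ(j/2) = -Γ(1 + j/2)` up to the power of `π`, giving `m - 1` signs. -/
lemma tendsto_prod_mul_gammaProd (hm : 0 < m) :
    Tendsto (fun s : ℂ => (∏ j ∈ Finset.range m, (s - (j : ℂ) / 2)) * gammaProd m s)
      (𝓝[{s : ℂ | 0 < s.re}] 0) (𝓝 ((-1) ^ (m - 1) * gammaProd m 1)) := by
  obtain ⟨n, rfl⟩ := Nat.exists_eq_succ_of_ne_zero hm.ne'
  set g : ℂ → ℂ := fun s => (∏ j ∈ Finset.range n, (s - ((j + 1 : ℕ) : ℂ) / 2) *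
    ((Real.pi : ℂ) ^ (((j + 1 : ℕ) : ℂ) / 2) * Complex.Gamma (s + ((j + 1 : ℕ) : ℂ) / 2))) *
      Complex.Gamma (s + 1) with hg
  have hcont : ContinuousAt g 0 := by
    have hΓ : ∀ a : ℂ, 0 < a.re → ContinuousAt (fun s : ℂ => Complex.Gamma (s + a)) 0 := by
      intro a ha
      have h1 : ContinuousAt Complex.Gamma (0 + a) := by
        refine (Complex.differentiableAt_Gamma _ fun k hk => ?_).continuousAt
        have := congrArg Complex.re hk
        simp at this
        have h2 : (0 : ℝ) ≤ k := Nat.cast_nonneg k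
        linarith
      exact ContinuousAt.comp (f := fun s : ℂ => s + a) h1 (by fun_prop)
    refine ContinuousAt.mul ?_ (hΓ 1 (by simp))
    refine tendsto_finsetProd _ fun j _ => ?_
    refine ContinuousAt.mul (by fun_prop) (continuousAt_const.mul (hΓ _ ?_))
    simp
    positivity
  have hval : g 0 = (-1) ^ (n.succ - 1) * gammaProd n.succ 1 := by
    have h1 : ∀ j : ℕ, (0 - ((j + 1 : ℕ) : ℂ) / 2) * ((Real.pi : ℂ) ^ (((j + 1 : ℕ) : ℂ) / 2) *
        Complex.Gamma (0 + ((j + 1 : ℕ) : ℂ) / 2)) = (-1) * ((Real.pi : ℂ) ^ (((j + 1 : ℕ) : ℂ) / 2) *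
        Complex.Gamma (1 + ((j + 1 : ℕ) : ℂ) / 2)) := by
      intro j
      have hne : ((j + 1 : ℕ) : ℂ) / 2 ≠ 0 := by
        refine div_ne_zero ?_ two_ne_zero
        exact_mod_cast Nat.succ_ne_zero j
      rw [zero_add, add_comm (1 : ℂ), Complex.Gamma_add_one _ hne]
      ring
    simp only [hg, h1]
    rw [gammaProd, Finset.prod_range_succ', Finset.prod_mul_distrib]
    simp
  have heq : ∀ s ∈ {s : ℂ | 0 < s.re}, g s =
      (∏ j ∈ Finset.range n.succ, (s - (j : ℂ) / 2)) * gammaProd n.succ s := by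
    intro s hs
    have hne : s ≠ 0 := by
      rintro rfl
      simp at hs
    rw [gammaProd, ← Finset.prod_mul_distrib, Finset.prod_range_succ']
    simp only [hg]
    rw [Complex.Gamma_add_one _ hne]
    simp
  rw [← hval]
  refine (hcont.tendsto.mono_left nhdsWithin_le_nhds).congr' ?_
  filter_upwards [self_mem_nhdsWithin] with s hs using heq s hs

/-- For `κ = m + 1` the argument of the gamma function is `(m+1)/2 = 1 + (m-1)/2`, the value that
also appears in the limit and cancels against it. -/
lemma sturmConst_eq {κ : ℤ} (hκ : κ = (m : ℤ) + 1) :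
    sturmConst m κ = ((4 * Real.pi : ℝ) : ℂ) ^ (-(m : ℂ) * (((m : ℂ) + 1) / 2)) * gammaProd m 1 := by
  have h1 : (κ : ℂ) - ((m : ℂ) + 1) / 2 = ((m : ℂ) + 1) / 2 := by
    rw [hκ]; push_cast; ring
  have h2 := siegelGamma_eq (m := m) (s := 1) (by simp)
  rw [show (1 : ℂ) + ((m : ℂ) - 1) / 2 = ((m : ℂ) + 1) / 2 by ring] at h2
  rw [sturmConst, h1, h2]

/-- The image under Sturm's operator of coefficients given by the Maass polynomial. -/
lemma hasSturmCoeff_maassPoly (hm : 0 < m) {κ : ℤ} (hκ : κ = (m : ℤ) + 1)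
    {A : Matrix (Fin m) (Fin m) ℝ → Matrix (Fin m) (Fin m) ℝ → ℂ}
    {T : Matrix (Fin m) (Fin m) ℝ} (hT : T.PosDef) (b : ℂ)
    (hA : ∀ Y : Matrix (Fin m) (Fin m) ℝ, Y.PosDef → A T Y =
      b * maassPoly (((m : ℝ) - 1) / 2) T Y *
        (Real.exp (-(2 * Real.pi) * (T * Y).trace) : ℝ)) :
    HasSturmCoeff κ A T (-1 * (4 * (Real.pi : ℂ)) ^ m * (T.det : ℂ) * b) := by
  have hTd := hT.det_pos
  have hTne : (T.det : ℂ) ≠ 0 := by exact_mod_cast hTd.ne'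
  have hκ' : ∀ s : ℂ, (κ : ℂ) - ((m : ℂ) + 1) / 2 + s = s + (m + 1) / 2 := by
    intro s; rw [hκ]; push_cast; ring
  have hae : ∀ s : ℂ, (fun y : SymIdx m → ℝ => (b * (T.det : ℂ) ^ (s + (m + 1) / 2)) *
      (maassPoly (((m : ℝ) - 1) / 2) T (symMat y) *
      Complex.exp (-(((((4 * Real.pi) • T) * symMat y).trace : ℝ) : ℂ)) *
        ((symMat y).det : ℂ) ^ (s + (m + 1) / 2))) =ᵐ[invMeasure m] sturmIntegrand κ A T s := by
    intro s
    filter_upwards [ae_invMeasure_mem m] with y hy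
    have hY : (symMat y).PosDef := hy
    have hdet : ((T.det * (symMat y).det : ℝ) : ℂ) ^ (s + ((m : ℂ) + 1) / 2) =
        (T.det : ℂ) ^ (s + ((m : ℂ) + 1) / 2) *
          ((symMat y).det : ℂ) ^ (s + ((m : ℂ) + 1) / 2) := by
      rw [Complex.ofReal_mul, Complex.mul_cpow_ofReal_nonneg hTd.le hY.det_pos.le]
    rw [sturmIntegrand, hA _ hY, hκ', det_mul, hdet, smul_mul, trace_smul, smul_eq_mul]
    have : Complex.exp (-((4 * Real.pi * (T * symMat y).trace : ℝ) : ℂ)) =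
        (Real.exp (-(2 * Real.pi) * (T * symMat y).trace) : ℝ) *
          Complex.exp (-(2 * Real.pi * (T * symMat y).trace : ℝ)) := by
      rw [Complex.ofReal_exp, ← Complex.exp_add]
      congr 1
      push_cast
      ring
    rw [this]
    ring
  refine ⟨fun s hs => ((integral_maassPoly hm hT hs _).1.const_mul _).congr (hae s), ?_⟩
  -- At `α = (m-1)/2` the shifts are `-(m-1-j)/2`, the numbers `-j/2` in reverse order; the shift
  -- `0` is among them.
  have hprod : ∀ s : ℂ, ∏ j ∈ Finset.range m, (s - ((((m : ℝ) - 1) / 2 : ℝ) : ℂ) + (j : ℂ) / 2)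
      = ∏ j ∈ Finset.range m, (s - (j : ℂ) / 2) := by
    intro s
    rw [← Finset.prod_range_reflect]
    refine Finset.prod_congr rfl fun j hj => ?_
    have hj' := Finset.mem_range.1 hj
    rw [Nat.sub_sub, Nat.cast_sub (by lia)]
    push_cast
    ring
  have h4pi : (0 : ℝ) < 4 * Real.pi := by positivity
  have h4ne : ((4 * Real.pi : ℝ) : ℂ) ≠ 0 := by exact_mod_cast h4pi.ne'
  have hval : ∀ s ∈ {s : ℂ | 0 < s.re}, ((sturmConst m κ)⁻¹ * b * (-1) ^ m * (T.det : ℂ)) *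
      ((4 * Real.pi : ℝ) : ℂ) ^ (-(m : ℂ) * (s + (m - 1) / 2)) *
      ((∏ j ∈ Finset.range m, (s - (j : ℂ) / 2)) * gammaProd m s) =
      (sturmConst m κ)⁻¹ * ∫ y, sturmIntegrand κ A T s y ∂(invMeasure m) := by
    intro s hs
    have hpow : ∀ w : ℂ, (((4 * Real.pi) ^ m : ℝ) : ℂ) ^ (-w) =
        ((4 * Real.pi : ℝ) : ℂ) ^ (-(m : ℂ) * w) := by
      intro w
      have hp : (((4 * Real.pi) ^ m : ℝ) : ℂ) ≠ 0 := by exact_mod_cast (pow_pos h4pi m).ne'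
      rw [Complex.cpow_def_of_ne_zero hp, Complex.cpow_def_of_ne_zero h4ne,
        ← Complex.ofReal_log (by positivity), ← Complex.ofReal_log h4pi.le, Real.log_pow]
      congr 1
      push_cast
      ring
    have hdet : (((4 * Real.pi) ^ m * T.det : ℝ) : ℂ) ^ (-(s + ((m : ℂ) - 1) / 2)) =
        ((4 * Real.pi : ℝ) : ℂ) ^ (-(m : ℂ) * (s + (m - 1) / 2)) *
          (T.det : ℂ) ^ (-(s + ((m : ℂ) - 1) / 2)) := by
      rw [Complex.ofReal_mul, Complex.mul_cpow_ofReal_nonneg (by positivity) hTd.le, hpow]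
    -- The exponents `s + (m+1)/2` from `det(TY)` and `-(s + (m-1)/2)` from the gamma integral
    -- differ by one in absolute value, for every `s`.
    have hT1 : (T.det : ℂ) ^ (s + ((m : ℂ) + 1) / 2) * (T.det : ℂ) ^ (-(s + ((m : ℂ) - 1) / 2)) =
        T.det := by
      rw [← Complex.cpow_add _ _ hTne]
      ring_nf
      rw [Complex.cpow_one]
    rw [← integral_congr_ae (hae s), integral_const_mul, (integral_maassPoly hm hT hs _).2, hprod,
      det_smul, Fintype.card_fin, hdet]
    linear_combination (-((sturmConst m κ)⁻¹ * b * (-1) ^ m *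
      ((4 * Real.pi : ℝ) : ℂ) ^ (-(m : ℂ) * (s + (m - 1) / 2)) *
      ((∏ j ∈ Finset.range m, (s - (j : ℂ) / 2)) * gammaProd m s))) * hT1
  have hlim : Tendsto (fun s : ℂ => ((sturmConst m κ)⁻¹ * b * (-1) ^ m * (T.det : ℂ)) *
      ((4 * Real.pi : ℝ) : ℂ) ^ (-(m : ℂ) * (s + (m - 1) / 2)) *
      ((∏ j ∈ Finset.range m, (s - (j : ℂ) / 2)) * gammaProd m s)) (𝓝[{s : ℂ | 0 < s.re}] 0)
      (𝓝 (((sturmConst m κ)⁻¹ * b * (-1) ^ m * (T.det : ℂ)) *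
      ((4 * Real.pi : ℝ) : ℂ) ^ (-(m : ℂ) * (0 + (m - 1) / 2)) *
      ((-1) ^ (m - 1) * gammaProd m 1))) := by
    refine Tendsto.mul (Tendsto.mul tendsto_const_nhds ?_) (tendsto_prod_mul_gammaProd hm)
    have : Continuous fun s : ℂ => ((4 * Real.pi : ℝ) : ℂ) ^ (-(m : ℂ) * (s + (m - 1) / 2)) :=
      Continuous.const_cpow (by fun_prop) (Or.inl h4ne)
    exact (this.tendsto 0).mono_left nhdsWithin_le_nhds
  have hfin : ((sturmConst m κ)⁻¹ * b * (-1) ^ m * (T.det : ℂ)) *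
      ((4 * Real.pi : ℝ) : ℂ) ^ (-(m : ℂ) * (0 + (m - 1) / 2)) *
      ((-1) ^ (m - 1) * gammaProd m 1) = -1 * (4 * (Real.pi : ℂ)) ^ m * (T.det : ℂ) * b := by
    have hG : gammaProd m 1 ≠ 0 := gammaProd_ne_zero (by simp)
    have hsign : (-1 : ℂ) ^ m * (-1) ^ (m - 1) = -1 := by
      rw [← pow_add]
      exact Odd.neg_one_pow ⟨m - 1, by lia⟩
    have hpow : ((4 * Real.pi : ℝ) : ℂ) ^ (-(m : ℂ) * (0 + (m - 1) / 2)) =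
        ((4 * Real.pi : ℝ) : ℂ) ^ (-(m : ℂ) * (((m : ℂ) + 1) / 2)) * (4 * (Real.pi : ℂ)) ^ m := by
      rw [show (-(m : ℂ) * (0 + (m - 1) / 2)) = -(m : ℂ) * (((m : ℂ) + 1) / 2) + (m : ℂ) by ring,
        Complex.cpow_add _ _ h4ne, Complex.cpow_natCast]
      push_cast
      rfl
    have hc : ((4 * Real.pi : ℝ) : ℂ) ^ (-(m : ℂ) * (((m : ℂ) + 1) / 2)) ≠ 0 := by
      simp only [ne_eq, Complex.cpow_eq_zero_iff, h4ne, false_and, not_false_eq_true]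
    rw [sturmConst_eq hκ, hpow]
    field_simp
    linear_combination b * hsign
  rw [← hfin]
  refine hlim.congr' ?_
  filter_upwards [self_mem_nhdsWithin] with s hs using hval s hs

end

end SturmScalar

end


/-! ### Sturm's operator on the Maass shift of a cusp form -/

theorem theorem2p1 (m : ℕ) (hm : 2 ≤ m) (κ k : ℤ) (hκ : κ = (m : ℤ) + 1) (hk : k = κ - 2)
    (Γ : Subgroup (Matrix.symplecticGroup (Fin m) ℤ))
    (hΓ : ∀ (γ : Matrix.symplecticGroup (Fin m) ℤ) (B : Matrix (Fin m) (Fin m) ℤ),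
      γ.1 = Matrix.fromBlocks 1 B 0 1 → γ ∈ Γ)
    (h : Matrix (Fin m) (Fin m) ℂ → ℂ) (hh : SturmScalar.IsCuspForm Γ k h)
    (b : SturmScalar.halfIntPos m → ℂ)
    (hb : ∀ Z ∈ SturmScalar.siegelHalfSpace m,
      HasSum (fun T : SturmScalar.halfIntPos m => b T * SturmScalar.expTr T.1 Z) (h Z)) :
    -- the function `Δ₊ h` has a Fourier expansion over positive definite half-integral `T`
    (∀ Z ∈ SturmScalar.siegelHalfSpace m,
      HasSum (fun T : SturmScalar.halfIntPos m =>
          SturmScalar.fourierCoeff (SturmScalar.maassShift k h) T.1 (SturmScalar.imPart Z) *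
            SturmScalar.expTr T.1 (SturmScalar.toC (SturmScalar.rePart Z)))
        (SturmScalar.maassShift k h Z)) ∧
    -- and its image under Sturm's operator of weight `κ` exists and is as claimed
    ∃ a : SturmScalar.halfIntPos m → ℂ,
      (∀ T : SturmScalar.halfIntPos m, SturmScalar.HasSturmCoeff κ
        (SturmScalar.fourierCoeff (SturmScalar.maassShift k h)) T.1 (a T)) ∧
      (∀ T : SturmScalar.halfIntPos m,
        a T = -1 * (4 * (Real.pi : ℂ)) ^ m * (T.1.det : ℂ) * b T) ∧
      ∀ Z ∈ SturmScalar.siegelHalfSpace m,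
        HasSum (fun T : SturmScalar.halfIntPos m => a T * SturmScalar.expTr T.1 Z)
          ((-1) ^ (m + 1) * (2 * Complex.I) ^ m * SturmScalar.detPartialZ h Z) := by
  have hF : SturmScalar.IsFourier b h := hb
  have hα : (k : ℝ) + (1 - m) / 2 = ((m : ℝ) - 1) / 2 := by
    rw [hk, hκ]; push_cast; ring
  refine ⟨fun Z hZ => ?_, _, fun T => ?_, fun T => rfl, fun Z hZ => ?_⟩
  · refine (hF.maassShift k hZ).congr_fun ?_
    intro T
    rw [hF.fourierCoeff_maassShift k T hZ.2, mul_assoc _ (Complex.ofReal _)]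
    congr 1
    have h1 : SturmScalar.imPart (SturmScalar.toC (SturmScalar.rePart Z)) = 0 := by
      ext i j; simp [SturmScalar.imPart, SturmScalar.toC]
    have h2 : SturmScalar.rePart (SturmScalar.toC (SturmScalar.rePart Z))
        = SturmScalar.rePart Z := by
      ext i j; simp [SturmScalar.rePart, SturmScalar.toC]
    rw [SturmScalar.expTr_eq, SturmScalar.expTr_eq, SturmScalar.expRI, SturmScalar.expRI, h1, h2,
      Complex.ofReal_exp, ← Complex.exp_add]
    congr 1
    simp
    ring
  · refine SturmScalar.hasSturmCoeff_maassPoly (by lia) hκ T.2.1 (b T) fun Y hY => ?_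
    rw [hF.fourierCoeff_maassShift k T hY, hα]
  · refine ((hF.detPartialZ Z hZ).mul_left ((-1) ^ (m + 1) * (2 * Complex.I) ^ m)).congr_fun ?_
    intro T
    -- Each of the `m` factors is `(2i)(2πi) = -4π`, and the prefactor `(-1)^(m+1)` leaves a single
    -- sign.
    have h1 : (-1 : ℂ) ^ (m + 1) * (2 * Complex.I) ^ m * (2 * Real.pi * Complex.I) ^ m
        = -1 * (4 * (Real.pi : ℂ)) ^ m := by
      have h2 : (2 * Complex.I) * (2 * Real.pi * Complex.I) = -1 * (4 * (Real.pi : ℂ)) := by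
        linear_combination 4 * (Real.pi : ℂ) * Complex.I_sq
      rw [mul_assoc, ← mul_pow, h2, mul_pow, ← mul_assoc, ← pow_add]
      congr 1
      exact Odd.neg_one_pow ⟨m, by lia⟩
    linear_combination (-(T.1.det : ℂ) * b T * SturmScalar.expTr T.1 Z) * h1
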